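/- Let $H_0=-\Delta$ on $L^2(\mathbb R^3)$ and let $f:\mathbb R\to L^2(\mathbb R^3;\mathbb R)$, $t\mapsto f(\cdot,t)$, be continuous. Consider the Hartree equation $$i\partial_t\psi(t)=H_0\psi(t)+\big[f(\cdot,t)*|\psi(t)|^2\big]\psi(t),\qquad \psi(0)=\psi_0\in L^2(\mathbb R^3;\mathbb C).\tag{1}$$ A (global) solution of (1) is a function $\psi\in C(\mathbb R;L^2(\mathbb R^3))\cap L^{8/3}_{\mathrm{loc}}(\mathbb R;L^4(\mathbb R^3))$ such that $N(s)=[f(\cdot,s)*|\psi(s)|^2]\psi(s)$ belongs to $L^1_{\mathrm{loc}}(\mathbb R;L^2(\mathbb R^3))$ and $$\psi(t)=e^{-itH_0}\psi_0-i\int_0^t e^{-i(t-s)H_0}N(s)\,ds\qquad\text{for all }t\in\mathbb R.$$ 1. Equation (1) is globally well-posed in $L^2$: for every $\psi_0\in L^2(\mathbb R^3)$ it has exactly one global solution $\psi$, and for every $T>0$ the map $\psi_0\mapsto\psi$ is continuous from $L^2(\mathbb R^3)$ to $C([-T,T];L^2(\mathbb R^3))\cap L^{8/3}([-T,T];L^4(\mathbb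 R^3))$. 2. Suppose in addition that $\sup_{t\in\mathbb R}\|f(\cdot,t)\|_{L^2}<\infty$. Then for every $c>0$ and every $M\ge 0$ there is a constant $C<\infty$, depending only on $f$, $c$ and $M$, such that for every $\psi_0\in L^1(\mathbb R^3)\cap L^2(\mathbb R^3)$ with $\|\psi_0\|_{L^1}\le M$ and $\|\psi_0\|_{L^2}\le M$ the solution $\psi$ of (1) satisfies $$\sup_{|t|\ge c}\|\psi(t)\|_{L^\infty}\le C.$$ -/

import Mathlib

open MeasureTheory FourierTransform
open scoped ENNReal NNReal Convolution

noncomputable section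

namespace Hartree

/-- Physical space `ℝ³` with its Euclidean norm and Lebesgue measure. -/
abbrev Space : Type := EuclideanSpace ℝ (Fin 3)

/-- Complex valued `L²(ℝ³)`. -/
abbrev L2 : Type := Lp ℂ 2 (volume : Measure Space)

/-- Real valued `L²(ℝ³)`. -/
abbrev RealL2 : Type := Lp ℝ 2 (volume : Measure Space)

/-- The Fourier symbol `exp (-i t |2πξ|²)` of `exp (-i t H₀)`, `H₀ = -Δ`; the Fourier transform of
Mathlib has the kernel `exp (-2πi ⟨x, ξ⟩)`, so that `-Δ` has the symbol `(2π|ξ|)²`. -/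
def freeSymbol (t : ℝ) (ξ : Space) : ℂ :=
  Complex.exp (-(Complex.I * (t : ℂ) * (((2 * Real.pi * ‖ξ‖) ^ 2 : ℝ) : ℂ)))

theorem norm_freeSymbol (t : ℝ) (ξ : Space) : ‖freeSymbol t ξ‖ = 1 := by
  have h : -(Complex.I * (t : ℂ) * (((2 * Real.pi * ‖ξ‖) ^ 2 : ℝ) : ℂ))
      = ((-(t * (2 * Real.pi * ‖ξ‖) ^ 2) : ℝ) : ℂ) * Complex.I := by
    push_cast; ring
  rw [freeSymbol, h, Complex.norm_exp_ofReal_mul_I]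

theorem continuous_freeSymbol (t : ℝ) : Continuous (freeSymbol t) := by
  unfold freeSymbol
  fun_prop

theorem memLp_freeSymbol_mul (t : ℝ) (u : L2) :
    MemLp (fun ξ => freeSymbol t ξ * u ξ) 2 (volume : Measure Space) := by
  refine (Lp.memLp u).of_le
    ((continuous_freeSymbol t).aestronglyMeasurable.mul (Lp.aestronglyMeasurable u)) ?_
  exact Filter.Eventually.of_forall fun ξ => by simp [norm_freeSymbol]

/-- The free propagator `exp (-i t H₀)` on `L²(ℝ³)`. -/
def freeFlow (t : ℝ) (u : L2) : L2 :=
  𝓕⁻ ((memLp_freeSymbol_mul t (𝓕 u)).toLp (fun ξ => freeSymbol t ξ * (𝓕 u : L2) ξ))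

theorem freeFlow_zero (u : L2) : freeFlow 0 u = u := by
  have h : (memLp_freeSymbol_mul 0 (𝓕 u)).toLp (fun ξ => freeSymbol 0 ξ * (𝓕 u : L2) ξ)
      = (𝓕 u : L2) := by
    apply Lp.ext
    filter_upwards [(memLp_freeSymbol_mul 0 (𝓕 u)).coeFn_toLp] with ξ hξ
    rw [hξ]
    simp [freeSymbol]
  rw [freeFlow, h]
  exact FourierPair.fourierInv_fourier_eq u

/-- The nonlinear term `(g * |u|²)(x) u(x)`, where `(g * |u|²)(x) = ∫ g(y) |u(x - y)|² dy`. -/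
def hartreeTerm (g : Space → ℝ) (u : Space → ℂ) (x : Space) : ℂ :=
  ((g ⋆[ContinuousLinearMap.mul ℝ ℝ, volume] fun y => ‖u y‖ ^ 2) x : ℂ) * u x

/-- `∫_{-T}^{T} ‖u(t)‖_{L⁴}^{8/3} dt`, the `8/3`-th power of the norm of
`L^{8/3}([-T, T]; L⁴(ℝ³))`. -/
def strichartzIntegral (T : ℝ) (u : ℝ → L2) : ℝ≥0∞ :=
  ∫⁻ t in Set.Icc (-T) T, eLpNorm (u t) 4 volume ^ (8 / 3 : ℝ)

/-- `ψ` is a global solution of `i ∂ₜψ = H₀ψ + (f(t) * |ψ|²) ψ`, `ψ(0) = ψ₀`, in the class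
`C(ℝ; L²) ∩ L^{8/3}_loc(ℝ; L⁴)`: it satisfies Duhamel's formula
`ψ(t) = e^{-itH₀} ψ₀ - i ∫₀ᵗ e^{-i(t-s)H₀} N(s) ds`, `N(s) = (f(s) * |ψ(s)|²) ψ(s)`,
where `N` is locally Bochner integrable with values in `L²`. -/
structure IsSolution (f : ℝ → RealL2) (ψ₀ : L2) (ψ : ℝ → L2) : Prop where
  continuous : Continuous ψ
  strichartz : ∀ T : ℝ, strichartzIntegral T ψ < ∞
  duhamel : ∃ N : ℝ → L2,
    (∀ᵐ s : ℝ, (N s : Space → ℂ) =ᵐ[volume] hartreeTerm (f s) (ψ s)) ∧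
    LocallyIntegrable N ∧
    ∀ t : ℝ, IntervalIntegrable (fun s => freeFlow (t - s) (N s)) volume 0 t ∧
      ψ t = freeFlow t ψ₀ - Complex.I • ∫ s in (0 : ℝ)..t, freeFlow (t - s) (N s)

theorem IsSolution.initial {f : ℝ → RealL2} {ψ₀ : L2} {ψ : ℝ → L2} (h : IsSolution f ψ₀ ψ) :
    ψ 0 = ψ₀ := by
  obtain ⟨N, -, -, hN⟩ := h.duhamel
  simpa [freeFlow_zero] using (hN 0).2

/-- Global well-posedness in `L²`: every `ψ₀ ∈ L²` has exactly one global solution, and the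
solution depends continuously on `ψ₀`, from `L²` to `C([-T, T]; L²) ∩ L^{8/3}([-T, T]; L⁴)` for
every `T`. -/
structure GloballyWellPosed (f : ℝ → RealL2) : Prop where
  existsUnique : ∀ ψ₀ : L2, ∃! ψ : ℝ → L2, IsSolution f ψ₀ ψ
  continuousDependence : ∀ (ψ₀ : L2) (ψ : ℝ → L2), IsSolution f ψ₀ ψ →
    ∀ T : ℝ, ∀ ε : ℝ≥0, 0 < ε → ∃ δ : ℝ, 0 < δ ∧
      ∀ (φ₀ : L2) (φ : ℝ → L2), IsSolution f φ₀ φ → ‖φ₀ - ψ₀‖ < δ →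
        (∀ t ∈ Set.Icc (-T) T, ‖φ t - ψ t‖ < ε) ∧
        strichartzIntegral T (fun t => φ t - ψ t) < ε

end Hartree

end

noncomputable section

namespace Hartree

open Filter Topology

/-! ### General facts on `Lᵖ` spaces -/

/-! Write `φ(t) = e^{itH₀}ψ(t)`. In this interaction picture Duhamel's formula becomes `φ(t) - φ(s)
= ∫ source`, and all estimates are estimates of `source`.

Well-posedness rests on two facts. Cauchy-Schwarz gives `‖f * |ψ|²‖_∞ ≤ ‖f‖₂ ‖ψ‖₄²`, so the
nonlinearity is bounded in `L²` by `‖f‖₂ ‖ψ‖₄² ‖ψ‖₂`, and it is Lipschitz in `L²` with a similar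
weight (`enorm_nonlin_sub_le`). The Strichartz estimate for the admissible pair `(8/3, 4)` controls
the weight: on an interval `J` the integral of `‖ψ‖₄²` is at most the square of the Strichartz norm
times `|J|^{1/4}`. Since the nonlinearity is placed in `L¹(L²)`, the inhomogeneous estimate follows
from the homogeneous one by Minkowski's inequality. A contraction then solves the equation on
intervals whose length depends only on bounds for `‖f‖₂` and `‖ψ‖₂` (`exists_picardMap_eq`). The
potential is real, so the mass is conserved (`IsMild.norm_eq`), the step length does not shrink, and
the local solutions are glued into a global one. Iterating `IsMild.stability` over the steps gives
continuous dependence.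

For the `L^∞` bound, fix the final time `t` and follow `‖e^{-itH₀}φ(s)‖_∞` as `s` runs from `0` to
`t`. While `|t - s| ≥ δ`, the dispersive estimate applies: the nonlinearity is bounded in `L¹` by
`‖f‖₂ ‖ψ‖₂³`, and `|t - s|^{-3/2}` is integrable there. Near `s = t` that decay is not integrable
and another mechanism takes over. The Fourier transform of `f * |ψ|²` is a product of two `L²`
functions, hence lies in `L¹`, so the potential is a superposition of plane waves of total weight at
most `‖f‖₂ ‖ψ‖₄²`. By Galilean covariance `e^{-iτH₀}` carries multiplication by a plane wave to a
modulation composed with a translation, an isometry of every `Lᵖ`. Hence `‖e^{-iτH₀}(Vu)‖_∞ ≤ ‖V̂‖₁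
‖e^{-iτH₀}u‖_∞` with no singularity at `τ = 0` (`eLpNorm_freeFlow_nonlin_le`), and on a short
interval the followed norm at most doubles. -/

/-- Fatou along an almost everywhere convergent subsequence. The `L⁴` and `L^∞` norms are not
continuous on `L²`, but this lower semicontinuity suffices to measure them in time and to pass
bounds to `L²` limits. -/
theorem isClosed_setOf_eLpNorm_le (p c : ℝ≥0∞) : IsClosed {v : L2 | eLpNorm v p volume ≤ c} := by
  refine IsSeqClosed.isClosed fun v w hv hvw => ?_
  obtain ⟨ns, -, hns⟩ := (tendstoInMeasure_of_tendsto_Lp hvw).exists_seq_tendsto_ae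
  refine (Lp.eLpNorm_lim_le_liminf_eLpNorm
    (fun n => Lp.aestronglyMeasurable (v (ns n))) _ hns).trans ?_
  exact (liminf_le_limsup).trans
    (limsup_le_of_le (by isBoundedDefault) (Eventually.of_forall fun n => hv (ns n)))

theorem lowerSemicontinuous_eLpNorm (p : ℝ≥0∞) :
    LowerSemicontinuous fun v : L2 => eLpNorm v p volume := by
  rw [lowerSemicontinuous_iff_isClosed_preimage]
  exact fun c => isClosed_setOf_eLpNorm_le p c

theorem measurable_eLpNorm_comp (p : ℝ≥0∞) {α : Type*} [TopologicalSpace α] [MeasurableSpace α]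
    [OpensMeasurableSpace α] {ψ : α → L2} (hψ : Continuous ψ) :
    Measurable fun t => eLpNorm (ψ t) p volume :=
  ((lowerSemicontinuous_eLpNorm p).comp hψ).measurable

theorem eLpNorm_le_liminf (p : ℝ≥0∞) {v : ℕ → L2} {w : L2} (h : Tendsto v atTop (𝓝 w)) :
    eLpNorm w p volume ≤ liminf (fun n => eLpNorm (v n) p volume) atTop :=
  le_of_forall_lt fun y hy => by
    obtain ⟨z, hyz, hz⟩ := exists_between hy
    exact hyz.trans_le (le_liminf_of_le (by isBoundedDefault)
      ((h.eventually (lowerSemicontinuous_eLpNorm p w z hz)).mono fun _ => le_of_lt))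

theorem enorm_eq_eLpNorm (v : L2) : ‖v‖ₑ = eLpNorm v 2 volume := Lp.enorm_def v

theorem eLpNorm_add_coe_le (p : ℝ≥0∞) (hp : 1 ≤ p) (u v : L2) :
    eLpNorm (u + v : L2) p volume ≤ eLpNorm u p volume + eLpNorm v p volume := by
  rw [eLpNorm_congr_ae (Lp.coeFn_add u v)]
  exact eLpNorm_add_le (Lp.aestronglyMeasurable u) (Lp.aestronglyMeasurable v) hp

theorem eLpNorm_smul_coe (p : ℝ≥0∞) (c : ℂ) (u : L2) :
    eLpNorm (c • u : L2) p volume = ‖c‖ₑ * eLpNorm u p volume := by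
  rw [eLpNorm_congr_ae (Lp.coeFn_smul c u)]
  exact eLpNorm_const_smul c _ _ _

/-- Dominated convergence in `L²`. -/
theorem tendsto_toLp_of_dominated {ι : Type*} {l : Filter ι} [l.IsCountablyGenerated]
    {F : ι → Space → ℂ} {G : Space → ℂ} (hF : ∀ i, MemLp (F i) 2 volume) (hG : MemLp G 2 volume)
    {b : Space → ℂ} (hb : MemLp b 2 volume) (hFb : ∀ i, ∀ᵐ x, ‖F i x‖ ≤ ‖b x‖)
    (hlim : ∀ᵐ x, Tendsto (fun i => F i x) l (𝓝 (G x))) :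
    Tendsto (fun i => (hF i).toLp (F i)) l (𝓝 (hG.toLp G)) := by
  rw [Lp.tendsto_Lp_iff_tendsto_eLpNorm'']
  have key : Tendsto (fun i => ∫⁻ x, ‖(F i - G) x‖ₑ ^ (2 : ℝ)) l (𝓝 0) := by
    have h0 : (0 : ℝ≥0∞) = ∫⁻ x : Space, 0 := by simp
    rw [h0]
    refine tendsto_lintegral_filter_of_dominated_convergence'
      (fun x => (‖b x‖ₑ + ‖G x‖ₑ) ^ (2 : ℝ))
      (Eventually.of_forall fun i => ?_) (Eventually.of_forall fun i => ?_) ?_ ?_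
    · exact ((hF i).1.sub hG.1).enorm.pow_const _
    · filter_upwards [hFb i] with x hx
      refine ENNReal.rpow_le_rpow ((enorm_sub_le).trans ?_) (by norm_num)
      gcongr
      exact enorm_le_iff_norm_le.mpr hx
    · have h := (hb.norm.add hG.norm).2
      rw [eLpNorm_lt_top_iff_lintegral_rpow_enorm_lt_top (by norm_num) (by norm_num)] at h
      refine (lt_of_le_of_lt (le_of_eq ?_) h).ne
      refine lintegral_congr fun x => ?_
      have h1 : ‖b x‖ₑ + ‖G x‖ₑ = ‖‖b x‖ + ‖G x‖‖ₑ := by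
        rw [← ofReal_norm, ← ofReal_norm, ← ofReal_norm,
          Real.norm_of_nonneg (by positivity), ENNReal.ofReal_add (by positivity) (by positivity)]
      simp only [Pi.add_apply, h1, ENNReal.toReal_ofNat]
    · filter_upwards [hlim] with x hx
      have h2 : Tendsto (fun i => ‖(F i - G) x‖ₑ) l (𝓝 0) := by
        have := (hx.sub_const (G x)).enorm
        simpa using this
      have h3 := h2.ennrpow_const (2 : ℝ)
      simpa using h3
  have h4 := key.ennrpow_const (1 / 2 : ℝ)
  refine (h4.congr fun i => ?_).trans (by simp)
  rw [eLpNorm_eq_lintegral_rpow_enorm_toReal (by norm_num) (by norm_num)]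
  simp

/-- Bounds of the `L^∞` norm by duality with `L¹ ∩ L²`. -/
theorem eLpNorm_top_le_of_inner_le {v : L2} {C : ℝ≥0}
    (h : ∀ φ : L2, MemLp φ 1 volume → ‖inner ℂ φ v‖ₑ ≤ C * eLpNorm φ 1 volume) :
    eLpNorm v ∞ volume ≤ C := by
  obtain ⟨w, hwm, hvw⟩ := Lp.aestronglyMeasurable v
  have key : ∀ R : ℕ, volume ({x | (C : ℝ) < ‖w x‖} ∩ Metric.ball (0 : Space) R) = 0 := by
    intro R
    set E := {x | (C : ℝ) < ‖w x‖} ∩ Metric.ball (0 : Space) R with hE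
    have hEm : MeasurableSet E :=
      (measurableSet_lt measurable_const hwm.norm.measurable).inter measurableSet_ball
    have hEf : volume E < ∞ := (measure_mono Set.inter_subset_right).trans_lt measure_ball_lt_top
    -- The phase of `w` on the bad set `E`: its `L¹` norm is the measure of `E`, while its pairing
    -- with `v` is `∫_E ‖w‖`, which would exceed `C` times that measure. The ball keeps `E` of
    -- finite measure.
    set g : Space → ℂ := E.indicator fun x => ((‖w x‖ : ℂ)⁻¹ * w x) with hg
    have hgm : AEStronglyMeasurable g volume := by
      refine (StronglyMeasurable.indicator ?_ hEm).aestronglyMeasurable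
      exact (Complex.continuous_ofReal.comp_stronglyMeasurable hwm.norm).inv₀.mul hwm
    have hgn : ∀ x, ‖g x‖ = E.indicator (fun _ => (1 : ℝ)) x := by
      intro x
      by_cases hx : x ∈ E
      · have : ‖w x‖ ≠ 0 := (lt_of_le_of_lt C.2 hx.1).ne'
        simp [hg, hx, this]
      · simp [hg, hx]
    have hi : ∀ p : ℝ≥0∞, MemLp (E.indicator (fun _ => (1 : ℝ))) p (volume : Measure Space) :=
      fun p => memLp_indicator_const p hEm 1 (Or.inr hEf.ne)
    have hgp : ∀ p : ℝ≥0∞, MemLp g p volume := fun p =>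
      (hi p).of_le hgm (Eventually.of_forall fun x => by
        rw [hgn]; exact le_abs_self _)
    have h1 := h ((hgp 2).toLp g) ((memLp_congr_ae (hgp 2).coeFn_toLp).mpr (hgp 1))
    rw [eLpNorm_congr_ae (hgp 2).coeFn_toLp] at h1
    have h2 : eLpNorm g 1 volume = volume E := by
      rw [eLpNorm_one_eq_lintegral_enorm]
      have : ∀ x, ‖g x‖ₑ = E.indicator (fun _ => (1 : ℝ≥0∞)) x := by
        intro x
        rw [← ofReal_norm, hgn]
        by_cases hx : x ∈ E <;> simp [hx]
      simp [this, lintegral_indicator hEm]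
    have h3 : inner ℂ ((hgp 2).toLp g) v = ((∫ x in E, ‖w x‖ : ℝ) : ℂ) := by
      rw [L2.inner_def, ← integral_indicator hEm, ← integral_complex_ofReal]
      refine integral_congr_ae ?_
      filter_upwards [(hgp 2).coeFn_toLp, hvw] with x hx hx'
      rw [hx, hx']
      by_cases hxE : x ∈ E
      · have : (‖w x‖ : ℂ) ≠ 0 := by
          exact_mod_cast (lt_of_le_of_lt C.2 hxE.1).ne'
        simp only [hg, hxE, Set.indicator_of_mem, RCLike.inner_apply, map_mul, map_inv₀,
          Complex.conj_ofReal]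
        have h5 : w x * (starRingEnd ℂ) (w x) = (‖w x‖ : ℂ) ^ 2 := Complex.mul_conj' _
        field_simp
        rw [h5]
      · simp [hg, hxE]
    rw [h2, h3] at h1
    by_contra hne
    have hwi : IntegrableOn (fun x => ‖w x‖) E volume := by
      have h6 : MemLp w 2 volume := (memLp_congr_ae hvw).mp (Lp.memLp v)
      have : IsFiniteMeasure (volume.restrict E) := ⟨by simpa using hEf⟩
      exact ((h6.restrict E).integrable (by norm_num)).norm
    have h7 : (C : ℝ) * (volume E).toReal < ∫ x in E, ‖w x‖ := by
      have hc : ∫ x in E, (C : ℝ) = C * (volume E).toReal := by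
        rw [setIntegral_const]; simp [Measure.real, mul_comm]
      rw [← hc, ← sub_pos, ← integral_sub hwi (integrableOn_const hEf.ne)]
      rw [setIntegral_pos_iff_support_of_nonneg_ae]
      · refine lt_of_lt_of_le (pos_iff_ne_zero.mpr hne) (measure_mono fun x hx => ⟨?_, hx⟩)
        have := hx.1
        simp only [Function.mem_support]
        exact (sub_pos.mpr this).ne'
      · filter_upwards [ae_restrict_mem hEm] with x hx
        exact (sub_pos.mpr hx.1).le
      · exact hwi.sub (integrableOn_const hEf.ne)
    have h8 : ‖((∫ x in E, ‖w x‖ : ℝ) : ℂ)‖ₑ = ENNReal.ofReal (∫ x in E, ‖w x‖) := by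
      rw [← ofReal_norm, Complex.norm_real,
        Real.norm_of_nonneg (integral_nonneg fun _ => norm_nonneg _)]
    rw [h8] at h1
    have h9 : (C : ℝ≥0∞) * volume E = ENNReal.ofReal (C * (volume E).toReal) := by
      rw [ENNReal.ofReal_mul C.coe_nonneg, ENNReal.ofReal_toReal hEf.ne, ENNReal.ofReal_coe_nnreal]
    rw [h9] at h1
    exact absurd h1 (not_le.mpr ((ENNReal.ofReal_lt_ofReal_iff_of_nonneg (by positivity)).mpr h7))
  have h0 : volume {x | (C : ℝ) < ‖w x‖} = 0 := by
    have : {x | (C : ℝ) < ‖w x‖} = ⋃ R : ℕ, {x | (C : ℝ) < ‖w x‖} ∩ Metric.ball (0 : Space) R := by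
      rw [← Set.inter_iUnion, Metric.iUnion_ball_nat, Set.inter_univ]
    rw [this]
    exact measure_iUnion_null key
  rw [eLpNorm_congr_ae hvw, eLpNorm_exponent_top]
  refine eLpNormEssSup_le_of_ae_nnnorm_bound ?_
  rw [ae_iff]
  refine measure_mono_null (fun x hx => ?_) h0
  exact lt_of_not_ge hx

theorem enorm_inner_le_eLpNorm {p q : ℝ≥0∞} [hpq : ENNReal.HolderTriple p q 1] (φ v : L2) :
    ‖inner ℂ φ v‖ₑ ≤ eLpNorm φ p volume * eLpNorm v q volume := by
  rw [L2.inner_def]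
  refine (enorm_integral_le_lintegral_enorm _).trans ?_
  have h1 := eLpNorm_smul_le_mul_eLpNorm (p := p) (q := q) (r := 1) (Lp.aestronglyMeasurable v)
      (Lp.aestronglyMeasurable φ)
  rw [eLpNorm_one_eq_lintegral_enorm] at h1
  have h2 : ∀ x, ‖inner ℂ (φ x) (v x)‖ₑ = ‖(⇑φ • ⇑v) x‖ₑ := fun x => by
    rw [Pi.smul_apply', enorm_smul, RCLike.inner_apply, enorm_mul, mul_comm, RCLike.enorm_conj]
  simpa only [h2] using h1

/-- Minkowski's inequality for the `L^∞` norm. -/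
theorem eLpNorm_top_integral_le {α : Type*} [MeasurableSpace α] {μ : Measure α} {F : α → L2}
    (hF : Integrable F μ) {k : α → ℝ≥0∞}
    (hk : ∀ᵐ s ∂μ, eLpNorm (F s) ∞ volume ≤ k s) {C : ℝ≥0} (hC : ∫⁻ s, k s ∂μ ≤ C) :
    eLpNorm (∫ s, F s ∂μ : L2) ∞ volume ≤ C := by
  refine eLpNorm_top_le_of_inner_le fun φ hφ => ?_
  rw [← integral_inner hF φ]
  refine (enorm_integral_le_lintegral_enorm _).trans ?_
  calc ∫⁻ s, ‖inner ℂ φ (F s)‖ₑ ∂μ ≤ ∫⁻ s, eLpNorm φ 1 volume * k s ∂μ := by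
        refine lintegral_mono_ae ?_
        filter_upwards [hk] with s hs
        exact (enorm_inner_le_eLpNorm (p := 1) (q := ∞) φ (F s)).trans (by gcongr)
    _ = eLpNorm φ 1 volume * ∫⁻ s, k s ∂μ := lintegral_const_mul' _ _ hφ.2.ne
    _ ≤ C * eLpNorm φ 1 volume := by rw [mul_comm]; gcongr

/-! ### The Fourier transform on `L¹ ∩ L²` -/

/-- Both sides define the same distribution. Paired with a test function, the transform moves onto
the test function, by Fubini for the integral and through tempered distributions for the `L²`
transform. -/
theorem fourier_coeFn_ae_eq {u : L2} (hu : Integrable (u : Space → ℂ)) :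
    ((𝓕 u : L2) : Space → ℂ) =ᵐ[volume] 𝓕 (u : Space → ℂ) := by
  have hc : Continuous (𝓕 (u : Space → ℂ)) :=
    VectorFourier.fourierIntegral_continuous (L := innerₗ Space) Real.continuous_fourierChar
      continuous_inner hu
  refine ae_eq_of_integral_contDiff_smul_eq ((Lp.memLp _).locallyIntegrable (by norm_num))
    hc.locallyIntegrable fun g hg hgc => ?_
  have hg' : ContDiff ℝ (⊤ : ℕ∞) fun x => (g x : ℂ) := Complex.ofRealCLM.contDiff.comp hg
  have hgc' : HasCompactSupport fun x => (g x : ℂ) := hgc.comp_left Complex.ofReal_zero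
  set G : SchwartzMap Space ℂ := hgc'.toSchwartzMap hg' with hG
  have hGx : ∀ x, G x = (g x : ℂ) := fun x => rfl
  have h1 := congrArg (fun T => T G) (Lp.fourier_toTemperedDistribution_eq u)
  simp only [TemperedDistribution.fourier_apply, Lp.toTemperedDistribution_apply] at h1
  have h2 := VectorFourier.integral_fourierIntegral_smul_eq_flip (L := innerₗ Space) (μ := volume)
    (ν := volume) Real.continuous_fourierChar continuous_inner G.integrable hu
  have h3 : ∫ x, (𝓕 G) x • u x = ∫ x, G x • 𝓕 (u : Space → ℂ) x := by
    refine h2.trans (integral_congr_ae (Eventually.of_forall fun x => ?_))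
    simp only [flip_innerₗ]
    rfl
  rw [h3] at h1
  simp only [hGx, smul_eq_mul, Complex.real_smul] at h1 ⊢
  exact h1.symm

theorem fourierInv_coeFn_ae_eq {u : L2} (hu : Integrable (u : Space → ℂ)) :
    ((𝓕⁻ u : L2) : Space → ℂ) =ᵐ[volume] 𝓕⁻ (u : Space → ℂ) := by
  have hc : Continuous (𝓕⁻ (u : Space → ℂ)) := by
    rw [Real.fourierInv_eq_fourier_comp_neg]
    exact VectorFourier.fourierIntegral_continuous (L := innerₗ Space) Real.continuous_fourierChar
      continuous_inner hu.comp_neg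
  refine ae_eq_of_integral_contDiff_smul_eq ((Lp.memLp _).locallyIntegrable (by norm_num))
    hc.locallyIntegrable fun g hg hgc => ?_
  have hg' : ContDiff ℝ (⊤ : ℕ∞) fun x => (g x : ℂ) := Complex.ofRealCLM.contDiff.comp hg
  have hgc' : HasCompactSupport fun x => (g x : ℂ) := hgc.comp_left Complex.ofReal_zero
  set G : SchwartzMap Space ℂ := hgc'.toSchwartzMap hg' with hG
  have hGx : ∀ x, G x = (g x : ℂ) := fun x => rfl
  have h1 := congrArg (fun T => T G) (Lp.fourierInv_toTemperedDistribution_eq u)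
  simp only [TemperedDistribution.fourierInv_apply, Lp.toTemperedDistribution_apply] at h1
  have h2 := VectorFourier.integral_fourierIntegral_smul_eq_flip (L := -innerₗ Space) (μ := volume)
    (ν := volume) Real.continuous_fourierChar continuous_inner.neg G.integrable hu
  have h3 : ∫ x, (𝓕⁻ G) x • u x = ∫ x, G x • 𝓕⁻ (u : Space → ℂ) x := by
    rw [SchwartzMap.fourierInv_coe]
    refine h2.trans (integral_congr_ae (Eventually.of_forall fun x => ?_))
    rw [show ((-innerₗ Space).flip) = -innerₗ Space by ext; simp [real_inner_comm]]
    rfl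
  rw [h3] at h1
  simp only [hGx, smul_eq_mul, Complex.real_smul] at h1 ⊢
  exact h1.symm

/-! ### The free propagator -/

/-- The Fourier side of the free propagator. -/
def symbolMul (t : ℝ) (v : L2) : L2 :=
  (memLp_freeSymbol_mul t v).toLp (fun ξ => freeSymbol t ξ * v ξ)

theorem symbolMul_coe (t : ℝ) (v : L2) :
    (symbolMul t v : Space → ℂ) =ᵐ[volume] fun ξ => freeSymbol t ξ * v ξ :=
  (memLp_freeSymbol_mul t v).coeFn_toLp

theorem freeFlow_eq (t : ℝ) (u : L2) : freeFlow t u = 𝓕⁻ (symbolMul t (𝓕 u)) := rfl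

theorem fourier_freeFlow (t : ℝ) (u : L2) : 𝓕 (freeFlow t u) = symbolMul t (𝓕 u) := by
  rw [freeFlow_eq]; exact FourierInvPair.fourier_fourierInv_eq _

theorem symbolMul_add (t : ℝ) (u v : L2) : symbolMul t (u + v) = symbolMul t u + symbolMul t v := by
  apply Lp.ext
  filter_upwards [symbolMul_coe t (u + v), symbolMul_coe t u, symbolMul_coe t v,
    Lp.coeFn_add u v, Lp.coeFn_add (symbolMul t u) (symbolMul t v)] with x h1 h2 h3 h4 h5
  rw [h1, h5, Pi.add_apply, h2, h3, h4, Pi.add_apply, mul_add]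

theorem symbolMul_smul (t : ℝ) (c : ℂ) (u : L2) : symbolMul t (c • u) = c • symbolMul t u := by
  apply Lp.ext
  filter_upwards [symbolMul_coe t (c • u), symbolMul_coe t u,
    Lp.coeFn_smul c u, Lp.coeFn_smul c (symbolMul t u)] with x h1 h2 h3 h4
  rw [h1, h4, Pi.smul_apply, h2, h3, Pi.smul_apply, smul_eq_mul, smul_eq_mul]
  ring

theorem norm_symbolMul (t : ℝ) (u : L2) : ‖symbolMul t u‖ = ‖u‖ := by
  rw [Lp.norm_def, Lp.norm_def]
  congr 1
  refine eLpNorm_congr_norm_ae ?_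
  filter_upwards [symbolMul_coe t u] with x hx
  rw [hx, norm_mul, norm_freeSymbol, one_mul]

/-- The free propagator as a linear isometry. -/
def freeFlowₗᵢ (t : ℝ) : L2 →ₗᵢ[ℂ] L2 where
  toFun := freeFlow t
  map_add' u v := by
    simp only [freeFlow_eq]
    rw [FourierAdd.fourier_add, symbolMul_add, FourierInvAdd.fourierInv_add]
  map_smul' c u := by
    simp only [freeFlow_eq, RingHom.id_apply]
    rw [FourierSMul.fourier_smul, symbolMul_smul, FourierInvSMul.fourierInv_smul]
  norm_map' u := by
    change ‖freeFlow t u‖ = ‖u‖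
    rw [← Lp.norm_fourier_eq, fourier_freeFlow, norm_symbolMul, Lp.norm_fourier_eq]

theorem freeFlow_add (t : ℝ) (u v : L2) : freeFlow t (u + v) = freeFlow t u + freeFlow t v :=
  (freeFlowₗᵢ t).map_add u v

theorem freeFlow_sub (t : ℝ) (u v : L2) : freeFlow t (u - v) = freeFlow t u - freeFlow t v :=
  (freeFlowₗᵢ t).map_sub u v

theorem freeFlow_smul (t : ℝ) (c : ℂ) (u : L2) : freeFlow t (c • u) = c • freeFlow t u :=
  (freeFlowₗᵢ t).map_smul c u

theorem freeFlow_map_zero (t : ℝ) : freeFlow t 0 = 0 := (freeFlowₗᵢ t).map_zero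

theorem norm_freeFlow (t : ℝ) (u : L2) : ‖freeFlow t u‖ = ‖u‖ := (freeFlowₗᵢ t).norm_map u

theorem enorm_freeFlow (t : ℝ) (u : L2) : ‖freeFlow t u‖ₑ = ‖u‖ₑ := by
  rw [← ofReal_norm, norm_freeFlow, ofReal_norm]

theorem freeSymbol_add (s t : ℝ) (ξ : Space) :
    freeSymbol (s + t) ξ = freeSymbol s ξ * freeSymbol t ξ := by
  simp only [freeSymbol]
  rw [← Complex.exp_add]
  congr 1
  push_cast
  ring

theorem freeFlow_freeFlow (s t : ℝ) (u : L2) : freeFlow s (freeFlow t u) = freeFlow (s + t) u := by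
  rw [freeFlow_eq, fourier_freeFlow, freeFlow_eq]
  congr 1
  apply Lp.ext
  filter_upwards [symbolMul_coe s (symbolMul t (𝓕 u)), symbolMul_coe t (𝓕 u),
    symbolMul_coe (s + t) (𝓕 u)] with x h1 h2 h3
  rw [h1, h2, h3, freeSymbol_add, mul_assoc]

theorem freeFlow_neg_freeFlow (t : ℝ) (u : L2) : freeFlow (-t) (freeFlow t u) = u := by
  rw [freeFlow_freeFlow, neg_add_cancel, freeFlow_zero]

theorem freeFlow_freeFlow_neg (t : ℝ) (u : L2) : freeFlow t (freeFlow (-t) u) = u := by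
  rw [freeFlow_freeFlow, add_neg_cancel, freeFlow_zero]

theorem inner_freeFlow (t : ℝ) (u v : L2) :
    inner ℂ (freeFlow t u) (freeFlow t v) = inner ℂ u v := (freeFlowₗᵢ t).inner_map_map u v

theorem inner_freeFlow_left (t : ℝ) (u v : L2) :
    inner ℂ (freeFlow t u) v = inner ℂ u (freeFlow (-t) v) := by
  rw [← inner_freeFlow t u, freeFlow_freeFlow_neg]

theorem continuous_freeFlow_time (u : L2) : Continuous fun t => freeFlow t u := by
  have h : Continuous fun t => symbolMul t (𝓕 u) := by
    refine continuous_iff_continuousAt.mpr fun t => ?_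
    refine tendsto_toLp_of_dominated (fun s => memLp_freeSymbol_mul s (𝓕 u))
      (memLp_freeSymbol_mul t (𝓕 u)) (Lp.memLp (𝓕 u)) (fun s => ?_) ?_
    · exact Eventually.of_forall fun x => by rw [norm_mul, norm_freeSymbol, one_mul]
    · refine Eventually.of_forall fun x => Tendsto.mul_const _ ?_
      have : Continuous fun s => freeSymbol s x := by unfold freeSymbol; fun_prop
      exact this.tendsto t
  exact (ContinuousFourierInv.continuous_fourierInv (E := L2)).comp h

/-- Strong continuity in time upgrades to joint continuity because each `freeFlow t` is an isometry.
-/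
theorem continuous_freeFlow : Continuous fun p : ℝ × L2 => freeFlow p.1 p.2 := by
  refine continuous_iff_continuousAt.mpr fun ⟨t, u⟩ => ?_
  rw [ContinuousAt, tendsto_iff_norm_sub_tendsto_zero]
  have h1 : Tendsto (fun p : ℝ × L2 => ‖p.2 - u‖ + ‖freeFlow p.1 u - freeFlow t u‖)
      (𝓝 (t, u)) (𝓝 0) := by
    have : Continuous fun p : ℝ × L2 => ‖p.2 - u‖ + ‖freeFlow p.1 u - freeFlow t u‖ :=
      ((continuous_snd.sub continuous_const).norm).add
        ((((continuous_freeFlow_time u).comp continuous_fst).sub continuous_const).norm)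
    simpa using this.tendsto (t, u)
  refine squeeze_zero (fun _ => norm_nonneg _) (fun p => ?_) h1
  calc ‖freeFlow p.1 p.2 - freeFlow t u‖
      = ‖freeFlow p.1 (p.2 - u) + (freeFlow p.1 u - freeFlow t u)‖ := by
        rw [freeFlow_sub]; congr 1; abel
    _ ≤ ‖freeFlow p.1 (p.2 - u)‖ + ‖freeFlow p.1 u - freeFlow t u‖ := norm_add_le _ _
    _ = _ := by rw [norm_freeFlow]

theorem continuous_freeFlow_comp {α : Type*} [TopologicalSpace α] {a : α → ℝ} {u : α → L2}
    (ha : Continuous a) (hu : Continuous u) : Continuous fun x => freeFlow (a x) (u x) := by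
  have h : Continuous fun x => (a x, u x) := ha.prodMk hu
  have := Continuous.comp (g := fun p : ℝ × L2 => freeFlow p.1 p.2) continuous_freeFlow h
  simpa only [Function.comp_def] using this

/-! ### The integral kernel of the free propagator -/

/-- The Fourier transform of the Gaussian `exp (-b |ξ|²)`. -/
def heatKernel (b : ℂ) (x : Space) : ℂ :=
  (Real.pi / b) ^ ((3 / 2 : ℝ) : ℂ) * Complex.exp (-Real.pi ^ 2 * ‖x‖ ^ 2 / b)

theorem continuous_heatKernel (b : ℂ) : Continuous (heatKernel b) := by
  unfold heatKernel
  fun_prop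

/-- The exponential has modulus at most one as soon as `b.re ≥ 0`, so the bound sees only `‖b‖` and
survives the limit to the imaginary axis. -/
theorem norm_heatKernel_le {b : ℂ} (hb : 0 ≤ b.re) (x : Space) :
    ‖heatKernel b x‖ ≤ (Real.pi / ‖b‖) ^ (3 / 2 : ℝ) := by
  rw [heatKernel, norm_mul, Complex.norm_cpow_real, norm_div, Complex.norm_real,
    Real.norm_of_nonneg Real.pi_pos.le]
  refine mul_le_of_le_one_right (by positivity) ?_
  rw [Complex.norm_exp, Real.exp_le_one_iff]
  have h : (-(Real.pi : ℂ) ^ 2 * (‖x‖ : ℂ) ^ 2 / b) = ((-(Real.pi ^ 2 * ‖x‖ ^ 2) : ℝ) : ℂ) * b⁻¹ := by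
    push_cast; ring
  rw [h, Complex.re_ofReal_mul, Complex.inv_re]
  have : 0 ≤ b.re / Complex.normSq b := div_nonneg hb (Complex.normSq_nonneg _)
  have h2 : 0 ≤ Real.pi ^ 2 * ‖x‖ ^ 2 := by positivity
  nlinarith

theorem norm_cexp_neg_mul_sq_le {b : ℂ} (hb : 0 ≤ b.re) (ξ : Space) :
    ‖Complex.exp (-b * ‖ξ‖ ^ 2)‖ ≤ 1 := by
  rw [Complex.norm_exp, Real.exp_le_one_iff]
  have h : (-b * (‖ξ‖ : ℂ) ^ 2) = ((-(‖ξ‖ ^ 2) : ℝ) : ℂ) * b := by push_cast; ring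
  rw [h, Complex.re_ofReal_mul]
  nlinarith [sq_nonneg ‖ξ‖]

theorem memLp_gaussian_mul {b : ℂ} (hb : 0 ≤ b.re) (v : L2) :
    MemLp (fun ξ => Complex.exp (-b * ‖ξ‖ ^ 2) * v ξ) 2 (volume : Measure Space) := by
  have hc : Continuous fun ξ : Space => Complex.exp (-b * ‖ξ‖ ^ 2) := by fun_prop
  refine (Lp.memLp v).of_le (hc.aestronglyMeasurable.mul (Lp.aestronglyMeasurable v))
    (Eventually.of_forall fun ξ => ?_)
  rw [norm_mul]
  exact mul_le_of_le_one_left (norm_nonneg _) (norm_cexp_neg_mul_sq_le hb ξ)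

/-- For `b.re > 0` the multiplier is integrable, so inversion is an honest integral and Fubini turns
it into a convolution with the transform of a Gaussian. -/
theorem fourierInv_gaussian_mul {b : ℂ} (hb : 0 < b.re) {u : L2}
    (hu : Integrable (u : Space → ℂ)) :
    ((𝓕⁻ ((memLp_gaussian_mul hb.le (𝓕 u)).toLp _) : L2) : Space → ℂ)
      =ᵐ[volume] fun x => ∫ y, heatKernel b (x - y) * u y := by
  have hc : Continuous (𝓕 (u : Space → ℂ)) :=
    VectorFourier.fourierIntegral_continuous (L := innerₗ Space) Real.continuous_fourierChar
      continuous_inner hu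
  have hG : ∀ x : Space, Integrable
      fun v : Space => Complex.exp (-b * ‖v‖ ^ 2 + 2 * Real.pi * Complex.I * inner ℝ x v) :=
    fun x => GaussianFourier.integrable_cexp_neg_mul_sq_norm_add hb _ x
  have hae : (((memLp_gaussian_mul hb.le (𝓕 u)).toLp _ : L2) : Space → ℂ)
      =ᵐ[volume] fun ξ => Complex.exp (-b * ‖ξ‖ ^ 2) * 𝓕 (u : Space → ℂ) ξ := by
    filter_upwards [(memLp_gaussian_mul hb.le (𝓕 u)).coeFn_toLp, fourier_coeFn_ae_eq hu]
      with ξ h1 h2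
    rw [h1, h2]
  have hint : Integrable fun ξ : Space => Complex.exp (-b * ‖ξ‖ ^ 2) * 𝓕 (u : Space → ℂ) ξ := by
    have h0 := hG 0
    simp only [inner_zero_left, Complex.ofReal_zero, mul_zero, add_zero] at h0
    refine h0.mul_bdd (c := ∫ v, ‖u v‖) hc.aestronglyMeasurable (Eventually.of_forall fun ξ => ?_)
    exact VectorFourier.norm_fourierIntegral_le_integral_norm _ _ _ _ _
  refine (fourierInv_coeFn_ae_eq (hint.congr hae.symm)).trans (Eventually.of_forall fun x => ?_)
  rw [Real.fourierInv_congr_ae hae, Real.fourierInv_eq']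
  have h2 := VectorFourier.integral_fourierIntegral_smul_eq_flip (L := innerₗ Space) (μ := volume)
    (ν := volume) Real.continuous_fourierChar continuous_inner hu (hG x)
  refine Eq.trans (integral_congr_ae (Eventually.of_forall fun ξ => ?_))
    (h2.trans (integral_congr_ae (Eventually.of_forall fun y => ?_)))
  · simp only [smul_eq_mul]
    rw [Complex.exp_add, real_inner_comm x ξ]
    have : (𝓕 (u : Space → ℂ) ξ) = VectorFourier.fourierIntegral Real.fourierChar volume
      (innerₗ Space) (u : Space → ℂ) ξ := rfl
    rw [this]
    have h3 : (((2 * Real.pi * inner ℝ x ξ : ℝ) : ℂ) * Complex.I)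
      = 2 * Real.pi * Complex.I * (inner ℝ x ξ : ℝ) := by push_cast; ring
    rw [h3]
    ring
  · simp only [smul_eq_mul, flip_innerₗ]
    have h4 := fourier_gaussian_innerProductSpace' hb x y
    have h5 : ((Module.finrank ℝ Space : ℕ) : ℂ) / 2 = ((3 / 2 : ℝ) : ℂ) := by simp
    rw [h5] at h4
    have h6 : VectorFourier.fourierIntegral Real.fourierChar volume (innerₗ Space)
      (fun v : Space => Complex.exp (-b * ‖v‖ ^ 2 + 2 * Real.pi * Complex.I * inner ℝ x v)) y
      = heatKernel b (x - y) := h4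
    rw [h6, mul_comm]

/-- The argument of the Gaussian that corresponds to the time `t`. -/
def gaussArg (ε t : ℝ) : ℂ := 4 * Real.pi ^ 2 * (ε + t * Complex.I)

theorem gaussArg_re (ε t : ℝ) : (gaussArg ε t).re = 4 * Real.pi ^ 2 * ε := by
  have : gaussArg ε t = ((4 * Real.pi ^ 2 : ℝ) : ℂ) * (ε + t * Complex.I) := by
    simp [gaussArg]
  rw [this, Complex.re_ofReal_mul]; simp

theorem gaussArg_im (ε t : ℝ) : (gaussArg ε t).im = 4 * Real.pi ^ 2 * t := by
  have : gaussArg ε t = ((4 * Real.pi ^ 2 : ℝ) : ℂ) * (ε + t * Complex.I) := by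
    simp [gaussArg]
  rw [this, Complex.im_ofReal_mul]; simp

theorem norm_gaussArg_ge (ε t : ℝ) : 4 * Real.pi ^ 2 * |t| ≤ ‖gaussArg ε t‖ := by
  have := Complex.abs_im_le_norm (gaussArg ε t)
  rwa [gaussArg_im, abs_mul, abs_of_nonneg (by positivity)] at this

theorem norm_heatKernel_gaussArg_le {ε t : ℝ} (hε : 0 ≤ ε) (ht : t ≠ 0) (x : Space) :
    ‖heatKernel (gaussArg ε t) x‖ ≤ (4 * Real.pi * |t|) ^ (-(3 / 2) : ℝ) := by
  have htp : 0 < |t| := abs_pos.mpr ht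
  have hpi := Real.pi_pos
  refine (norm_heatKernel_le (by rw [gaussArg_re]; positivity) x).trans ?_
  rw [Real.rpow_neg (by positivity), ← Real.inv_rpow (by positivity)]
  refine Real.rpow_le_rpow (by positivity) ?_ (by norm_num)
  calc Real.pi / ‖gaussArg ε t‖ ≤ Real.pi / (4 * Real.pi ^ 2 * |t|) := by
        gcongr; exact norm_gaussArg_ge ε t
    _ = (4 * Real.pi * |t|)⁻¹ := by field_simp

theorem gaussArg_ne_zero (ε : ℝ) {t : ℝ} (ht : t ≠ 0) : gaussArg ε t ≠ 0 := by
  intro h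
  have := gaussArg_im ε t
  rw [h, Complex.zero_im] at this
  have hpi := Real.pi_pos
  exact ht ((mul_eq_zero.mp this.symm).resolve_left (by positivity))

theorem continuousAt_heatKernel_gaussArg {t : ℝ} (ht : t ≠ 0) (x : Space) :
    ContinuousAt (fun ε : ℝ => heatKernel (gaussArg ε t) x) 0 := by
  have hc : Continuous fun ε : ℝ => gaussArg ε t := by unfold gaussArg; fun_prop
  have hd : ∀ c : ℂ, ContinuousAt (fun ε : ℝ => c / gaussArg ε t) 0 := fun c =>
    continuousAt_const.div hc.continuousAt (gaussArg_ne_zero 0 ht)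
  unfold heatKernel
  refine ContinuousAt.mul (ContinuousAt.cpow (hd _) continuousAt_const ?_)
    (Complex.continuous_exp.continuousAt.comp (hd _))
  -- For `t ≠ 0` the base of the complex power has nonzero imaginary part at `ε = 0`, hence stays
  -- off the branch cut.
  right
  have hpi := Real.pi_pos
  rw [Complex.div_im, gaussArg_re, gaussArg_im]
  simp only [Complex.ofReal_im, Complex.ofReal_re, zero_mul, zero_div, zero_sub, ne_eq, neg_eq_zero]
  have := Complex.normSq_pos.mpr (gaussArg_ne_zero 0 ht)
  positivity

/-- The integral kernel of `exp (-i t H₀)`. -/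
def schrodingerKernel (t : ℝ) : Space → ℂ := heatKernel (gaussArg 0 t)

theorem norm_schrodingerKernel_le {t : ℝ} (ht : t ≠ 0) (x : Space) :
    ‖schrodingerKernel t x‖ ≤ (4 * Real.pi * |t|) ^ (-(3 / 2) : ℝ) :=
  norm_heatKernel_gaussArg_le le_rfl ht x

/-- The symbol of the free flow is not integrable, so `it` is replaced by `ε + it` and `ε → 0`. The
multipliers converge boundedly, hence the flows converge in `L²` and along a subsequence almost
everywhere. The kernels are bounded uniformly in `ε`, so their integrals against `u ∈ L¹` converge
too. -/
theorem freeFlow_ae_eq_kernel {t : ℝ} (ht : t ≠ 0) {u : L2} (hu : Integrable (u : Space → ℂ)) :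
    (freeFlow t u : Space → ℂ) =ᵐ[volume] fun x => ∫ y, schrodingerKernel t (x - y) * u y := by
  set ε : ℕ → ℝ := fun n => 1 / ((n : ℝ) + 1) with hε
  have hεp : ∀ n, 0 < ε n := fun n => by positivity
  have hε0 : Tendsto ε atTop (𝓝 0) := tendsto_one_div_add_atTop_nhds_zero_nat
  have hre : ∀ n, 0 < (gaussArg (ε n) t).re := fun n => by
    rw [gaussArg_re]; have := hεp n; positivity
  have h1 : Tendsto (fun n => (memLp_gaussian_mul (hre n).le (𝓕 u)).toLp _) atTop
      (𝓝 (symbolMul t (𝓕 u))) := by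
    refine tendsto_toLp_of_dominated (fun n => memLp_gaussian_mul (hre n).le (𝓕 u))
      (memLp_freeSymbol_mul t (𝓕 u)) (Lp.memLp (𝓕 u)) (fun n => ?_) ?_
    · refine Eventually.of_forall fun ξ => ?_
      rw [norm_mul]
      exact mul_le_of_le_one_left (norm_nonneg _) (norm_cexp_neg_mul_sq_le (hre n).le ξ)
    · refine Eventually.of_forall fun ξ => Tendsto.mul_const _ ?_
      have hc : Continuous fun e : ℝ => Complex.exp (-gaussArg e t * ‖ξ‖ ^ 2) := by
        unfold gaussArg; fun_prop
      have h2 := (hc.tendsto 0).comp hε0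
      refine h2.trans (le_of_eq ?_)
      congr 1
      simp only [freeSymbol, gaussArg]
      congr 1
      push_cast
      ring
  have h2 := ((ContinuousFourierInv.continuous_fourierInv (E := L2)).tendsto _).comp h1
  obtain ⟨ns, hns, hlim⟩ := (tendstoInMeasure_of_tendsto_Lp h2).exists_seq_tendsto_ae
  have h3 : ∀ᵐ x, ∀ n, ((𝓕⁻ ((memLp_gaussian_mul (hre n).le (𝓕 u)).toLp _) : L2) : Space → ℂ) x
      = ∫ y, heatKernel (gaussArg (ε n) t) (x - y) * u y :=
    ae_all_iff.mpr fun n => fourierInv_gaussian_mul (hre n) hu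
  filter_upwards [hlim, h3] with x hx hx3
  refine tendsto_nhds_unique hx ?_
  have h4 : Tendsto (fun n => ∫ y, heatKernel (gaussArg (ε n) t) (x - y) * u y) atTop
      (𝓝 (∫ y, schrodingerKernel t (x - y) * u y)) := by
    refine tendsto_integral_of_dominated_convergence
      (fun y => (4 * Real.pi * |t|) ^ (-(3 / 2) : ℝ) * ‖u y‖) (fun n => ?_)
      (hu.norm.const_mul _) (fun n => ?_) ?_
    · exact ((continuous_heatKernel _).comp (continuous_const.sub continuous_id)).aestronglyMeasurable.mul
        hu.1
    · refine Eventually.of_forall fun y => ?_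
      rw [norm_mul]
      gcongr
      exact norm_heatKernel_gaussArg_le (hεp n).le ht _
    · exact Eventually.of_forall fun y =>
        ((continuousAt_heatKernel_gaussArg ht (x - y)).tendsto.comp hε0).mul_const _
  refine (h4.comp hns.tendsto_atTop).congr fun n => ?_
  exact (hx3 (ns n)).symm

/-- The dispersive estimate `L¹ → L^∞`. -/
theorem eLpNorm_top_freeFlow_le {t : ℝ} (ht : t ≠ 0) {u : L2} (hu : MemLp u 1 volume) :
    eLpNorm (freeFlow t u) ∞ volume
      ≤ ENNReal.ofReal ((4 * Real.pi * |t|) ^ (-(3 / 2) : ℝ)) * eLpNorm u 1 volume := by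
  rw [eLpNorm_congr_ae (freeFlow_ae_eq_kernel ht (memLp_one_iff_integrable.mp hu)),
    eLpNorm_exponent_top]
  refine eLpNormEssSup_le_of_ae_enorm_bound (Eventually.of_forall fun x => ?_)
  refine (enorm_integral_le_lintegral_enorm _).trans ?_
  rw [eLpNorm_one_eq_lintegral_enorm, ← lintegral_const_mul' _ _ ENNReal.ofReal_ne_top]
  refine lintegral_mono fun y => ?_
  rw [enorm_mul]
  gcongr
  rw [← ofReal_norm]
  exact ENNReal.ofReal_le_ofReal (norm_schrodingerKernel_le ht _)

/-! ### The Hausdorff-Young inequality with exponents `4/3` and `4` -/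

/-- The Cauchy-Schwarz inequality for the Lebesgue integral. -/
theorem lintegral_mul_sq_le {α : Type*} [MeasurableSpace α] {μ : Measure α} {f g : α → ℝ≥0∞}
    (hf : AEMeasurable f μ) (hg : AEMeasurable g μ) :
    (∫⁻ x, f x * g x ∂μ) ^ 2 ≤ (∫⁻ x, f x ^ 2 ∂μ) * ∫⁻ x, g x ^ 2 ∂μ := by
  have h := ENNReal.lintegral_mul_le_Lp_mul_Lq μ Real.HolderConjugate.two_two hf hg
  simp only [Pi.mul_apply, ENNReal.rpow_two] at h
  calc (∫⁻ x, f x * g x ∂μ) ^ 2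
      ≤ ((∫⁻ x, f x ^ 2 ∂μ) ^ (1 / 2 : ℝ) * (∫⁻ x, g x ^ 2 ∂μ) ^ (1 / 2 : ℝ)) ^ 2 := by gcongr
    _ = _ := by
      rw [mul_pow, ← ENNReal.rpow_natCast, ← ENNReal.rpow_natCast, ← ENNReal.rpow_mul,
        ← ENNReal.rpow_mul]
      norm_num

theorem lintegral_sub_left_eq (x : Space) (f : Space → ℝ≥0∞) :
    ∫⁻ y, f (x - y) = ∫⁻ y, f y :=
  lintegral_sub_left_eq_self f x

theorem lintegral_lintegral_mul_sub {f g : Space → ℝ≥0∞} (hf : AEMeasurable f)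
    (hg : AEMeasurable g) :
    ∫⁻ x, ∫⁻ y, f y * g (x - y) = (∫⁻ y, f y) * ∫⁻ y, g y := by
  rw [lintegral_lintegral_swap]
  · calc ∫⁻ y, ∫⁻ x, f y * g (x - y) = ∫⁻ y, f y * ∫⁻ z, g z := by
          refine lintegral_congr fun y => ?_
          have hgy : AEMeasurable fun x => g (x - y) := hg.comp_quasiMeasurePreserving
              (measurePreserving_sub_right volume y).quasiMeasurePreserving
          rw [lintegral_const_mul'' _ hgy, lintegral_sub_right_eq_self]
      _ = _ := lintegral_mul_const'' _ hf
  · exact (hf.comp_quasiMeasurePreserving Measure.quasiMeasurePreserving_snd).mul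
      (hg.comp_quasiMeasurePreserving (quasiMeasurePreserving_sub volume volume))

theorem aemeasurable_comp_sub {f : Space → ℝ≥0∞} (hf : AEMeasurable f) (x : Space) :
    AEMeasurable fun y => f (x - y) :=
  hf.comp_quasiMeasurePreserving (quasiMeasurePreserving_sub_left volume x)

/-- A case of Young's inequality for convolutions. -/
theorem lintegral_sq_lintegral_mul_sub_le {p : Space → ℝ≥0∞} (hp : AEMeasurable p) :
    ∫⁻ x, (∫⁻ y, p y * p (x - y)) ^ 2 ≤ (∫⁻ y, p y ^ (4 / 3 : ℝ)) ^ 3 := by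
  -- With `p = q³` the integrand `q³ q³` splits as `(q² q²)(q q)`. Cauchy-Schwarz once separates the
  -- two factors, and a second time bounds `∫ q² q²` by `∫ q⁴ = ∫ p^{4/3}`.
  set q : Space → ℝ≥0∞ := fun y => p y ^ (1 / 3 : ℝ) with hq
  have hqm : AEMeasurable q := hp.pow_const _
  have hpq : ∀ y, p y = q y ^ 3 := fun y => by
    rw [hq, ← ENNReal.rpow_natCast, ← ENNReal.rpow_mul]; norm_num
  have hpq4 : ∀ y, p y ^ (4 / 3 : ℝ) = q y ^ 4 := fun y => by
    rw [hq, ← ENNReal.rpow_natCast, ← ENNReal.rpow_mul]; norm_num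
  simp only [hpq4]
  set Q := ∫⁻ y, q y ^ 4 with hQ
  have key : ∀ x, (∫⁻ y, p y * p (x - y)) ^ 2 ≤ (∫⁻ y, q y ^ 4 * q (x - y) ^ 4) * Q := by
    intro x
    have hqx := aemeasurable_comp_sub hqm x
    calc (∫⁻ y, p y * p (x - y)) ^ 2
        = (∫⁻ y, (q y ^ 2 * q (x - y) ^ 2) * (q y * q (x - y))) ^ 2 := by
          congr 1
          refine lintegral_congr fun y => ?_
          rw [hpq, hpq]; ring
      _ ≤ (∫⁻ y, (q y ^ 2 * q (x - y) ^ 2) ^ 2) * ∫⁻ y, (q y * q (x - y)) ^ 2 :=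
          lintegral_mul_sq_le ((hqm.pow_const _).mul (hqx.pow_const _)) (hqm.mul hqx)
      _ ≤ _ := by
          refine mul_le_mul' (le_of_eq (lintegral_congr fun y => by ring)) ?_
          have h2 := lintegral_mul_sq_le (hqm.pow_const 2) (hqx.pow_const 2)
          have h3 : ∫⁻ y, (q (x - y) ^ 2) ^ 2 = Q := by
            rw [lintegral_sub_left_eq x fun z => (q z ^ 2) ^ 2, hQ]
            exact lintegral_congr fun y => by ring
          have h4 : ∫⁻ y, (q y ^ 2) ^ 2 = Q := by
            rw [hQ]; exact lintegral_congr fun y => by ring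
          rw [h3, h4, ← sq] at h2
          have h5 := (ENNReal.pow_le_pow_left_iff two_ne_zero).mp h2
          refine le_trans (le_of_eq (lintegral_congr fun y => by ring)) h5
  calc ∫⁻ x, (∫⁻ y, p y * p (x - y)) ^ 2
      ≤ ∫⁻ x, (∫⁻ y, q y ^ 4 * q (x - y) ^ 4) * Q := lintegral_mono key
    _ = Q ^ 3 := by
      rw [lintegral_mul_const'']
      · rw [lintegral_lintegral_mul_sub (hqm.pow_const 4) (hqm.pow_const 4)]
        ring
      · refine AEMeasurable.lintegral_prod_right'
          (f := fun z : Space × Space => q z.2 ^ 4 * q (z.1 - z.2) ^ 4) ?_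
        exact ((hqm.comp_quasiMeasurePreserving
          Measure.quasiMeasurePreserving_snd).pow_const _).mul
          ((hqm.comp_quasiMeasurePreserving
            (quasiMeasurePreserving_sub volume volume)).pow_const _)

/-- Because `4` is even, no interpolation is needed: `(𝓕 h)²` is the transform of `h ⋆ h`, and
Plancherel reduces the claim to Young's inequality `L^{4/3} ⋆ L^{4/3} ⊆ L²`. -/
theorem lintegral_fourier_pow_four_le {h : Space → ℂ} (h1 : Integrable h) :
    ∫⁻ ξ, ‖𝓕 h ξ‖ₑ ^ 4 ≤ (∫⁻ y, ‖h y‖ₑ ^ (4 / 3 : ℝ)) ^ 3 := by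
  by_cases hfin : (∫⁻ y, ‖h y‖ₑ ^ (4 / 3 : ℝ)) ^ 3 = ∞
  · rw [hfin]; exact le_top
  set k : Space → ℂ := h ⋆[ContinuousLinearMap.mul ℂ ℂ] h with hk
  have hki : Integrable k := h1.integrable_convolution (ContinuousLinearMap.mul ℂ ℂ) h1
  have hkF : ∀ ξ, 𝓕 k ξ = 𝓕 h ξ * 𝓕 h ξ := Real.fourier_mul_convolution_eq h1 h1
  have hk2 : ∫⁻ x, ‖k x‖ₑ ^ 2 ≤ (∫⁻ y, ‖h y‖ₑ ^ (4 / 3 : ℝ)) ^ 3 := by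
    refine le_trans (lintegral_mono fun x => ?_)
      (lintegral_sq_lintegral_mul_sub_le h1.1.enorm)
    gcongr
    refine (enorm_integral_le_lintegral_enorm _).trans (le_of_eq (lintegral_congr fun y => ?_))
    simp [enorm_mul]
  have hkL : MemLp k 2 volume := by
    refine ⟨hki.1, ?_⟩
    rw [eLpNorm_lt_top_iff_lintegral_rpow_enorm_lt_top (by norm_num) (by norm_num)]
    simpa using hk2.trans_lt (lt_top_iff_ne_top.mpr hfin)
  have hsq : ∀ u : L2, ‖u‖ₑ ^ 2 = ∫⁻ x, ‖u x‖ₑ ^ 2 := fun u => by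
    rw [enorm_eq_eLpNorm, eLpNorm_eq_lintegral_rpow_enorm_toReal (by norm_num) (by norm_num),
      ← ENNReal.rpow_natCast, ← ENNReal.rpow_mul]
    simp
  have hF := fourier_coeFn_ae_eq (u := hkL.toLp k) (hki.congr hkL.coeFn_toLp.symm)
  calc ∫⁻ ξ, ‖𝓕 h ξ‖ₑ ^ 4 = ‖(𝓕 (hkL.toLp k) : L2)‖ₑ ^ 2 := by
        rw [hsq]
        refine lintegral_congr_ae ?_
        filter_upwards [hF] with ξ hξ
        rw [hξ, Real.fourier_congr_ae hkL.coeFn_toLp, hkF, enorm_mul]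
        ring
    _ = ‖hkL.toLp k‖ₑ ^ 2 := by
        rw [← ofReal_norm, Lp.norm_fourier_eq, ofReal_norm]
    _ = ∫⁻ x, ‖k x‖ₑ ^ 2 := by
        rw [hsq]
        refine lintegral_congr_ae ?_
        filter_upwards [hkL.coeFn_toLp] with x hx
        rw [hx]
    _ ≤ _ := hk2

/-! ### The dispersive estimate in `L⁴` -/

theorem schrodingerKernel_eq (t : ℝ) (x : Space) :
    schrodingerKernel t x
      = schrodingerKernel t 0 * Complex.exp (((‖x‖ ^ 2 / (4 * t) : ℝ) : ℂ) * Complex.I) := by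
  simp only [schrodingerKernel, heatKernel]
  rw [norm_zero]
  simp only [Complex.ofReal_zero, ne_eq, OfNat.ofNat_ne_zero, not_false_eq_true, zero_pow,
    mul_zero, zero_div, Complex.exp_zero, mul_one]
  congr 2
  rw [gaussArg]
  have hpi : (Real.pi : ℂ) ≠ 0 := by exact_mod_cast Real.pi_ne_zero
  by_cases ht : t = 0
  · simp [ht]
  have ht' : (t : ℂ) ≠ 0 := by exact_mod_cast ht
  push_cast
  rw [zero_add, div_eq_iff (by simp [ht', hpi])]
  field_simp
  rw [Complex.I_sq, mul_neg_one]

/-- Expanding `‖x - y‖²` in the quadratic phase of the kernel leaves a phase in `x`, a phase in `y`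
and a Fourier character: the free flow is a rescaled Fourier transform between two phases, so
Hausdorff-Young applies to it. -/
theorem freeFlow_ae_eq_fourier {t : ℝ} (ht : t ≠ 0) {u : L2} (hu : Integrable (u : Space → ℂ)) :
    (freeFlow t u : Space → ℂ) =ᵐ[volume] fun x => schrodingerKernel t x *
      𝓕 (fun y => Complex.exp (((‖y‖ ^ 2 / (4 * t) : ℝ) : ℂ) * Complex.I) * u y)
        ((1 / (4 * Real.pi * t)) • x) := by
  filter_upwards [freeFlow_ae_eq_kernel ht hu] with x hx
  rw [hx, Real.fourier_eq', ← integral_const_mul]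
  refine integral_congr_ae (Eventually.of_forall fun y => ?_)
  simp only [smul_eq_mul]
  have hpi := Real.pi_ne_zero
  have hph : ‖x - y‖ ^ 2 / (4 * t) = ‖x‖ ^ 2 / (4 * t)
      + -2 * Real.pi * inner ℝ y ((1 / (4 * Real.pi * t)) • x) + ‖y‖ ^ 2 / (4 * t) := by
    rw [norm_sub_sq_real, inner_smul_right, real_inner_comm y x]
    field_simp
    ring
  rw [schrodingerKernel_eq t (x - y), schrodingerKernel_eq t x, hph, Complex.ofReal_add,
    Complex.ofReal_add, add_mul, add_mul, Complex.exp_add, Complex.exp_add]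
  ring

theorem lintegral_comp_smul_space (f : Space → ℝ≥0∞) {r : ℝ} (hr : r ≠ 0) :
    ∫⁻ x, f (r • x) = ENNReal.ofReal (|r ^ 3|⁻¹) * ∫⁻ x, f x := by
  have h1 := lintegral_map_equiv (μ := volume) f (MeasurableEquiv.smul₀ r hr : Space ≃ᵐ Space)
  have h2 : Measure.map (MeasurableEquiv.smul₀ r hr : Space ≃ᵐ Space) volume
      = ENNReal.ofReal (|r ^ 3|⁻¹) • (volume : Measure Space) := by
    have := Measure.map_addHaar_smul (volume : Measure Space) hr
    rw [show Module.finrank ℝ Space = 3 by simp, abs_inv] at this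
    exact this
  rw [h2, lintegral_smul_measure] at h1
  exact h1.symm

/-- The dispersive estimate `L^{4/3} → L⁴`. -/
theorem eLpNorm_four_freeFlow_le {t : ℝ} (ht : t ≠ 0) {u : L2} (hu : MemLp u 1 volume) :
    eLpNorm (freeFlow t u) 4 volume
      ≤ ENNReal.ofReal ((4 * Real.pi * |t|) ^ (-(3 / 4) : ℝ)) * eLpNorm u (4 / 3) volume := by
  have hui := memLp_one_iff_integrable.mp hu
  set h : Space → ℂ := fun y => Complex.exp (((‖y‖ ^ 2 / (4 * t) : ℝ) : ℂ) * Complex.I) * u y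
    with hh
  have hnorm : ∀ y, ‖h y‖ₑ = ‖u y‖ₑ := fun y => by
    rw [← ofReal_norm, ← ofReal_norm, hh, norm_mul, Complex.norm_exp_ofReal_mul_I, one_mul]
  have hi : Integrable h := by
    refine hui.bdd_mul (c := 1) ?_ (Eventually.of_forall fun y => ?_)
    · exact Continuous.aestronglyMeasurable (by fun_prop)
    · rw [Complex.norm_exp_ofReal_mul_I]
  have htp : 0 < 4 * Real.pi * |t| := by have := abs_pos.mpr ht; have := Real.pi_pos; positivity
  set κ := (4 * Real.pi * |t|) ^ (-(3 / 4) : ℝ) with hκ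
  have hκp : 0 ≤ κ := by positivity
  have h43 : (4 / 3 : ℝ≥0∞).toReal = 4 / 3 := by simp
  have h43' : (4 / 3 : ℝ≥0∞) ≠ ∞ := ENNReal.div_ne_top (by norm_num) (by norm_num)
  have key : ∫⁻ x, ‖freeFlow t u x‖ₑ ^ 4
      ≤ ENNReal.ofReal κ ^ 4 * (∫⁻ y, ‖u y‖ₑ ^ (4 / 3 : ℝ)) ^ 3 := by
    calc ∫⁻ x, ‖freeFlow t u x‖ₑ ^ 4
        ≤ ∫⁻ x, ENNReal.ofReal ((4 * Real.pi * |t|) ^ (-(3 / 2) : ℝ)) ^ 4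
            * ‖𝓕 h ((1 / (4 * Real.pi * t)) • x)‖ₑ ^ 4 := by
          refine lintegral_mono_ae ?_
          filter_upwards [freeFlow_ae_eq_fourier ht hui] with x hx
          rw [hx, enorm_mul, mul_pow]
          gcongr
          rw [← ofReal_norm]
          exact ENNReal.ofReal_le_ofReal (norm_schrodingerKernel_le ht x)
      -- Powers of `4π|t|`: the kernel contributes `-6` and the dilation of `ℝ³` contributes `+3`,
      -- in total `-3 = 4 · (-3/4)`.
      _ = ENNReal.ofReal κ ^ 4 * ∫⁻ ξ, ‖𝓕 h ξ‖ₑ ^ 4 := by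
          rw [lintegral_const_mul' _ _ (by finiteness),
            lintegral_comp_smul_space (fun x => ‖𝓕 h x‖ₑ ^ 4)
              (one_div_ne_zero (by have := Real.pi_ne_zero; positivity)), ← mul_assoc]
          congr 1
          rw [← ENNReal.ofReal_pow (by positivity), ← ENNReal.ofReal_pow hκp,
            ← ENNReal.ofReal_mul (by positivity)]
          congr 1
          have h5 : |(1 / (4 * Real.pi * t)) ^ 3|⁻¹ = (4 * Real.pi * |t|) ^ (3 : ℝ) := by
            rw [abs_pow, abs_div, abs_mul, abs_of_pos (show (0 : ℝ) < 4 * Real.pi by positivity)]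
            norm_cast
            rw [one_div, inv_pow, inv_inv]
          rw [h5, hκ, ← Real.rpow_natCast, ← Real.rpow_natCast, ← Real.rpow_mul htp.le,
            ← Real.rpow_mul htp.le, ← Real.rpow_add htp]
          norm_num
      _ ≤ _ := by
          gcongr
          refine (lintegral_fourier_pow_four_le hi).trans (le_of_eq ?_)
          simp only [hnorm]
  rw [eLpNorm_eq_lintegral_rpow_enorm_toReal (by norm_num) (by norm_num),
    eLpNorm_eq_lintegral_rpow_enorm_toReal (by simp) h43', h43]
  have h4 : ∀ x, ‖freeFlow t u x‖ₑ ^ (4 : ℝ≥0∞).toReal = ‖freeFlow t u x‖ₑ ^ 4 := fun x => by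
    rw [← ENNReal.rpow_natCast]; simp
  simp only [h4]
  refine (ENNReal.rpow_le_rpow key (by norm_num)).trans (le_of_eq ?_)
  rw [ENNReal.mul_rpow_of_nonneg _ _ (by norm_num), ← ENNReal.rpow_natCast,
    ← ENNReal.rpow_natCast, ← ENNReal.rpow_mul, ← ENNReal.rpow_mul]
  norm_num

/-! ### Galilean covariance -/

/-- The plane wave `exp (2πi ⟨k, x⟩)`. -/
def planeWave (k x : Space) : ℂ := Complex.exp (((2 * Real.pi * inner ℝ k x : ℝ) : ℂ) * Complex.I)

theorem norm_planeWave (k x : Space) : ‖planeWave k x‖ = 1 := Complex.norm_exp_ofReal_mul_I _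

theorem continuous_planeWave : Continuous fun p : Space × Space => planeWave p.1 p.2 := by
  unfold planeWave; fun_prop

theorem continuous_planeWave_right (k : Space) : Continuous (planeWave k) := by
  unfold planeWave; fun_prop

theorem memLp_planeWave_mul {p : ℝ≥0∞} (k : Space) {f : Space → ℂ} (hf : MemLp f p volume) :
    MemLp (fun x => planeWave k x * f x) p (volume : Measure Space) :=
  hf.of_le ((continuous_planeWave_right k).aestronglyMeasurable.mul hf.1)
    (Eventually.of_forall fun x => by rw [norm_mul, norm_planeWave, one_mul])

/-- Multiplication by a plane wave. -/
def modulate (k : Space) (u : L2) : L2 := (memLp_planeWave_mul k (Lp.memLp u)).toLp _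

theorem modulate_coe (k : Space) (u : L2) :
    (modulate k u : Space → ℂ) =ᵐ[volume] fun x => planeWave k x * u x :=
  (memLp_planeWave_mul k (Lp.memLp u)).coeFn_toLp

theorem eLpNorm_modulate (k : Space) (u : L2) (p : ℝ≥0∞) :
    eLpNorm (modulate k u) p volume = eLpNorm u p volume := by
  refine eLpNorm_congr_norm_ae ?_
  filter_upwards [modulate_coe k u] with x hx
  rw [hx, norm_mul, norm_planeWave, one_mul]

theorem modulate_sub (k : Space) (u v : L2) :
    modulate k u - modulate k v = modulate k (u - v) := by
  apply Lp.ext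
  filter_upwards [modulate_coe k (u - v), modulate_coe k u, modulate_coe k v,
    Lp.coeFn_sub u v, Lp.coeFn_sub (modulate k u) (modulate k v)] with x h1 h2 h3 h4 h5
  rw [h1, h5, Pi.sub_apply, h2, h3, h4, Pi.sub_apply, mul_sub]

theorem continuous_modulate (k : Space) : Continuous (modulate k) := by
  refine (Isometry.of_dist_eq fun u v => ?_).continuous
  rw [dist_eq_norm, dist_eq_norm, modulate_sub, Lp.norm_def, Lp.norm_def, eLpNorm_modulate]

/-- Translation in `L²`. -/
def translate (a : Space) (u : L2) : L2 :=
  Lp.compMeasurePreserving (fun x => x - a) (measurePreserving_sub_right volume a) u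

theorem translate_coe (a : Space) (u : L2) :
    (translate a u : Space → ℂ) =ᵐ[volume] fun x => u (x - a) :=
  Lp.coeFn_compMeasurePreserving u (measurePreserving_sub_right volume a)

theorem continuous_translate (a : Space) : Continuous (translate a) :=
  (Lp.isometry_compMeasurePreserving (measurePreserving_sub_right volume a)).continuous

theorem eLpNorm_translate (a : Space) (u : L2) (p : ℝ≥0∞) :
    eLpNorm (translate a u) p volume = eLpNorm u p volume := by
  rw [eLpNorm_congr_ae (translate_coe a u)]
  exact eLpNorm_comp_measurePreserving (Lp.aestronglyMeasurable u)
    (measurePreserving_sub_right volume a)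

theorem denseRange_schwartz : DenseRange (SchwartzMap.toLpCLM ℝ ℂ 2 (volume : Measure Space)) :=
  SchwartzMap.denseRange_toLpCLM (by norm_num)

/-- Completing the square in the phase of the kernel: a boost by `k` moves the free evolution by
`4πtk` and multiplies it by a plane wave and a constant phase. Both sides are continuous in `u`, so
Schwartz functions suffice, for which the kernel formula is available. -/
theorem freeFlow_modulate {t : ℝ} (ht : t ≠ 0) (k : Space) (u : L2) :
    freeFlow t (modulate k u) = Complex.exp (((-(4 * Real.pi ^ 2 * t * ‖k‖ ^ 2) : ℝ) : ℂ) * Complex.I)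
      • modulate k (translate ((4 * Real.pi * t) • k) (freeFlow t u)) := by
  refine DenseRange.induction_on denseRange_schwartz u (isClosed_eq ?_ ?_) fun w => ?_
  · exact continuous_freeFlow_comp continuous_const (continuous_modulate k)
  · have h := (continuous_modulate k).comp ((continuous_translate ((4 * Real.pi * t) • k)).comp
      (continuous_freeFlow_comp (continuous_const (y := t)) continuous_id))
    exact h.const_smul (M := ℂ) _
  set u : L2 := SchwartzMap.toLpCLM ℝ ℂ 2 volume w with hu
  have hui : Integrable (u : Space → ℂ) :=
    w.integrable.congr (w.coeFn_toLp 2 volume).symm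
  have hmi : Integrable (modulate k u : Space → ℂ) :=
    memLp_one_iff_integrable.mp ((memLp_congr_ae (modulate_coe k u)).mpr
      (memLp_planeWave_mul k (memLp_one_iff_integrable.mpr hui)))
  set a : Space := (4 * Real.pi * t) • k with ha
  set c := Complex.exp (((-(4 * Real.pi ^ 2 * t * ‖k‖ ^ 2) : ℝ) : ℂ) * Complex.I) with hc
  apply Lp.ext
  have hker : ∀ᵐ x, freeFlow t u (x - a) = ∫ y, schrodingerKernel t (x - a - y) * u y :=
    (measurePreserving_sub_right volume a).quasiMeasurePreserving.ae (freeFlow_ae_eq_kernel ht hui)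
  filter_upwards [freeFlow_ae_eq_kernel ht hmi, Lp.coeFn_smul c (modulate k (translate a
    (freeFlow t u))), modulate_coe k (translate a (freeFlow t u)), translate_coe a (freeFlow t u),
    hker] with x h1 h2 h3 h4 h5
  rw [h1, h2, Pi.smul_apply, h3, h4, h5, smul_eq_mul, ← integral_const_mul, ← integral_const_mul]
  refine integral_congr_ae ?_
  filter_upwards [modulate_coe k u] with y hy
  have hph : ‖x - y‖ ^ 2 / (4 * t) + 2 * Real.pi * inner ℝ k y
      = -(4 * Real.pi ^ 2 * t * ‖k‖ ^ 2) + 2 * Real.pi * inner ℝ k x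
        + ‖x - a - y‖ ^ 2 / (4 * t) := by
    have h6 : x - a - y = (x - y) - a := by abel
    rw [h6, norm_sub_sq_real (x - y) a, ha, inner_smul_right, norm_smul, mul_pow, Real.norm_eq_abs,
      sq_abs, inner_sub_left, real_inner_comm k x, real_inner_comm k y]
    field_simp
    ring
  have hph' : Complex.exp (((‖x - y‖ ^ 2 / (4 * t) : ℝ) : ℂ) * Complex.I) * planeWave k y
      = c * planeWave k x * Complex.exp (((‖x - a - y‖ ^ 2 / (4 * t) : ℝ) : ℂ) * Complex.I) := by
    rw [hc, planeWave, planeWave, ← Complex.exp_add, ← Complex.exp_add, ← Complex.exp_add,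
      ← add_mul, ← add_mul, ← add_mul, ← Complex.ofReal_add, ← Complex.ofReal_add,
      ← Complex.ofReal_add, hph]
  rw [hy, schrodingerKernel_eq t (x - y), schrodingerKernel_eq t (x - a - y)]
  linear_combination (schrodingerKernel t 0 * u y) * hph'

/-- A plane wave conjugated by the free flow is a phase times a modulated translation, so it
preserves every `Lᵖ` norm although the flow itself does not. The case `p = ∞` drives the boundedness
theorem. -/
theorem eLpNorm_freeFlow_modulate_freeFlow_neg (t : ℝ) (k : Space) (v : L2) (p : ℝ≥0∞) :
    eLpNorm (freeFlow t (modulate k (freeFlow (-t) v))) p volume = eLpNorm v p volume := by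
  by_cases ht : t = 0
  · rw [ht, neg_zero, freeFlow_zero, freeFlow_zero, eLpNorm_modulate]
  rw [freeFlow_modulate ht, eLpNorm_smul_coe, eLpNorm_modulate, eLpNorm_translate,
    freeFlow_freeFlow_neg, ← ofReal_norm, Complex.norm_exp_ofReal_mul_I, ENNReal.ofReal_one,
    one_mul]

/-! ### A diagonal Hardy-Littlewood-Sobolev inequality -/

theorem lintegral_comp_abs_eq (F : ℝ → ℝ≥0∞) :
    ∫⁻ x : ℝ, F |x| = 2 * ∫⁻ x in Set.Ioi (0 : ℝ), F x := by
  have h1 : ∫⁻ x in Set.Ioi (0 : ℝ), F |x| = ∫⁻ x in Set.Ioi (0 : ℝ), F x :=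
    setLIntegral_congr_fun measurableSet_Ioi fun x hx => by rw [abs_of_pos hx]
  have h2 : ∫⁻ x in Set.Iio (0 : ℝ), F |x| = ∫⁻ x in Set.Ioi (0 : ℝ), F x := by
    have h3 := (Measure.measurePreserving_neg (volume : Measure ℝ)).setLIntegral_comp_preimage_emb
      (Homeomorph.neg ℝ).measurableEmbedding (fun x => F |x|) (Set.Ioi 0)
    rw [← h1, ← h3]
    simp [abs_neg]
  rw [← lintegral_add_compl (fun x => F |x|) (measurableSet_Ioi (a := (0 : ℝ))), h1,
    Set.compl_Ioi, setLIntegral_congr Iio_ae_eq_Iic.symm, h2, two_mul]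

/-- The time decay of the dispersive estimate in `L⁴`. -/
def decay (x : ℝ) : ℝ≥0∞ := ENNReal.ofReal (|x| ^ (-(3 / 4) : ℝ))

theorem measurable_decay : Measurable decay := by unfold decay; fun_prop

theorem decay_neg (x : ℝ) : decay (-x) = decay x := by simp [decay]

theorem lintegral_decay_near {R : ℝ} (hR : 0 < R) :
    ∫⁻ x in {x : ℝ | |x| < R}, decay x = ENNReal.ofReal (8 * R ^ (1 / 4 : ℝ)) := by
  have hm : MeasurableSet {x : ℝ | |x| < R} := measurableSet_lt (by fun_prop) measurable_const
  rw [← lintegral_indicator hm]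
  have h1 : ∀ x : ℝ, {x : ℝ | |x| < R}.indicator decay x
      = (fun y => (Set.Iio R).indicator (fun y => ENNReal.ofReal (y ^ (-(3 / 4) : ℝ))) y) |x| :=
    fun x => by simp only [Set.indicator_apply, Set.mem_ofPred_eq, Set.mem_Iio, decay]
  simp only [h1]
  rw [lintegral_comp_abs_eq, setLIntegral_indicator measurableSet_Iio, Set.inter_comm,
    Set.Ioi_inter_Iio, setLIntegral_congr Ioo_ae_eq_Ioc]
  have hi : IntervalIntegrable (fun x : ℝ => x ^ (-(3 / 4) : ℝ)) volume 0 R :=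
    intervalIntegral.intervalIntegrable_rpow' (by norm_num)
  rw [← ofReal_integral_eq_lintegral_ofReal
    ((intervalIntegrable_iff_integrableOn_Ioc_of_le hR.le).mp hi),
    ← intervalIntegral.integral_of_le hR.le, integral_rpow (Or.inl (by norm_num)),
    ← ENNReal.ofReal_ofNat, ← ENNReal.ofReal_mul (by norm_num)]
  · congr 1
    rw [Real.zero_rpow (by norm_num)]
    norm_num
    ring
  · filter_upwards [ae_restrict_mem measurableSet_Ioc] with x hx
    exact Real.rpow_nonneg hx.1.le _

/-- The exponent `8/3` is conjugate to `8/5`, and `(3/4)(8/3) = 2 > 1` gives integrability at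
infinity. -/
theorem lintegral_decay_far {R : ℝ} (hR : 0 < R) :
    ∫⁻ x in {x : ℝ | R < |x|}, decay x ^ (8 / 3 : ℝ) = ENNReal.ofReal (2 * R⁻¹) := by
  have hm : MeasurableSet {x : ℝ | R < |x|} := measurableSet_lt measurable_const (by fun_prop)
  rw [← lintegral_indicator hm]
  have h1 : ∀ x : ℝ, {x : ℝ | R < |x|}.indicator (fun x => decay x ^ (8 / 3 : ℝ)) x
      = (fun y => (Set.Ioi R).indicator (fun y => ENNReal.ofReal (y ^ (-2 : ℝ))) y) |x| :=
    fun x => by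
      simp only [Set.indicator_apply, Set.mem_ofPred_eq, Set.mem_Ioi, decay]
      congr 1
      rw [ENNReal.ofReal_rpow_of_nonneg (by positivity) (by norm_num),
        ← Real.rpow_mul (abs_nonneg x)]
      norm_num
  simp only [h1]
  rw [lintegral_comp_abs_eq, setLIntegral_indicator measurableSet_Ioi, Set.Ioi_inter_Ioi,
    max_eq_left hR.le]
  rw [← ofReal_integral_eq_lintegral_ofReal (integrableOn_Ioi_rpow_of_lt (by norm_num) hR),
    integral_Ioi_rpow_of_lt (by norm_num) hR,
    ← ENNReal.ofReal_ofNat, ← ENNReal.ofReal_mul (by norm_num)]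
  · congr 1
    norm_num
    exact Real.rpow_neg_one R
  · filter_upwards [ae_restrict_mem measurableSet_Ioi] with x hx
    exact Real.rpow_nonneg (hR.le.trans (le_of_lt hx)) _

/-- Hedberg's splitting at distance `R`: the near part uses `g ≤ a` and is at most `8 a R^{1/4}`,
the far part uses Hölder and is at most `2^{3/8} X R^{-3/8}`. -/
theorem lintegral_mul_decay_le {g : ℝ → ℝ≥0∞} (hg : Measurable g) {a X : ℝ} (ha : 0 < a)
    (hX : 0 < X) (hgX : (∫⁻ s, g s ^ (8 / 5 : ℝ)) ^ (5 / 8 : ℝ) = ENNReal.ofReal X) (t : ℝ) :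
    ∫⁻ s in {s | g s ≤ ENNReal.ofReal a}, g s * decay (t - s)
      ≤ ENNReal.ofReal (10 * a ^ (3 / 5 : ℝ) * X ^ (2 / 5 : ℝ)) := by
  -- This `R` balances `a R^{1/4}` against `X R^{-3/8}`.
  set R : ℝ := (X / a) ^ (8 / 5 : ℝ) with hR
  have hRp : 0 < R := by positivity
  set N : Set ℝ := {s | |t - s| ≤ R} with hN
  have hNm : MeasurableSet N := measurableSet_le (by fun_prop) measurable_const
  have hsub : ∀ F : ℝ → ℝ≥0∞, ∫⁻ s, F (t - s) = ∫⁻ s, F s := fun F => lintegral_sub_left_eq_self F t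
  have hdm : Measurable fun s => decay (t - s) := measurable_decay.comp (by fun_prop)
  have near : ∫⁻ s in {s | g s ≤ ENNReal.ofReal a} ∩ N, g s * decay (t - s)
      ≤ ENNReal.ofReal (8 * a * R ^ (1 / 4 : ℝ)) := by
    calc ∫⁻ s in {s | g s ≤ ENNReal.ofReal a} ∩ N, g s * decay (t - s)
        ≤ ∫⁻ s in {s | g s ≤ ENNReal.ofReal a} ∩ N, ENNReal.ofReal a * decay (t - s) := by
          refine setLIntegral_mono (by fun_prop) fun s hs => ?_
          gcongr
          exact hs.1
      _ ≤ ∫⁻ s in N, ENNReal.ofReal a * decay (t - s) := lintegral_mono_set Set.inter_subset_right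
      _ = ENNReal.ofReal a * ∫⁻ s in {x : ℝ | |x| ≤ R}, decay s := by
          rw [lintegral_const_mul _ hdm]
          congr 1
          rw [← lintegral_indicator hNm, ← lintegral_indicator (measurableSet_le (by fun_prop)
            measurable_const), ← hsub ({x : ℝ | |x| ≤ R}.indicator decay)]
          rfl
      _ = _ := by
          have h1 : ({x : ℝ | |x| ≤ R} : Set ℝ) =ᵐ[volume] {x : ℝ | |x| < R} := by
            have e1 : {x : ℝ | |x| ≤ R} = Set.Icc (-R) R := by ext; simp [abs_le]
            have e2 : {x : ℝ | |x| < R} = Set.Ioo (-R) R := by ext; simp [abs_lt]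
            rw [e1, e2]
            exact Ioo_ae_eq_Icc.symm
          rw [setLIntegral_congr h1, lintegral_decay_near hRp, ← ENNReal.ofReal_mul ha.le]
          congr 1
          ring
  have far : ∫⁻ s in {s | g s ≤ ENNReal.ofReal a} ∩ Nᶜ, g s * decay (t - s)
      ≤ ENNReal.ofReal (X * (2 * R⁻¹) ^ (3 / 8 : ℝ)) := by
    calc ∫⁻ s in {s | g s ≤ ENNReal.ofReal a} ∩ Nᶜ, g s * decay (t - s)
        ≤ ∫⁻ s in Nᶜ, g s * decay (t - s) := lintegral_mono_set Set.inter_subset_right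
      _ ≤ (∫⁻ s in Nᶜ, g s ^ (8 / 5 : ℝ)) ^ (1 / (8 / 5) : ℝ)
          * (∫⁻ s in Nᶜ, decay (t - s) ^ (8 / 3 : ℝ)) ^ (1 / (8 / 3) : ℝ) :=
          ENNReal.lintegral_mul_le_Lp_mul_Lq _ (by rw [Real.holderConjugate_iff]; norm_num)
            hg.aemeasurable hdm.aemeasurable
      _ ≤ ENNReal.ofReal X * (ENNReal.ofReal (2 * R⁻¹)) ^ (3 / 8 : ℝ) := by
          refine mul_le_mul' ?_ (le_of_eq ?_)
          · rw [← hgX]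
            norm_num
            gcongr
            exact Measure.restrict_le_self
          · rw [← lintegral_decay_far hRp, ← lintegral_indicator hNm.compl,
              ← lintegral_indicator (measurableSet_lt measurable_const (by fun_prop)), ← hsub]
            norm_num
            congr 2
            ext s
            simp [Set.indicator_apply, hN]
      _ = _ := by
          rw [ENNReal.ofReal_rpow_of_nonneg (by positivity) (by norm_num),
            ← ENNReal.ofReal_mul hX.le]
  have hsplit := lintegral_inter_add_sdiff (μ := volume) (fun s => g s * decay (t - s))
    {s | g s ≤ ENNReal.ofReal a} hNm
  rw [← hsplit, Set.sdiff_eq]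
  refine (add_le_add near far).trans ?_
  rw [← ENNReal.ofReal_add (by positivity) (by positivity)]
  refine ENNReal.ofReal_le_ofReal ?_
  have e1 : a * R ^ (1 / 4 : ℝ) = a ^ (3 / 5 : ℝ) * X ^ (2 / 5 : ℝ) := by
    rw [hR, ← Real.rpow_mul (by positivity), Real.div_rpow hX.le ha.le]
    norm_num
    have : a ^ (3 / 5 : ℝ) * a ^ (2 / 5 : ℝ) = a := by
      rw [← Real.rpow_add ha]; norm_num
    have hne : a ^ (2 / 5 : ℝ) ≠ 0 := by positivity
    field_simp
    linear_combination -this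
  have e2 : X * (R⁻¹) ^ (3 / 8 : ℝ) = a ^ (3 / 5 : ℝ) * X ^ (2 / 5 : ℝ) := by
    rw [hR, Real.inv_rpow (by positivity), ← Real.rpow_mul (by positivity),
      Real.div_rpow hX.le ha.le]
    norm_num
    have : X ^ (3 / 5 : ℝ) * X ^ (2 / 5 : ℝ) = X := by
      rw [← Real.rpow_add hX]; norm_num
    have hne : X ^ (3 / 5 : ℝ) ≠ 0 := by positivity
    field_simp
    linear_combination -this
  have e3 : (2 : ℝ) ^ (3 / 8 : ℝ) ≤ 2 := by
    calc (2 : ℝ) ^ (3 / 8 : ℝ) ≤ 2 ^ (1 : ℝ) :=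
          Real.rpow_le_rpow_of_exponent_le (by norm_num) (by norm_num)
      _ = 2 := Real.rpow_one 2
  rw [Real.mul_rpow (by norm_num) (by positivity)]
  have hp : 0 ≤ a ^ (3 / 5 : ℝ) * X ^ (2 / 5 : ℝ) := by positivity
  calc 8 * a * R ^ (1 / 4 : ℝ) + X * (2 ^ (3 / 8 : ℝ) * R⁻¹ ^ (3 / 8 : ℝ))
      = 8 * (a * R ^ (1 / 4 : ℝ)) + 2 ^ (3 / 8 : ℝ) * (X * R⁻¹ ^ (3 / 8 : ℝ)) := by ring
    _ = (8 + 2 ^ (3 / 8 : ℝ)) * (a ^ (3 / 5 : ℝ) * X ^ (2 / 5 : ℝ)) := by rw [e1, e2]; ring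
    _ ≤ (8 + 2) * (a ^ (3 / 5 : ℝ) * X ^ (2 / 5 : ℝ)) := by gcongr
    _ = _ := by ring

/-- The Hardy-Littlewood-Sobolev inequality on the diagonal, with exponent `8/5`. -/
theorem lintegral_lintegral_mul_decay_le {g : ℝ → ℝ≥0∞} (hg : Measurable g) :
    ∫⁻ t, ∫⁻ s, g t * g s * decay (t - s) ≤ 20 * (∫⁻ s, g s ^ (8 / 5 : ℝ)) ^ (5 / 4 : ℝ) := by
  set Y := ∫⁻ s, g s ^ (8 / 5 : ℝ) with hY
  have hgm : Measurable fun s => g s ^ (8 / 5 : ℝ) := hg.pow_const _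
  by_cases hY0 : Y = 0
  · have h0 : ∀ᵐ s, g s = 0 := by
      have := (lintegral_eq_zero_iff hgm).mp hY0
      filter_upwards [this] with s hs
      exact (ENNReal.rpow_eq_zero_iff_of_pos (by norm_num)).mp hs
    have : ∫⁻ t, ∫⁻ s, g t * g s * decay (t - s) = 0 := by
      rw [lintegral_congr_ae (g := fun _ => 0) ?_]
      · simp
      · filter_upwards [h0] with t ht
        simp [ht]
    rw [this]; exact zero_le
  by_cases hYt : Y = ∞
  · rw [hYt, ENNReal.top_rpow_of_pos (by norm_num), ENNReal.mul_top (by norm_num)]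
    exact le_top
  set X : ℝ := (Y ^ (5 / 8 : ℝ)).toReal with hX
  have hXe : Y ^ (5 / 8 : ℝ) = ENNReal.ofReal X := by
    rw [hX, ENNReal.ofReal_toReal]
    exact ENNReal.rpow_ne_top_of_nonneg (by norm_num) hYt
  have hXp : 0 < X := by
    refine ENNReal.toReal_pos ?_ (ENNReal.rpow_ne_top_of_nonneg (by norm_num) hYt)
    simp [ENNReal.rpow_eq_zero_iff, hY0, hYt]
  have hfin : ∀ᵐ t, g t < ∞ := by
    filter_upwards [ae_lt_top hgm hYt] with t ht
    exact (ENNReal.rpow_lt_top_iff_of_pos (by norm_num)).mp ht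
  have hm3 : Measurable fun p : ℝ × ℝ => g p.1 * g p.2 * decay (p.1 - p.2) :=
    ((hg.comp measurable_fst).mul (hg.comp measurable_snd)).mul
      (measurable_decay.comp (measurable_fst.sub measurable_snd))
  -- The double integral is symmetric, so it is enough to treat `g s ≤ g t`. The previous lemma with
  -- `a = g t` then leaves `g(t)^{8/5}` to be integrated, and no maximal function is needed.
  have half : ∫⁻ t, ∫⁻ s in {s | g s ≤ g t}, g t * g s * decay (t - s)
      ≤ 10 * Y ^ (5 / 4 : ℝ) := by
    calc ∫⁻ t, ∫⁻ s in {s | g s ≤ g t}, g t * g s * decay (t - s)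
        ≤ ∫⁻ t, g t ^ (8 / 5 : ℝ) * ENNReal.ofReal (10 * X ^ (2 / 5 : ℝ)) := by
          refine lintegral_mono_ae ?_
          filter_upwards [hfin] with t ht
          by_cases ht0 : g t = 0
          · simp [ht0]
          set a := (g t).toReal with ha
          have hap : 0 < a := ENNReal.toReal_pos ht0 ht.ne
          have hga : g t = ENNReal.ofReal a := (ENNReal.ofReal_toReal ht.ne).symm
          have := lintegral_mul_decay_le hg hap hXp hXe t
          have hdm : Measurable fun s => g s * decay (t - s) :=
            hg.mul (measurable_decay.comp (by fun_prop))
          simp only [mul_assoc]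
          rw [lintegral_const_mul _ hdm, hga]
          refine (mul_le_mul_right this _).trans (le_of_eq ?_)
          rw [ENNReal.ofReal_rpow_of_pos hap, ← ENNReal.ofReal_mul hap.le,
            ← ENNReal.ofReal_mul (by positivity)]
          congr 1
          have : a ^ (8 / 5 : ℝ) = a * a ^ (3 / 5 : ℝ) := by
            nth_rewrite 2 [← Real.rpow_one a]
            rw [← Real.rpow_add hap]; norm_num
          rw [this]; ring
      _ = Y * ENNReal.ofReal (10 * X ^ (2 / 5 : ℝ)) := lintegral_mul_const _ hgm
      _ = 10 * Y ^ (5 / 4 : ℝ) := by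
          rw [ENNReal.ofReal_mul (by norm_num), ← ENNReal.ofReal_rpow_of_pos hXp, ← hXe,
            ← ENNReal.rpow_mul, ENNReal.ofReal_ofNat, mul_left_comm]
          congr 1
          nth_rewrite 1 [← ENNReal.rpow_one Y]
          rw [← ENNReal.rpow_add _ _ hY0 hYt]
          norm_num
  have hsplit : ∀ t, ∫⁻ s, g t * g s * decay (t - s)
      ≤ (∫⁻ s in {s | g s ≤ g t}, g t * g s * decay (t - s))
        + ∫⁻ s in {s | g t ≤ g s}, g t * g s * decay (t - s) := fun t => by
    rw [← setLIntegral_univ]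
    refine (lintegral_mono_set fun s _ => ?_).trans (lintegral_union_le _ _ _)
    exact le_total (g s) (g t)
  have hswap : ∫⁻ t, ∫⁻ s in {s | g t ≤ g s}, g t * g s * decay (t - s)
      = ∫⁻ t, ∫⁻ s in {s | g s ≤ g t}, g t * g s * decay (t - s) := by
    have hS : MeasurableSet {p : ℝ × ℝ | g p.1 ≤ g p.2} :=
      measurableSet_le (hg.comp measurable_fst) (hg.comp measurable_snd)
    have e1 : ∀ t, ∫⁻ s in {s | g t ≤ g s}, g t * g s * decay (t - s)
        = ∫⁻ s, {p : ℝ × ℝ | g p.1 ≤ g p.2}.indicator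
            (fun p => g p.1 * g p.2 * decay (p.1 - p.2)) (t, s) := fun t => by
      rw [← lintegral_indicator (measurableSet_le measurable_const hg)]
      rfl
    have e2 : ∀ t, ∫⁻ s in {s | g s ≤ g t}, g t * g s * decay (t - s)
        = ∫⁻ s, {p : ℝ × ℝ | g p.1 ≤ g p.2}.indicator
            (fun p => g p.1 * g p.2 * decay (p.1 - p.2)) (s, t) := fun t => by
      rw [← lintegral_indicator (measurableSet_le hg measurable_const)]
      refine lintegral_congr fun s => ?_
      simp only [Set.indicator_apply, Set.mem_ofPred_eq]
      rw [mul_comm (g s) (g t), ← decay_neg (s - t), neg_sub]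
    simp only [e1, e2]
    exact lintegral_lintegral_swap (hm3.indicator hS).aemeasurable
  calc ∫⁻ t, ∫⁻ s, g t * g s * decay (t - s)
      ≤ ∫⁻ t, ((∫⁻ s in {s | g s ≤ g t}, g t * g s * decay (t - s))
        + ∫⁻ s in {s | g t ≤ g s}, g t * g s * decay (t - s)) := lintegral_mono hsplit
    _ = (∫⁻ t, ∫⁻ s in {s | g s ≤ g t}, g t * g s * decay (t - s))
        + ∫⁻ t, ∫⁻ s in {s | g t ≤ g s}, g t * g s * decay (t - s) := by
        refine lintegral_add_left ?_ _
        have e2 : ∀ t, ∫⁻ s in {s | g s ≤ g t}, g t * g s * decay (t - s)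
            = ∫⁻ s, {p : ℝ × ℝ | g p.2 ≤ g p.1}.indicator
                (fun p => g p.1 * g p.2 * decay (p.1 - p.2)) (t, s) := fun t => by
          rw [← lintegral_indicator (measurableSet_le hg measurable_const)]
          rfl
        simp only [e2]
        exact (hm3.indicator (measurableSet_le (hg.comp measurable_snd)
          (hg.comp measurable_fst))).lintegral_prod_right'
    _ ≤ 10 * Y ^ (5 / 4 : ℝ) + 10 * Y ^ (5 / 4 : ℝ) := by
        rw [hswap]; exact add_le_add half half
    _ = 20 * Y ^ (5 / 4 : ℝ) := by rw [← add_mul]; norm_num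

/-! ### The mixed norm `L^{8/3} L⁴` -/

/-- The norm of `L^{8/3}(J; L⁴)`. -/
def mixedNorm (J : Set ℝ) (ψ : ℝ → L2) : ℝ≥0∞ :=
  (∫⁻ t in J, eLpNorm (ψ t) 4 volume ^ (8 / 3 : ℝ)) ^ (3 / 8 : ℝ)

theorem mixedNorm_rpow (J : Set ℝ) (ψ : ℝ → L2) :
    mixedNorm J ψ ^ (8 / 3 : ℝ) = ∫⁻ t in J, eLpNorm (ψ t) 4 volume ^ (8 / 3 : ℝ) := by
  rw [mixedNorm, ← ENNReal.rpow_mul]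
  norm_num

theorem mixedNorm_zero (J : Set ℝ) : mixedNorm J (fun _ => 0) = 0 := by
  have h : eLpNorm ((0 : L2) : Space → ℂ) 4 volume = 0 := by
    rw [eLpNorm_congr_ae (Lp.coeFn_zero ℂ 2 volume), eLpNorm_zero]
  simp only [mixedNorm, h]
  simp

theorem mixedNorm_mono {J K : Set ℝ} (h : J ⊆ K) (ψ : ℝ → L2) : mixedNorm J ψ ≤ mixedNorm K ψ := by
  unfold mixedNorm
  gcongr

theorem mixedNorm_congr {J : Set ℝ} (hJ : MeasurableSet J) {ψ φ : ℝ → L2}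
    (h : ∀ t ∈ J, ψ t = φ t) : mixedNorm J ψ = mixedNorm J φ := by
  unfold mixedNorm
  congr 1
  exact setLIntegral_congr_fun hJ fun t ht => by rw [h t ht]

theorem mixedNorm_add_le (J : Set ℝ) {ψ φ : ℝ → L2} (hψ : Continuous ψ) (hφ : Continuous φ) :
    mixedNorm J (fun t => ψ t + φ t) ≤ mixedNorm J ψ + mixedNorm J φ := by
  have h := ENNReal.lintegral_Lp_add_le (μ := volume.restrict J) (p := 8 / 3)
    (measurable_eLpNorm_comp 4 hψ).aemeasurable (measurable_eLpNorm_comp 4 hφ).aemeasurable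
    (by norm_num)
  simp only [Pi.add_apply] at h
  unfold mixedNorm
  rw [show (3 / 8 : ℝ) = 1 / (8 / 3) by norm_num]
  refine le_trans ?_ h
  gcongr with t
  exact eLpNorm_add_coe_le 4 (by norm_num) _ _

theorem mixedNorm_smul_le (J : Set ℝ) {c : ℝ → ℂ} {a : ℝ≥0∞} (hc : ∀ t, ‖c t‖ₑ ≤ a) (ha : a ≠ ∞)
    (ψ : ℝ → L2) :
    mixedNorm J (fun t => c t • ψ t) ≤ a * mixedNorm J ψ := by
  unfold mixedNorm
  simp only [eLpNorm_smul_coe]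
  calc (∫⁻ t in J, (‖c t‖ₑ * eLpNorm (ψ t) 4 volume) ^ (8 / 3 : ℝ)) ^ (3 / 8 : ℝ)
      ≤ (∫⁻ t in J, (a * eLpNorm (ψ t) 4 volume) ^ (8 / 3 : ℝ)) ^ (3 / 8 : ℝ) := by
        gcongr with t; exact hc t
    _ = _ := by
      simp_rw [ENNReal.mul_rpow_of_nonneg _ _ (show (0 : ℝ) ≤ 8 / 3 by norm_num)]
      rw [lintegral_const_mul' _ _ (by finiteness), ENNReal.mul_rpow_of_nonneg _ _ (by norm_num),
        ← ENNReal.rpow_mul]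
      norm_num

/-- Lower semicontinuity of the `L⁴` norm at each time, then Fatou in time. -/
theorem mixedNorm_le_liminf {J : Set ℝ} (hJ : MeasurableSet J) {ψ : ℕ → ℝ → L2} {φ : ℝ → L2}
    (hψ : ∀ n, Continuous (ψ n)) (h : ∀ t ∈ J, Tendsto (fun n => ψ n t) atTop (𝓝 (φ t))) :
    mixedNorm J φ ≤ liminf (fun n => mixedNorm J (ψ n)) atTop := by
  have hl : ∀ (p : ℝ) (hp : 0 < p) (a : ℕ → ℝ≥0∞),
      (liminf a atTop) ^ p = liminf (fun n => a n ^ p) atTop := fun p hp a =>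
    (ENNReal.orderIsoRpow p hp).liminf_apply (u := a)
  unfold mixedNorm
  rw [← hl _ (by norm_num)]
  gcongr
  calc ∫⁻ t in J, eLpNorm (φ t) 4 volume ^ (8 / 3 : ℝ)
      ≤ ∫⁻ t in J, liminf (fun n => eLpNorm (ψ n t) 4 volume ^ (8 / 3 : ℝ)) atTop := by
        refine setLIntegral_mono' hJ fun t ht => ?_
        rw [← hl _ (by norm_num)]
        gcongr
        exact eLpNorm_le_liminf 4 (h t ht)
    _ ≤ _ := lintegral_liminf_le fun n => (measurable_eLpNorm_comp 4 (hψ n)).pow_const _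

theorem mixedNorm_le_of_tendsto {J : Set ℝ} (hJ : MeasurableSet J) {ψ : ℕ → ℝ → L2} {φ : ℝ → L2}
    (hψ : ∀ n, Continuous (ψ n)) (h : ∀ t ∈ J, Tendsto (fun n => ψ n t) atTop (𝓝 (φ t)))
    {c : ℕ → ℝ≥0∞} {c' : ℝ≥0∞} (hc : ∀ n, mixedNorm J (ψ n) ≤ c n)
    (hc' : Tendsto c atTop (𝓝 c')) : mixedNorm J φ ≤ c' := by
  rw [← hc'.liminf_eq]
  exact (mixedNorm_le_liminf hJ hψ h).trans
    (liminf_le_liminf (Eventually.of_forall hc) (by isBoundedDefault) (by isBoundedDefault))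

/-! ### The Strichartz estimate -/

theorem norm_sq_mul_sub_le {a b : ℂ} {B : ℝ} (ha : ‖a‖ ≤ B) (hb : ‖b‖ ≤ B) :
    ‖(‖a‖ : ℂ) ^ 2 * a - (‖b‖ : ℂ) ^ 2 * b‖ ≤ 3 * B ^ 2 * ‖a - b‖ := by
  have hB : 0 ≤ B := (norm_nonneg a).trans ha
  have e : (‖a‖ : ℂ) ^ 2 * a - (‖b‖ : ℂ) ^ 2 * b
      = (‖a‖ : ℂ) ^ 2 * (a - b) + (((‖a‖ - ‖b‖) * (‖a‖ + ‖b‖) : ℝ) : ℂ) * b := by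
    push_cast; ring
  rw [e]
  refine (norm_add_le _ _).trans ?_
  rw [norm_mul, norm_mul, norm_pow, Complex.norm_real, Complex.norm_real, norm_norm, norm_mul]
  have h1 : ‖‖a‖ - ‖b‖‖ ≤ ‖a - b‖ := abs_norm_sub_norm_le a b
  have h2 : ‖‖a‖ + ‖b‖‖ ≤ 2 * B := by
    rw [Real.norm_of_nonneg (by positivity)]; linarith
  calc ‖a‖ ^ 2 * ‖a - b‖ + ‖‖a‖ - ‖b‖‖ * ‖‖a‖ + ‖b‖‖ * ‖b‖
      ≤ B ^ 2 * ‖a - b‖ + ‖a - b‖ * (2 * B) * B := by gcongr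
    _ = _ := by ring

theorem memLp_cubic {B : ℝ} {u : L2} (hu : ∀ᵐ x, ‖u x‖ ≤ B) :
    MemLp (fun x => (‖u x‖ : ℂ) ^ 2 * u x) 2 (volume : Measure Space) := by
  have hm := Lp.aestronglyMeasurable u
  refine ((Lp.memLp u).const_mul ((B : ℂ) ^ 2)).of_le
    (((Complex.continuous_ofReal.comp_aestronglyMeasurable hm.norm).pow 2).mul hm) ?_
  filter_upwards [hu] with x hx
  rw [norm_mul, norm_mul, norm_pow, norm_pow, Complex.norm_real, Complex.norm_real, norm_norm]
  gcongr
  exact hx.trans (le_abs_self B)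

theorem integrable_cubic {B : ℝ} {u : L2} (hu : ∀ᵐ x, ‖u x‖ ≤ B) :
    Integrable (fun x => (‖u x‖ : ℂ) ^ 2 * u x) (volume : Measure Space) := by
  have hm := Lp.aestronglyMeasurable u
  have h2 : Integrable (fun x => ‖u x‖ ^ 2) volume := (Lp.memLp u).integrable_norm_pow two_ne_zero
  refine (h2.mul_const B).mono
    (((Complex.continuous_ofReal.comp_aestronglyMeasurable hm.norm).pow 2).mul hm) ?_
  filter_upwards [hu] with x hx
  rw [norm_mul, norm_mul, norm_pow, norm_pow, Complex.norm_real, norm_norm]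
  gcongr
  exact hx.trans (le_abs_self B)

/-- The symbol has modulus one, so the `L¹` norm of `𝓕 w` bounds the evolution at all times. This
makes the cubic expression `|W|² W` below a function in `L¹ ∩ L²`. -/
theorem exists_bound_freeFlow_schwartz (w : SchwartzMap Space ℂ) :
    ∃ B : ℝ, ∀ t, ∀ᵐ x, ‖freeFlow t (w.toLp 2 volume) x‖ ≤ B := by
  refine ⟨∫ ξ, ‖(𝓕 w) ξ‖, fun t => ?_⟩
  have h1 : (𝓕 (w.toLp 2 volume : L2) : L2) = (𝓕 w).toLp 2 volume := SchwartzMap.toLp_fourier_eq w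
  have hae : (symbolMul t (𝓕 (w.toLp 2 volume : L2)) : Space → ℂ)
      =ᵐ[volume] fun ξ => freeSymbol t ξ * (𝓕 w) ξ := by
    filter_upwards [symbolMul_coe t (𝓕 (w.toLp 2 volume : L2)),
      (𝓕 w).coeFn_toLp 2 volume] with ξ h2 h3
    rw [h2, h1, h3]
  have hi : Integrable (symbolMul t (𝓕 (w.toLp 2 volume : L2)) : Space → ℂ) := by
    refine Integrable.congr ?_ hae.symm
    exact (𝓕 w).integrable.bdd_mul (c := 1) (continuous_freeSymbol t).aestronglyMeasurable
      (Eventually.of_forall fun ξ => (norm_freeSymbol t ξ).le)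
  filter_upwards [fourierInv_coeFn_ae_eq hi] with x hx
  rw [freeFlow_eq, hx, Real.fourierInv_eq]
  refine (norm_integral_le_integral_norm _).trans (le_of_eq (integral_congr_ae ?_))
  filter_upwards [hae] with ξ hξ
  rw [Circle.norm_smul, hξ, norm_mul, norm_freeSymbol, one_mul]

/-- The `TT*` argument with the extremal dual function written out. With `W` the evolution of `u`
and `G = ‖W‖₄^{-4/3} |W|² W`, the quantity `A = ∫ ‖W‖₄^{8/3}` equals `⟨u, S⟩`, where `S = ∫ e^{itH₀}
G(t) dt`. The dispersive `L^{4/3} → L⁴` bound and the diagonal Hardy-Littlewood-Sobolev inequality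
give `‖S‖² ≤ 20 A^{5/4}`, so `A² ≤ 20 ‖u‖² A^{5/4}`. Schwartz data and a compact interval make `A`
finite beforehand, which permits the division. -/
theorem strichartz_schwartz_aux (w : SchwartzMap Space ℂ) (T : ℝ) :
    mixedNorm (Set.Icc (-T) T) (fun t => freeFlow t (w.toLp 2 volume))
      ≤ 5 * ‖(w.toLp 2 volume : L2)‖ₑ := by
  set u : L2 := w.toLp 2 volume with hu
  set I := Set.Icc (-T) T with hI
  by_cases hu0 : u = 0
  · rw [hu0]
    simp only [freeFlow_map_zero, mixedNorm_zero, zero_le]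
  obtain ⟨B, hB⟩ := exists_bound_freeFlow_schwartz w
  rw [← hu] at hB
  set W : ℝ → L2 := fun t => freeFlow t u with hW
  have hWc : Continuous W := continuous_freeFlow_time u
  set F : ℝ → L2 := fun t => (memLp_cubic (hB t)).toLp _ with hF
  have hFcoe : ∀ t, (F t : Space → ℂ) =ᵐ[volume] fun x => (‖W t x‖ : ℂ) ^ 2 * W t x :=
    fun t => (memLp_cubic (hB t)).coeFn_toLp
  have hFc : Continuous F := by
    refine continuous_iff_continuousAt.mpr fun t => ?_
    rw [ContinuousAt, tendsto_iff_norm_sub_tendsto_zero]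
    have h0 : Tendsto (fun s => 3 * B ^ 2 * ‖W s - W t‖) (𝓝 t) (𝓝 0) := by
      have hc : Continuous fun s => 3 * B ^ 2 * ‖W s - W t‖ :=
        continuous_const.mul (hWc.sub continuous_const).norm
      simpa using hc.tendsto t
    refine squeeze_zero (fun _ => norm_nonneg _) (fun s => ?_) h0
    refine Lp.norm_le_mul_norm_of_ae_le_mul ?_
    filter_upwards [Lp.coeFn_sub (F s) (F t), Lp.coeFn_sub (W s) (W t), hFcoe s, hFcoe t, hB s,
      hB t] with x h1 h2 h3 h4 h5 h6
    rw [h1, h2, Pi.sub_apply, Pi.sub_apply, h3, h4]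
    exact norm_sq_mul_sub_le h5 h6
  set P : ℝ → ℝ := fun t => ∫ x, ‖W t x‖ ^ 4 with hP
  have hinner : ∀ t, inner ℂ (W t) (F t) = ((P t : ℝ) : ℂ) := fun t => by
    rw [L2.inner_def, hP, ← integral_complex_ofReal]
    refine integral_congr_ae ?_
    filter_upwards [hFcoe t] with x hx
    rw [hx, RCLike.inner_apply, mul_assoc, Complex.mul_conj']
    push_cast; ring
  have hint : ∀ t, Integrable fun x => ‖W t x‖ ^ 4 := fun t => by
    refine (L2.integrable_inner (𝕜 := ℂ) (W t) (F t)).norm.congr ?_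
    filter_upwards [hFcoe t] with x hx
    rw [hx, RCLike.inner_apply, norm_mul, norm_mul, RCLike.norm_conj, norm_pow, Complex.norm_real,
      norm_norm]
    ring
  have hPc : Continuous P := by
    have h1 : Continuous fun t => (inner ℂ (W t) (F t) : ℂ).re :=
      Complex.continuous_re.comp (hWc.inner hFc)
    refine h1.congr fun t => ?_
    rw [hinner, Complex.ofReal_re]
  -- The flow is isometric and `u ≠ 0`, so `W t` never vanishes and negative powers of `P` are
  -- continuous.
  have hPpos : ∀ t, 0 < P t := fun t => by
    refine lt_of_le_of_ne (integral_nonneg fun x => by positivity) fun h0 => hu0 ?_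
    have h1 := (integral_eq_zero_iff_of_nonneg (fun x => by positivity) (hint t)).mp h0.symm
    have h2 : W t = 0 := by
      apply Lp.ext
      filter_upwards [h1, Lp.coeFn_zero ℂ 2 (volume : Measure Space)] with x hx hx0
      rw [hx0]
      simpa using hx
    rw [← norm_eq_zero, ← norm_freeFlow t u]
    exact norm_eq_zero.mpr h2
  have hP4 : ∀ t, ∫⁻ x, ‖W t x‖ₑ ^ 4 = ENNReal.ofReal (P t) := fun t => by
    rw [hP, ofReal_integral_eq_lintegral_ofReal (hint t)
      (Eventually.of_forall fun x => by positivity)]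
    refine lintegral_congr fun x => ?_
    rw [ENNReal.ofReal_pow (norm_nonneg _), ofReal_norm]
  have hW4 : ∀ t, eLpNorm (W t) 4 volume ^ (8 / 3 : ℝ) = ENNReal.ofReal (P t ^ (2 / 3 : ℝ)) :=
    fun t => by
    rw [eLpNorm_eq_lintegral_rpow_enorm_toReal (by norm_num) (by norm_num),
      ← ENNReal.ofReal_rpow_of_pos (hPpos t), ← hP4, ← ENNReal.rpow_mul]
    simp only [ENNReal.toReal_ofNat, ← ENNReal.rpow_natCast]
    norm_num
  -- Since `P = ‖W‖₄⁴`, this weight makes `⟨W, G⟩ = P^{2/3} = ‖W‖₄^{8/3}` and `‖G‖_{4/3} =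
  -- P^{5/12}`, whose power `8/5` is again `P^{2/3}`.
  set α : ℝ → ℝ := fun t => P t ^ (-(1 / 3) : ℝ) with hα
  have hαc : Continuous α := hPc.rpow_const fun t => Or.inl (hPpos t).ne'
  set G : ℝ → L2 := fun t => (α t : ℂ) • F t with hG
  have hGc : Continuous G := (Complex.continuous_ofReal.comp hαc).smul hFc
  have h43 : (4 / 3 : ℝ≥0∞).toReal = 4 / 3 := by simp
  have h43' : (4 / 3 : ℝ≥0∞) ≠ ∞ := ENNReal.div_ne_top (by norm_num) (by norm_num)
  have hGn : ∀ t, eLpNorm (G t) (4 / 3) volume = ENNReal.ofReal (P t ^ (5 / 12 : ℝ)) := fun t => by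
    have e1 : eLpNorm (F t) (4 / 3) volume = ENNReal.ofReal (P t) ^ (3 / 4 : ℝ) := by
      rw [eLpNorm_eq_lintegral_rpow_enorm_toReal (by simp) h43', h43, ← hP4]
      norm_num
      congr 1
      refine lintegral_congr_ae ?_
      filter_upwards [hFcoe t] with x hx
      rw [hx, enorm_mul, enorm_pow, ← ofReal_norm (‖W t x‖ : ℂ), Complex.norm_real, norm_norm,
        ofReal_norm, ← pow_succ, ← ENNReal.rpow_natCast, ← ENNReal.rpow_natCast,
        ← ENNReal.rpow_mul]
      norm_num
    rw [hG, eLpNorm_smul_coe, e1, ← ofReal_norm, Complex.norm_real,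
      Real.norm_of_nonneg (Real.rpow_nonneg (hPpos t).le _), ENNReal.ofReal_rpow_of_pos (hPpos t),
      ← ENNReal.ofReal_mul (Real.rpow_nonneg (hPpos t).le _), ← Real.rpow_add (hPpos t)]
    norm_num
  have hG1 : ∀ t, MemLp (G t) 1 volume := fun t => by
    refine (memLp_congr_ae (Lp.coeFn_smul (α t : ℂ) (F t))).mpr (MemLp.const_smul ?_ _)
    exact (memLp_congr_ae (hFcoe t)).mpr (memLp_one_iff_integrable.mpr (integrable_cubic (hB t)))
  set H : ℝ → L2 := fun t => freeFlow (-t) (G t) with hH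
  have hHc : Continuous H := continuous_freeFlow_comp continuous_neg hGc
  have hHi : IntegrableOn H I := hHc.continuousOn.integrableOn_compact isCompact_Icc
  set S : L2 := ∫ t in I, H t with hS
  set A : ℝ≥0∞ := ∫⁻ t in I, eLpNorm (W t) 4 volume ^ (8 / 3 : ℝ) with hA
  have hPi : IntegrableOn (fun t => P t ^ (2 / 3 : ℝ)) I :=
    (hPc.rpow_const fun t => Or.inl (hPpos t).ne').continuousOn.integrableOn_compact isCompact_Icc
  have hAfin : A ≠ ∞ := by
    rw [hA]
    simp only [hW4]
    rw [← ofReal_integral_eq_lintegral_ofReal hPi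
      (Eventually.of_forall fun t => Real.rpow_nonneg (hPpos t).le _)]
    exact ENNReal.ofReal_ne_top
  have hA1 : A ≤ ‖u‖ₑ * ‖S‖ₑ := by
    have e1 : inner ℂ u S = ((∫ t in I, P t ^ (2 / 3 : ℝ) : ℝ) : ℂ) := by
      rw [hS, ← integral_inner hHi u, ← integral_complex_ofReal]
      refine integral_congr_ae (Eventually.of_forall fun t => ?_)
      simp only [hH, hG]
      rw [← inner_freeFlow t u, freeFlow_freeFlow_neg, inner_smul_right]
      change (α t : ℂ) * inner ℂ (W t) (F t) = _
      rw [hinner, ← Complex.ofReal_mul]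
      congr 1
      change P t ^ (-(1 / 3) : ℝ) * P t = P t ^ (2 / 3 : ℝ)
      rw [← Real.rpow_add_one (hPpos t).ne']
      norm_num
    have e2 : A = ‖inner ℂ u S‖ₑ := by
      rw [e1, hA]
      simp only [hW4]
      rw [← ofReal_integral_eq_lintegral_ofReal hPi
        (Eventually.of_forall fun t => Real.rpow_nonneg (hPpos t).le _), ← ofReal_norm,
        Complex.norm_real, Real.norm_of_nonneg
        (integral_nonneg fun t => Real.rpow_nonneg (hPpos t).le _)]
    rw [e2, ← ofReal_norm, ← ofReal_norm, ← ofReal_norm, ← ENNReal.ofReal_mul (norm_nonneg _)]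
    exact ENNReal.ofReal_le_ofReal (norm_inner_le_norm u S)
  set g : ℝ → ℝ≥0∞ := I.indicator fun t => ENNReal.ofReal (P t ^ (5 / 12 : ℝ)) with hg
  have hPm : Measurable fun t => P t ^ (5 / 12 : ℝ) :=
    (hPc.rpow_const fun t => Or.inl (hPpos t).ne').measurable
  have hgm : Measurable g := (hPm.ennreal_ofReal).indicator measurableSet_Icc
  have hgA : ∫⁻ t, g t ^ (8 / 5 : ℝ) = A := by
    rw [hA, ← lintegral_indicator measurableSet_Icc]
    refine lintegral_congr fun t => ?_
    by_cases ht : t ∈ I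
    · rw [hg, Set.indicator_of_mem ht, Set.indicator_of_mem ht, hW4,
        ENNReal.ofReal_rpow_of_pos (Real.rpow_pos_of_pos (hPpos t) _), ← Real.rpow_mul (hPpos t).le]
      norm_num
    · rw [hg, Set.indicator_of_notMem ht, Set.indicator_of_notMem ht]
      norm_num
  have hpair : ∀ t ∈ I, ∀ s ∈ I, t ≠ s → ‖inner ℂ (H t) (H s)‖ₑ ≤ g t * g s * decay (t - s) := by
    intro t ht s hs hts
    have hne : t - s ≠ 0 := sub_ne_zero.mpr hts
    have : ENNReal.HolderTriple (4 / 3) 4 1 := ⟨by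
      rw [ENNReal.inv_div (by norm_num) (by norm_num), inv_one, ← one_div,
        ENNReal.div_add_div_same, show (3 : ℝ≥0∞) + 1 = 4 by norm_num]
      exact ENNReal.div_self (by norm_num) (by norm_num)⟩
    rw [hH, ← inner_freeFlow t, freeFlow_freeFlow_neg, freeFlow_freeFlow, ← sub_eq_add_neg]
    refine (enorm_inner_le_eLpNorm (p := 4 / 3) (q := 4) _ _).trans ?_
    rw [hGn t, mul_assoc]
    have e1 : g t = ENNReal.ofReal (P t ^ (5 / 12 : ℝ)) := Set.indicator_of_mem ht _
    have e2 : g s = ENNReal.ofReal (P s ^ (5 / 12 : ℝ)) := Set.indicator_of_mem hs _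
    rw [e1, e2, ← hGn s]
    gcongr
    refine (eLpNorm_four_freeFlow_le hne (hG1 s)).trans ?_
    rw [mul_comm]
    gcongr
    refine ENNReal.ofReal_le_ofReal ?_
    have := abs_pos.mpr hne
    refine Real.rpow_le_rpow_of_nonpos this ?_ (by norm_num)
    have := Real.pi_gt_three
    nlinarith
  have hSS : ‖S‖ₑ ^ 2 ≤ 20 * A ^ (5 / 4 : ℝ) := by
    have e0 : ‖S‖ₑ ^ 2 = ‖inner ℂ S S‖ₑ := by
      rw [← ofReal_norm, ← ofReal_norm, inner_self_eq_norm_sq_to_K, norm_pow, RCLike.norm_ofReal,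
        abs_norm, ENNReal.ofReal_pow (norm_nonneg _)]
    have e1 : ∀ v : L2, ‖inner ℂ v S‖ₑ ≤ ∫⁻ s in I, ‖inner ℂ v (H s)‖ₑ := fun v => by
      rw [hS, ← integral_inner hHi v]
      exact enorm_integral_le_lintegral_enorm _
    calc ‖S‖ₑ ^ 2 ≤ ∫⁻ t in I, ‖inner ℂ S (H t)‖ₑ := by rw [e0]; exact e1 S
      _ = ∫⁻ t in I, ‖inner ℂ (H t) S‖ₑ := by
          refine lintegral_congr fun t => ?_
          rw [← ofReal_norm, norm_inner_symm, ofReal_norm]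
      _ ≤ ∫⁻ t in I, ∫⁻ s in I, ‖inner ℂ (H t) (H s)‖ₑ := lintegral_mono fun t => e1 (H t)
      _ ≤ ∫⁻ t in I, ∫⁻ s in I, g t * g s * decay (t - s) := by
          refine setLIntegral_mono' measurableSet_Icc fun t ht => ?_
          refine lintegral_mono_ae ?_
          have hne : ∀ᵐ s ∂(volume.restrict I), s ≠ t :=
            ae_restrict_of_ae (Measure.ae_ne volume t)
          filter_upwards [ae_restrict_mem measurableSet_Icc, hne] with s hs hst
          exact hpair t ht s hs hst.symm
      _ ≤ ∫⁻ t, ∫⁻ s, g t * g s * decay (t - s) :=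
          lintegral_mono' Measure.restrict_le_self fun t =>
            lintegral_mono' Measure.restrict_le_self le_rfl
      _ ≤ _ := by
          rw [← hgA]
          exact lintegral_lintegral_mul_decay_le hgm
  set X := mixedNorm I W with hX
  have hXA : X ^ (8 / 3 : ℝ) = A := mixedNorm_rpow I W
  by_cases hX0 : X = 0
  · rw [hX0]; exact zero_le
  have hXt : X ≠ ∞ := fun h => hAfin (by rw [← hXA, h]; norm_num)
  -- In terms of `X`, with `A = X^{8/3}`, the bound on `A²` reads `X^{16/3} ≤ 20 ‖u‖² X^{10/3}`. The
  -- constant `5` in the statement comes from `20 ≤ 5²`.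
  have h1 : X ^ 2 * X ^ (10 / 3 : ℝ) ≤ (20 * ‖u‖ₑ ^ 2) * X ^ (10 / 3 : ℝ) := by
    calc X ^ 2 * X ^ (10 / 3 : ℝ) = A ^ 2 := by
          rw [← hXA, ← ENNReal.rpow_natCast, ← ENNReal.rpow_natCast, ← ENNReal.rpow_mul,
            ← ENNReal.rpow_add _ _ hX0 hXt]
          norm_num
      _ ≤ (‖u‖ₑ * ‖S‖ₑ) ^ 2 := by gcongr
      _ = ‖u‖ₑ ^ 2 * ‖S‖ₑ ^ 2 := mul_pow _ _ _
      _ ≤ ‖u‖ₑ ^ 2 * (20 * A ^ (5 / 4 : ℝ)) := by gcongr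
      _ = _ := by
          rw [← hXA, ← ENNReal.rpow_mul]
          norm_num
          ring
  have h2 : X ^ 2 ≤ 20 * ‖u‖ₑ ^ 2 := by
    refine (ENNReal.mul_le_mul_iff_left ?_ ?_).mp h1
    · simp [ENNReal.rpow_eq_zero_iff, hX0, hXt]
    · exact ENNReal.rpow_ne_top_of_nonneg (by norm_num) hXt
  refine (ENNReal.pow_le_pow_left_iff two_ne_zero).mp (h2.trans ?_)
  rw [mul_pow]
  gcongr
  norm_num

/-- The homogeneous Strichartz estimate. -/
theorem mixedNorm_freeFlow_le (u : L2) (J : Set ℝ) :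
    mixedNorm J (fun t => freeFlow t u) ≤ 5 * ‖u‖ₑ := by
  have hI : ∀ T : ℝ, mixedNorm (Set.Icc (-T) T) (fun t => freeFlow t u) ≤ 5 * ‖u‖ₑ := by
    intro T
    obtain ⟨w, hw⟩ : ∃ w : ℕ → SchwartzMap Space ℂ,
        Tendsto (fun n => ((w n).toLp 2 volume : L2)) atTop (𝓝 u) := by
      obtain ⟨v, hv, hvu⟩ := mem_closure_iff_seq_limit.mp (denseRange_schwartz u)
      choose w hw using hv
      exact ⟨w, hvu.congr fun n => (hw n).symm⟩
    refine mixedNorm_le_of_tendsto measurableSet_Icc (fun n => continuous_freeFlow_time _)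
      (fun t _ => ?_) (fun n => strichartz_schwartz_aux (w n) T)
      (ENNReal.Tendsto.const_mul hw.enorm (Or.inr (by norm_num)))
    exact ((freeFlowₗᵢ t).continuous.tendsto u).comp hw
  have hu : mixedNorm Set.univ (fun t => freeFlow t u) ≤ 5 * ‖u‖ₑ := by
    have hmono : Monotone fun n : ℕ => Set.Icc (-(n : ℝ)) n := fun m n h =>
      Set.Icc_subset_Icc (neg_le_neg (by exact_mod_cast h)) (by exact_mod_cast h)
    have hun : ⋃ n : ℕ, Set.Icc (-(n : ℝ)) n = Set.univ := by
      refine Set.eq_univ_of_forall fun t => ?_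
      obtain ⟨n, hn⟩ := exists_nat_ge |t|
      exact Set.mem_iUnion.mpr ⟨n, abs_le.mp hn⟩
    have key : ∫⁻ t, eLpNorm (freeFlow t u) 4 volume ^ (8 / 3 : ℝ) ≤ (5 * ‖u‖ₑ) ^ (8 / 3 : ℝ) := by
      rw [← setLIntegral_univ, ← hun, setLIntegral_iUnion_of_directed _ hmono.directed_le]
      refine iSup_le fun n => ?_
      have := hI n
      rw [← mixedNorm_rpow]
      gcongr
    rw [← setLIntegral_univ, ← mixedNorm_rpow] at key
    exact (ENNReal.rpow_le_rpow_iff (by norm_num)).mp key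
  exact (mixedNorm_mono (Set.subset_univ J) _).trans hu

/-- The inhomogeneous Strichartz estimate. -/
theorem mixedNorm_freeFlow_integral_le {g : ℝ → L2} (hg : Integrable g) (t₀ : ℝ) (J : Set ℝ) :
    mixedNorm J (fun t => freeFlow t (∫ s in t₀..t, g s)) ≤ 5 * ∫⁻ s, ‖g s‖ₑ := by
  have hcont : ∀ {g : ℝ → L2}, Integrable g →
      Continuous fun t => freeFlow t (∫ s in t₀..t, g s) := fun hg =>
    continuous_freeFlow_comp continuous_id
      (intervalIntegral.continuous_primitive (fun a b => hg.intervalIntegrable) t₀)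
  refine (mixedNorm_mono (Set.subset_univ J) _).trans ?_
  -- This is Minkowski's inequality by induction on `g`. For `g = 1_A c` the truncated integral is a
  -- scalar of modulus at most `|A|` times the fixed vector `c`, so the homogeneous estimate
  -- applies. Sums of functions with disjoint supports have additive `L¹` norms, and limits are
  -- handled by Fatou.
  refine Integrable.induction (P := fun g => mixedNorm Set.univ
    (fun t => freeFlow t (∫ s in t₀..t, g s)) ≤ 5 * ∫⁻ s, ‖g s‖ₑ) ?_ ?_ ?_ ?_ hg
  · intro c A hA hAfin
    have hi : ∀ t, (∫ s in t₀..t, A.indicator (fun _ => c) s)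
        = ((∫ s in t₀..t, A.indicator (fun _ => (1 : ℝ)) s : ℝ) : ℂ) • c := fun t => by
      rw [← intervalIntegral.integral_ofReal, ← intervalIntegral.integral_smul_const]
      refine intervalIntegral.integral_congr fun s _ => ?_
      by_cases hs : s ∈ A <;> simp [hs]
    have hb : ∀ t, ‖((∫ s in t₀..t, A.indicator (fun _ => (1 : ℝ)) s : ℝ) : ℂ)‖ₑ ≤ volume A :=
      fun t => by
      rw [← ofReal_norm, Complex.norm_real, ofReal_norm,
        ← ofReal_norm, intervalIntegral.norm_intervalIntegral_eq, ofReal_norm]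
      refine (enorm_integral_le_lintegral_enorm _).trans ?_
      refine (lintegral_mono' Measure.restrict_le_self le_rfl).trans ?_
      have : ∀ s, ‖A.indicator (fun _ => (1 : ℝ)) s‖ₑ = A.indicator (fun _ => (1 : ℝ≥0∞)) s :=
        fun s => by by_cases hs : s ∈ A <;> simp [hs]
      simp [this, lintegral_indicator hA]
    have hn : ∫⁻ s, ‖A.indicator (fun _ => c) s‖ₑ = volume A * ‖c‖ₑ := by
      have : ∀ s, ‖A.indicator (fun _ => c) s‖ₑ = A.indicator (fun _ => ‖c‖ₑ) s :=
        fun s => by by_cases hs : s ∈ A <;> simp [hs]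
      simp [this, lintegral_indicator hA, mul_comm]
    simp only [hi, freeFlow_smul]
    refine (mixedNorm_smul_le _ hb hAfin.ne (fun t => freeFlow t c)).trans ?_
    rw [hn, mul_left_comm]
    gcongr
    exact mixedNorm_freeFlow_le c _
  · intro g h hgh hg hh hPg hPh
    have e1 : ∀ t, freeFlow t (∫ s in t₀..t, (g + h) s)
        = freeFlow t (∫ s in t₀..t, g s) + freeFlow t (∫ s in t₀..t, h s) := fun t => by
      simp only [Pi.add_apply]
      rw [intervalIntegral.integral_add hg.intervalIntegrable hh.intervalIntegrable, freeFlow_add]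
    have e2 : ∫⁻ s, ‖(g + h) s‖ₑ = (∫⁻ s, ‖g s‖ₑ) + ∫⁻ s, ‖h s‖ₑ := by
      rw [← lintegral_add_left' hg.1.enorm]
      refine lintegral_congr fun s => ?_
      by_cases hs : g s = 0
      · simp [hs]
      · have : h s = 0 := by
          by_contra hne
          exact Set.disjoint_left.mp hgh hs hne
        simp [this]
    simp only [e1]
    refine (mixedNorm_add_le _ (hcont hg) (hcont hh)).trans ?_
    rw [e2, mul_add]
    exact add_le_add hPg hPh
  · refine IsSeqClosed.isClosed fun v w hv hvw => ?_
    refine mixedNorm_le_of_tendsto MeasurableSet.univ (fun n => hcont (L1.integrable_coeFn (v n)))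
      (fun t _ => ?_) hv ?_
    · have h1 : Tendsto (fun n => ∫ s in t₀..t, v n s) atTop (𝓝 (∫ s in t₀..t, w s)) := by
        simp only [intervalIntegral]
        exact ((continuous_setIntegral _).tendsto w |>.comp hvw).sub
          ((continuous_setIntegral _).tendsto w |>.comp hvw)
      exact ((freeFlowₗᵢ t).continuous.tendsto _).comp h1
    · have h2 : ∀ f : ℝ →₁[volume] L2, ∫⁻ s, ‖f s‖ₑ = ‖f‖ₑ := fun f => by
        rw [Lp.enorm_def, eLpNorm_one_eq_lintegral_enorm]
      simp only [h2]
      exact ENNReal.Tendsto.const_mul hvw.enorm (Or.inr (by norm_num))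
  · intro f g hfg _ hPf
    have e1 : ∀ t, (∫ s in t₀..t, g s) = ∫ s in t₀..t, f s := fun t =>
      intervalIntegral.integral_congr_ae (hfg.mono fun s hs _ => hs.symm)
    have e2 : ∫⁻ s, ‖g s‖ₑ = ∫⁻ s, ‖f s‖ₑ :=
      lintegral_congr_ae (hfg.mono fun s hs => by simp only [hs])
    simp only [e1, e2]
    exact hPf

/-! ### Estimates of the nonlinearity -/

theorem eLpNorm_two_sq {F : Type*} [NormedAddCommGroup F] (f : Space → F) :
    eLpNorm f 2 volume ^ 2 = ∫⁻ x, ‖f x‖ₑ ^ 2 := by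
  rw [eLpNorm_eq_lintegral_rpow_enorm_toReal (by norm_num) (by norm_num),
    ← ENNReal.rpow_natCast, ← ENNReal.rpow_mul]
  simp

theorem eLpNorm_four_pow {F : Type*} [NormedAddCommGroup F] (f : Space → F) :
    eLpNorm f 4 volume ^ 4 = ∫⁻ x, ‖f x‖ₑ ^ 4 := by
  rw [eLpNorm_eq_lintegral_rpow_enorm_toReal (by norm_num) (by norm_num),
    ← ENNReal.rpow_natCast, ← ENNReal.rpow_mul]
  simp only [ENNReal.toReal_ofNat, ← ENNReal.rpow_natCast]
  norm_num

theorem sqrt_lintegral_pow_four {F : Type*} [NormedAddCommGroup F] (f : Space → F) :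
    (∫⁻ x, ‖f x‖ₑ ^ 4) ^ (1 / 2 : ℝ) = eLpNorm f 4 volume ^ 2 := by
  rw [← eLpNorm_four_pow, ← ENNReal.rpow_natCast, ← ENNReal.rpow_natCast, ← ENNReal.rpow_mul]
  norm_num

theorem aemeasurable_lintegral_mul_sub {p q : Space → ℝ≥0∞} (hp : AEMeasurable p)
    (hq : AEMeasurable q) : AEMeasurable fun x => ∫⁻ y, p y * q (x - y) := by
  refine AEMeasurable.lintegral_prod_right' (f := fun z : Space × Space => p z.2 * q (z.1 - z.2)) ?_
  exact (hp.comp_quasiMeasurePreserving Measure.quasiMeasurePreserving_snd).mul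
    (hq.comp_quasiMeasurePreserving (quasiMeasurePreserving_sub volume volume))

theorem lintegral_mul_sub_sq_le {p q : Space → ℝ≥0∞} (hp : AEMeasurable p)
    (hq : AEMeasurable q) (x : Space) :
    (∫⁻ y, p y * q (x - y)) ^ 2 ≤ (∫⁻ y, p y ^ 2) * ∫⁻ y, q y ^ 2 := by
  have h := lintegral_mul_sq_le hp (aemeasurable_comp_sub hq x)
  rwa [lintegral_sub_left_eq x fun z => q z ^ 2] at h

/-- Here `a` stands for `|u - v|`, which is to be measured in `L²` only. Cauchy-Schwarz in `y` pulls
it out; Fubini and Cauchy-Schwarz in `x` then put `b` and `w` into `L⁴`. -/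
theorem lintegral_convolution_sq_mul_sq_le {p a b w : Space → ℝ≥0∞} (hp : AEMeasurable p)
    (ha : AEMeasurable a) (hb : AEMeasurable b) (hw : AEMeasurable w) :
    ∫⁻ x, ((∫⁻ y, p y * (a (x - y) * b (x - y))) * w x) ^ 2
      ≤ (∫⁻ y, p y ^ 2) * (∫⁻ y, a y ^ 2) *
        ((∫⁻ y, b y ^ 4) ^ (1 / 2 : ℝ) * (∫⁻ y, w y ^ 4) ^ (1 / 2 : ℝ)) := by
  set A := ∫⁻ y, a y ^ 2 with hA
  set D := (∫⁻ y, b y ^ 4) ^ (1 / 2 : ℝ) * (∫⁻ y, w y ^ 4) ^ (1 / 2 : ℝ) with hD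
  have h1 : ∀ x, ((∫⁻ y, p y * (a (x - y) * b (x - y))) * w x) ^ 2
      ≤ A * ∫⁻ y, p y ^ 2 * (b (x - y) ^ 2 * w x ^ 2) := fun x => by
    have hax := aemeasurable_comp_sub ha x
    have hbx := aemeasurable_comp_sub hb x
    have h2 := lintegral_mul_sq_le (hp.mul hbx) hax
    rw [lintegral_sub_left_eq x fun z => a z ^ 2] at h2
    have e1 : ∫⁻ y, p y * (a (x - y) * b (x - y)) = ∫⁻ y, p y * b (x - y) * a (x - y) :=
      lintegral_congr fun y => by ring
    have e2 : ∫⁻ y, p y ^ 2 * (b (x - y) ^ 2 * w x ^ 2)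
        = (∫⁻ y, (p y * b (x - y)) ^ 2) * w x ^ 2 := by
      have hm : AEMeasurable fun y => (p y * b (x - y)) ^ 2 := (hp.mul hbx).pow_const 2
      rw [← lintegral_mul_const'' _ hm]
      exact lintegral_congr fun y => by ring
    rw [e1, mul_pow, e2, ← mul_assoc]
    gcongr
    rw [mul_comm]
    exact h2
  have hm : AEMeasurable (fun z : Space × Space => p z.2 ^ 2 * (b (z.1 - z.2) ^ 2 * w z.1 ^ 2))
      (volume.prod volume) :=
    ((hp.comp_quasiMeasurePreserving Measure.quasiMeasurePreserving_snd).pow_const 2).mul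
      (((hb.comp_quasiMeasurePreserving (quasiMeasurePreserving_sub volume volume)).pow_const 2).mul
        ((hw.comp_quasiMeasurePreserving Measure.quasiMeasurePreserving_fst).pow_const 2))
  have hin : ∀ y, ∫⁻ x, b (x - y) ^ 2 * w x ^ 2 ≤ D := fun y => by
    have hby : AEMeasurable fun x => b (x - y) := hb.comp_quasiMeasurePreserving
      (measurePreserving_sub_right volume y).quasiMeasurePreserving
    have h3 := lintegral_mul_sq_le (hby.pow_const 2) (hw.pow_const 2)
    have e3 : ∫⁻ x, (b (x - y) ^ 2) ^ 2 = ∫⁻ x, b x ^ 4 := by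
      rw [lintegral_sub_right_eq_self (fun z => (b z ^ 2) ^ 2) y]
      exact lintegral_congr fun y => by ring
    have e4 : ∫⁻ x, (w x ^ 2) ^ 2 = ∫⁻ x, w x ^ 4 := lintegral_congr fun y => by ring
    rw [e3, e4] at h3
    have h4 := ENNReal.rpow_le_rpow h3 (show (0 : ℝ) ≤ 1 / 2 by norm_num)
    rw [← ENNReal.rpow_natCast, ← ENNReal.rpow_mul,
      ENNReal.mul_rpow_of_nonneg _ _ (by norm_num)] at h4
    simpa [hD] using h4
  calc ∫⁻ x, ((∫⁻ y, p y * (a (x - y) * b (x - y))) * w x) ^ 2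
      ≤ ∫⁻ x, A * ∫⁻ y, p y ^ 2 * (b (x - y) ^ 2 * w x ^ 2) := lintegral_mono h1
    _ = A * ∫⁻ x, ∫⁻ y, p y ^ 2 * (b (x - y) ^ 2 * w x ^ 2) :=
        lintegral_const_mul'' _ hm.lintegral_prod_right'
    _ = A * ∫⁻ y, ∫⁻ x, p y ^ 2 * (b (x - y) ^ 2 * w x ^ 2) := by
        rw [lintegral_lintegral_swap hm]
    _ ≤ A * ∫⁻ y, p y ^ 2 * D := by
        gcongr with y
        rw [lintegral_const_mul'']
        · gcongr
          exact hin y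
        · have hby : AEMeasurable fun x => b (x - y) := hb.comp_quasiMeasurePreserving
            (measurePreserving_sub_right volume y).quasiMeasurePreserving
          exact (hby.pow_const 2).mul (hw.pow_const 2)
    _ = _ := by
        rw [lintegral_mul_const'' _ (hp.pow_const 2)]
        ring

/-- Cauchy-Schwarz in `x` and again in `y`. The bound involves no norm of `u` beyond `L²`, so mass
conservation makes it uniform in time. -/
theorem lintegral_convolution_mul_sq_le {p u : Space → ℝ≥0∞} (hp : AEMeasurable p)
    (hu : AEMeasurable u) :
    (∫⁻ x, (∫⁻ y, p y * u (x - y) ^ 2) * u x) ^ 2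
      ≤ (∫⁻ y, p y ^ 2) * (∫⁻ y, u y ^ 2) ^ 3 := by
  set U := ∫⁻ y, u y ^ 2 with hU
  have hV : ∀ x, (∫⁻ y, p y * u (x - y) ^ 2) ^ 2 ≤ (∫⁻ y, p y ^ 2 * u (x - y) ^ 2) * U := fun x => by
    have hux := aemeasurable_comp_sub hu x
    have h2 := lintegral_mul_sq_le (hp.mul hux) hux
    rw [lintegral_sub_left_eq x fun z => u z ^ 2] at h2
    have e1 : ∫⁻ y, p y * u (x - y) ^ 2 = ∫⁻ y, p y * u (x - y) * u (x - y) :=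
      lintegral_congr fun y => by ring
    have e2 : ∫⁻ y, p y ^ 2 * u (x - y) ^ 2 = ∫⁻ y, (p y * u (x - y)) ^ 2 :=
      lintegral_congr fun y => by ring
    rwa [e1, e2]
  calc (∫⁻ x, (∫⁻ y, p y * u (x - y) ^ 2) * u x) ^ 2
      ≤ (∫⁻ x, (∫⁻ y, p y * u (x - y) ^ 2) ^ 2) * U :=
        lintegral_mul_sq_le (aemeasurable_lintegral_mul_sub hp (hu.pow_const 2)) hu
    _ ≤ (∫⁻ x, (∫⁻ y, p y ^ 2 * u (x - y) ^ 2) * U) * U := by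
        gcongr with x; exact hV x
    _ = _ := by
        rw [lintegral_mul_const'' _
          (aemeasurable_lintegral_mul_sub (hp.pow_const 2) (hu.pow_const 2)),
          lintegral_lintegral_mul_sub (hp.pow_const 2) (hu.pow_const 2)]
        ring

/-- The potential `g * |u|²`. -/
def potential (g : Space → ℝ) (u : Space → ℂ) : Space → ℝ :=
  g ⋆[ContinuousLinearMap.mul ℝ ℝ, volume] fun y => ‖u y‖ ^ 2

theorem hartreeTerm_eq (g : Space → ℝ) (u : Space → ℂ) (x : Space) :
    hartreeTerm g u x = (potential g u x : ℂ) * u x := rfl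

theorem potential_eq (g : Space → ℝ) (u : Space → ℂ) (x : Space) :
    potential g u x = ∫ y, g y * ‖u (x - y)‖ ^ 2 := rfl

theorem aestronglyMeasurable_potential (g : RealL2) (u : L2) :
    AEStronglyMeasurable (potential g u) (volume : Measure Space) :=
  (AEStronglyMeasurable.convolution_integrand (ContinuousLinearMap.mul ℝ ℝ)
    (Lp.aestronglyMeasurable g) ((Lp.aestronglyMeasurable u).norm.pow 2)).integral_prod_right'

theorem aestronglyMeasurable_hartreeTerm (g : RealL2) (u : L2) :
    AEStronglyMeasurable (hartreeTerm g u) (volume : Measure Space) :=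
  (Complex.continuous_ofReal.comp_aestronglyMeasurable (aestronglyMeasurable_potential g u)).mul
    (Lp.aestronglyMeasurable u)

theorem enorm_potential_le_lintegral (g : Space → ℝ) (u : Space → ℂ) (x : Space) :
    ‖potential g u x‖ₑ ≤ ∫⁻ y, ‖g y‖ₑ * ‖u (x - y)‖ₑ ^ 2 := by
  rw [potential_eq]
  refine (enorm_integral_le_lintegral_enorm _).trans (le_of_eq (lintegral_congr fun y => ?_))
  rw [enorm_mul, enorm_pow, enorm_norm]

theorem lintegral_potential_le (g : RealL2) (u : L2) (x : Space) :
    ∫⁻ y, ‖g y‖ₑ * ‖u (x - y)‖ₑ ^ 2 ≤ ‖g‖ₑ * eLpNorm u 4 volume ^ 2 := by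
  have h := lintegral_mul_sub_sq_le (Lp.aestronglyMeasurable g).enorm
    ((Lp.aestronglyMeasurable u).enorm.pow_const 2) x
  have e : ∫⁻ y, (‖u y‖ₑ ^ 2) ^ 2 = eLpNorm u 4 volume ^ 4 := by
    rw [eLpNorm_four_pow]; exact lintegral_congr fun y => by ring
  rw [e, ← eLpNorm_two_sq, ← Lp.enorm_def] at h
  refine (ENNReal.pow_le_pow_left_iff two_ne_zero).mp (h.trans (le_of_eq (by ring)))

theorem potential_bound_ne_top (g : RealL2) {u : L2} (hu : eLpNorm u 4 volume < ∞) :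
    ‖g‖ₑ * eLpNorm u 4 volume ^ 2 ≠ ∞ :=
  ENNReal.mul_ne_top enorm_ne_top (ENNReal.pow_ne_top hu.ne)

theorem enorm_potential_le (g : RealL2) (u : L2) (x : Space) :
    ‖potential g u x‖ₑ ≤ ‖g‖ₑ * eLpNorm u 4 volume ^ 2 :=
  (enorm_potential_le_lintegral _ _ x).trans (lintegral_potential_le g u x)

theorem eLpNorm_hartreeTerm_le (g : RealL2) (u : L2) :
    eLpNorm (hartreeTerm g u) 2 volume ≤ ‖g‖ₑ * eLpNorm u 4 volume ^ 2 * ‖u‖ₑ := by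
  by_cases h4 : ‖g‖ₑ * eLpNorm u 4 volume ^ 2 = ∞
  · by_cases hu : ‖u‖ₑ = 0
    · have hu' : u = 0 := by rwa [enorm_eq_zero] at hu
      have h0 : hartreeTerm g u =ᵐ[volume] 0 := by
        filter_upwards [Lp.coeFn_zero ℂ 2 (volume : Measure Space)] with x hx
        rw [hartreeTerm_eq, hu', hx]
        simp
      rw [eLpNorm_congr_ae h0, eLpNorm_zero]
      exact zero_le
    · rw [h4, ENNReal.top_mul hu]; exact le_top
  refine (ENNReal.pow_le_pow_left_iff two_ne_zero).mp ?_
  rw [eLpNorm_two_sq, mul_pow, Lp.enorm_def u, eLpNorm_two_sq,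
    ← lintegral_const_mul' _ _ (ENNReal.pow_ne_top h4)]
  refine lintegral_mono fun x => ?_
  rw [← mul_pow, hartreeTerm_eq, enorm_mul, ← ofReal_norm (potential g u x : ℂ), Complex.norm_real,
    ofReal_norm]
  gcongr
  exact enorm_potential_le g u x

theorem memLp_hartreeTerm (g : RealL2) {u : L2} (hu : eLpNorm u 4 volume < ∞) :
    MemLp (hartreeTerm g u) 2 volume :=
  ⟨aestronglyMeasurable_hartreeTerm g u,
    (eLpNorm_hartreeTerm_le g u).trans_lt
      (ENNReal.mul_ne_top (potential_bound_ne_top g hu) enorm_ne_top).lt_top⟩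

open Classical in
/-- The nonlinearity as a map into `L²`, set to zero outside `L⁴`. -/
def nonlin (g : RealL2) (u : L2) : L2 :=
  if hu : eLpNorm u 4 volume < ∞ then (memLp_hartreeTerm g hu).toLp _ else 0

theorem nonlin_coe (g : RealL2) {u : L2} (hu : eLpNorm u 4 volume < ∞) :
    (nonlin g u : Space → ℂ) =ᵐ[volume] hartreeTerm g u := by
  rw [nonlin, dif_pos hu]
  exact (memLp_hartreeTerm g hu).coeFn_toLp

theorem nonlin_of_eq_top (g : RealL2) {u : L2} (hu : eLpNorm u 4 volume = ∞) :
    nonlin g u = 0 := by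
  rw [nonlin, dif_neg (by simp [hu])]

theorem enorm_nonlin_le (g : RealL2) (u : L2) :
    ‖nonlin g u‖ₑ ≤ ‖g‖ₑ * eLpNorm u 4 volume ^ 2 * ‖u‖ₑ := by
  by_cases hu : eLpNorm u 4 volume < ∞
  · rw [Lp.enorm_def, eLpNorm_congr_ae (nonlin_coe g hu)]
    exact eLpNorm_hartreeTerm_le g u
  · rw [nonlin_of_eq_top g (not_lt_top_iff.mp hu), enorm_zero]
    exact zero_le

theorem integrable_potential (g : RealL2) {u : L2} (hu : eLpNorm u 4 volume < ∞) (x : Space) :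
    Integrable fun y => g y * ‖u (x - y)‖ ^ 2 := by
  have hm : AEStronglyMeasurable (fun y => u (x - y)) volume :=
    (Lp.aestronglyMeasurable u).comp_quasiMeasurePreserving
      (quasiMeasurePreserving_sub_left volume x)
  refine ⟨(Lp.aestronglyMeasurable g).mul (hm.norm.pow 2), ?_⟩
  rw [HasFiniteIntegral]
  refine lt_of_le_of_lt (le_of_eq (lintegral_congr fun y => ?_))
    ((lintegral_potential_le g u x).trans_lt (potential_bound_ne_top g hu).lt_top)
  rw [enorm_mul, enorm_pow, enorm_norm]

theorem enorm_potential_sub_le (g : RealL2) {u v : L2} (hu : eLpNorm u 4 volume < ∞)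
    (hv : eLpNorm v 4 volume < ∞) (x : Space) :
    ‖potential g u x - potential g v x‖ₑ
      ≤ ∫⁻ y, ‖g y‖ₑ * (‖u (x - y) - v (x - y)‖ₑ * (‖u (x - y)‖ₑ + ‖v (x - y)‖ₑ)) := by
  rw [potential_eq, potential_eq,
    ← integral_sub (integrable_potential g hu x) (integrable_potential g hv x)]
  refine (enorm_integral_le_lintegral_enorm _).trans (lintegral_mono fun y => ?_)
  rw [← mul_sub, enorm_mul, sq_sub_sq, mul_comm (_ + _), enorm_mul]
  gcongr
  · rw [← ofReal_norm, ← ofReal_norm]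
    exact ENNReal.ofReal_le_ofReal (abs_norm_sub_norm_le _ _)
  · refine (enorm_add_le _ _).trans ?_
    rw [enorm_norm, enorm_norm]

/-- The difference is `V_u (u - v) + (V_u - V_v) v`: the sup bound of the potential handles the
first term, `lintegral_convolution_sq_mul_sq_le` the second. The difference enters through its `L²`
norm alone, so the contraction can be run in the `L²` metric. -/
theorem enorm_nonlin_sub_le (g : RealL2) {u v : L2} (hu : eLpNorm u 4 volume < ∞)
    (hv : eLpNorm v 4 volume < ∞) :
    ‖nonlin g u - nonlin g v‖ₑ
      ≤ 2 * ‖g‖ₑ * (eLpNorm u 4 volume ^ 2 + eLpNorm v 4 volume ^ 2) * ‖u - v‖ₑ := by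
  have hgm := (Lp.aestronglyMeasurable g)
  have hum := (Lp.aestronglyMeasurable u)
  have hvm := (Lp.aestronglyMeasurable v)
  set F1 : Space → ℂ := fun x => (potential g u x : ℂ) * (u x - v x) with hF1
  set F2 : Space → ℂ := fun x => ((potential g u x - potential g v x : ℝ) : ℂ) * v x with hF2
  have hF1m : AEStronglyMeasurable F1 volume :=
    (Complex.continuous_ofReal.comp_aestronglyMeasurable (aestronglyMeasurable_potential g u)).mul
      (hum.sub hvm)
  have hF2m : AEStronglyMeasurable F2 volume :=
    (Complex.continuous_ofReal.comp_aestronglyMeasurable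
      ((aestronglyMeasurable_potential g u).sub (aestronglyMeasurable_potential g v))).mul hvm
  have hae : ((nonlin g u - nonlin g v : L2) : Space → ℂ) =ᵐ[volume] F1 + F2 := by
    filter_upwards [Lp.coeFn_sub (nonlin g u) (nonlin g v), nonlin_coe g hu, nonlin_coe g hv]
      with x h1 h2 h3
    rw [h1, Pi.sub_apply, h2, h3, hartreeTerm_eq, hartreeTerm_eq, Pi.add_apply, hF1, hF2]
    push_cast
    ring
  have b1 : eLpNorm F1 2 volume ≤ ‖g‖ₑ * eLpNorm u 4 volume ^ 2 * ‖u - v‖ₑ := by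
    refine (ENNReal.pow_le_pow_left_iff two_ne_zero).mp ?_
    rw [eLpNorm_two_sq, mul_pow, Lp.enorm_def (u - v), eLpNorm_two_sq,
      ← lintegral_const_mul' _ _ (ENNReal.pow_ne_top (potential_bound_ne_top g hu))]
    refine lintegral_mono_ae ?_
    filter_upwards [Lp.coeFn_sub u v] with x hx
    rw [← mul_pow, hF1, enorm_mul, ← ofReal_norm (potential g u x : ℂ), Complex.norm_real,
      ofReal_norm, hx]
    gcongr
    · exact enorm_potential_le g u x
    · exact le_rfl
  have b2 : eLpNorm F2 2 volume ≤ ‖g‖ₑ * ((eLpNorm u 4 volume + eLpNorm v 4 volume)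
      * eLpNorm v 4 volume) * ‖u - v‖ₑ := by
    refine (ENNReal.pow_le_pow_left_iff two_ne_zero).mp ?_
    have h := lintegral_convolution_sq_mul_sq_le hgm.enorm (hum.sub hvm).enorm
      (hum.norm.add hvm.norm).enorm hvm.enorm
    rw [sqrt_lintegral_pow_four, sqrt_lintegral_pow_four, ← eLpNorm_two_sq, ← eLpNorm_two_sq,
      ← Lp.enorm_def, ← eLpNorm_congr_ae (Lp.coeFn_sub u v), ← Lp.enorm_def] at h
    have h3 : eLpNorm ((fun x => ‖u x‖) + fun x => ‖v x‖) 4 volume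
        ≤ eLpNorm u 4 volume + eLpNorm v 4 volume := by
      refine (eLpNorm_add_le hum.norm hvm.norm (by norm_num)).trans ?_
      rw [eLpNorm_norm, eLpNorm_norm]
    have h4 : eLpNorm F2 2 volume ^ 2 ≤ ‖g‖ₑ ^ 2 * ‖u - v‖ₑ ^ 2 *
        (eLpNorm ((fun x => ‖u x‖) + fun x => ‖v x‖) 4 volume ^ 2 * eLpNorm v 4 volume ^ 2) := by
      rw [eLpNorm_two_sq]
      refine (lintegral_mono fun x => ?_).trans h
      rw [hF2, enorm_mul, ← ofReal_norm ((potential g u x - potential g v x : ℝ) : ℂ),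
        Complex.norm_real, ofReal_norm]
      gcongr
      refine (enorm_potential_sub_le g hu hv x).trans (le_of_eq (lintegral_congr fun y => ?_))
      simp only [Pi.sub_apply, Pi.add_apply]
      congr 2
      rw [← ofReal_norm, ← ofReal_norm, ← ofReal_norm, ← ENNReal.ofReal_add (norm_nonneg _)
        (norm_nonneg _), Real.norm_of_nonneg (by positivity)]
    refine h4.trans ?_
    calc _ ≤ ‖g‖ₑ ^ 2 * ‖u - v‖ₑ ^ 2 * ((eLpNorm u 4 volume + eLpNorm v 4 volume) ^ 2
          * eLpNorm v 4 volume ^ 2) := by gcongr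
      _ = _ := by ring
  rw [Lp.enorm_def, eLpNorm_congr_ae hae]
  refine (eLpNorm_add_le hF1m hF2m (by norm_num)).trans ((add_le_add b1 b2).trans ?_)
  rw [← add_mul, ← mul_add, mul_comm 2 ‖g‖ₑ, mul_assoc ‖g‖ₑ 2]
  gcongr
  set a := eLpNorm u 4 volume
  set b := eLpNorm v 4 volume
  have hab : a * b ≤ a ^ 2 + b ^ 2 := by
    rcases le_total a b with h | h
    · calc a * b ≤ b * b := by gcongr
        _ = b ^ 2 := (sq b).symm
        _ ≤ _ := le_add_self
    · calc a * b ≤ a * a := by gcongr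
        _ = a ^ 2 := (sq a).symm
        _ ≤ _ := le_self_add
  calc a ^ 2 + (a + b) * b = (a ^ 2 + b ^ 2) + a * b := by ring
    _ ≤ (a ^ 2 + b ^ 2) + (a ^ 2 + b ^ 2) := by gcongr
    _ = _ := (two_mul _).symm

theorem nonlin_sub_left (g h : RealL2) (u : L2) :
    nonlin g u - nonlin h u = nonlin (g - h) u := by
  by_cases hu : eLpNorm u 4 volume < ∞
  · apply Lp.ext
    have hsub : ∀ x, potential (g - h : RealL2) u x = potential g u x - potential h u x := by
      intro x
      rw [potential_eq, potential_eq, potential_eq,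
        ← integral_sub (integrable_potential g hu x) (integrable_potential h hu x)]
      refine integral_congr_ae ?_
      filter_upwards [Lp.coeFn_sub g h] with y hy
      rw [hy, Pi.sub_apply, sub_mul]
    filter_upwards [Lp.coeFn_sub (nonlin g u) (nonlin h u), nonlin_coe g hu, nonlin_coe h hu,
      nonlin_coe (g - h) hu] with x h1 h2 h3 h4
    rw [h1, Pi.sub_apply, h2, h3, h4, hartreeTerm_eq, hartreeTerm_eq, hartreeTerm_eq, hsub]
    push_cast
    ring
  · have hu' := not_lt_top_iff.mp hu
    rw [nonlin_of_eq_top _ hu', nonlin_of_eq_top _ hu', nonlin_of_eq_top _ hu', sub_zero]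

/-- The potential is real; this is the origin of mass conservation. -/
theorem inner_nonlin_im (g : RealL2) (u : L2) : (inner ℂ u (nonlin g u)).im = 0 := by
  by_cases hu : eLpNorm u 4 volume < ∞
  · have h : inner ℂ u (nonlin g u) = ((∫ x, potential g u x * ‖u x‖ ^ 2 : ℝ) : ℂ) := by
      rw [L2.inner_def, ← integral_complex_ofReal]
      refine integral_congr_ae ?_
      filter_upwards [nonlin_coe g hu] with x hx
      rw [hx, RCLike.inner_apply, hartreeTerm_eq, mul_assoc, Complex.mul_conj']
      push_cast
      ring
    rw [h, Complex.ofReal_im]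
  · rw [nonlin_of_eq_top g (not_lt_top_iff.mp hu), inner_zero_right, Complex.zero_im]

theorem eLpNorm_one_nonlin_le (g : RealL2) (u : L2) :
    eLpNorm (nonlin g u) 1 volume ≤ ‖g‖ₑ * ‖u‖ₑ ^ 3 := by
  by_cases hu : eLpNorm u 4 volume < ∞
  · rw [eLpNorm_congr_ae (nonlin_coe g hu), eLpNorm_one_eq_lintegral_enorm]
    have h := lintegral_convolution_mul_sq_le (Lp.aestronglyMeasurable g).enorm
      (Lp.aestronglyMeasurable u).enorm
    rw [← eLpNorm_two_sq, ← eLpNorm_two_sq, ← Lp.enorm_def, ← Lp.enorm_def] at h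
    refine (ENNReal.pow_le_pow_left_iff two_ne_zero).mp (le_trans ?_ (h.trans (le_of_eq (by ring))))
    gcongr with x
    rw [hartreeTerm_eq, enorm_mul, ← ofReal_norm (potential g u x : ℂ), Complex.norm_real,
      ofReal_norm]
    gcongr
    exact enorm_potential_le_lintegral _ _ x
  · rw [nonlin_of_eq_top g (not_lt_top_iff.mp hu), eLpNorm_congr_ae (Lp.coeFn_zero ℂ 2 volume),
      eLpNorm_zero]
    exact zero_le

theorem norm_nonlin_le (g : RealL2) {u : L2} {R : ℝ≥0} (hu : eLpNorm u 4 volume ≤ R) :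
    ‖nonlin g u‖ ≤ ‖g‖ * R ^ 2 * ‖u‖ := by
  have h : ‖nonlin g u‖ₑ ≤ ‖g‖ₑ * (R : ℝ≥0∞) ^ 2 * ‖u‖ₑ :=
    (enorm_nonlin_le g u).trans (by gcongr)
  simp only [enorm_eq_nnnorm] at h
  exact_mod_cast h

theorem norm_nonlin_sub_le (g : RealL2) {u v : L2} {R : ℝ≥0} (hu : eLpNorm u 4 volume ≤ R)
    (hv : eLpNorm v 4 volume ≤ R) :
    ‖nonlin g u - nonlin g v‖ ≤ 2 * ‖g‖ * (R ^ 2 + R ^ 2) * ‖u - v‖ := by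
  have h : ‖nonlin g u - nonlin g v‖ₑ
      ≤ 2 * ‖g‖ₑ * ((R : ℝ≥0∞) ^ 2 + (R : ℝ≥0∞) ^ 2) * ‖u - v‖ₑ :=
    (enorm_nonlin_sub_le g (hu.trans_lt ENNReal.coe_lt_top)
      (hv.trans_lt ENNReal.coe_lt_top)).trans (by gcongr)
  simp only [enorm_eq_nnnorm] at h
  exact_mod_cast h

theorem continuousOn_nonlin {f : ℝ → RealL2} (hf : Continuous f) {ψ : ℝ → L2}
    (hψ : Continuous ψ) (R : ℝ≥0) :
    ContinuousOn (fun s => nonlin (f s) (ψ s)) {s | eLpNorm (ψ s) 4 volume ≤ R} := by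
  intro s hs
  rw [ContinuousWithinAt, tendsto_iff_norm_sub_tendsto_zero]
  have hb : Continuous fun r => 2 * ‖f r‖ * ((R : ℝ) ^ 2 + R ^ 2) * ‖ψ r - ψ s‖
      + ‖f r - f s‖ * R ^ 2 * ‖ψ s‖ := by fun_prop
  refine squeeze_zero' (Eventually.of_forall fun _ => norm_nonneg _) ?_
    ((hb.tendsto' s 0 (by simp)).mono_left nhdsWithin_le_nhds)
  filter_upwards [self_mem_nhdsWithin] with r hr
  rw [← sub_add_sub_cancel _ (nonlin (f r) (ψ s)), nonlin_sub_left]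
  exact (norm_add_le _ _).trans (add_le_add (norm_nonlin_sub_le _ hr hs) (norm_nonlin_le _ hs))

/-- Along an `L²`-continuous curve the nonlinearity need not be continuous, but it is on each closed
set where the `L⁴` norm is at most `n`. These sets exhaust the times of finite `L⁴` norm, and at all
others `nonlin` is zero by definition. -/
theorem aestronglyMeasurable_nonlin {f : ℝ → RealL2} (hf : Continuous f) {ψ : ℝ → L2}
    (hψ : Continuous ψ) : AEStronglyMeasurable (fun s => nonlin (f s) (ψ s)) volume := by
  set E : ℕ → Set ℝ := fun n => {s | eLpNorm (ψ s) 4 volume ≤ (n : ℝ≥0)} with hE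
  have hEm : ∀ n, MeasurableSet (E n) := fun n =>
    ((isClosed_setOf_eLpNorm_le 4 n).preimage hψ).measurableSet
  refine aestronglyMeasurable_of_tendsto_ae atTop
    (f := fun n => (E n).indicator fun s => nonlin (f s) (ψ s))
    (fun n => (aestronglyMeasurable_indicator_iff (hEm n)).mpr
      ((continuousOn_nonlin hf hψ n).aestronglyMeasurable (hEm n))) ?_
  refine Eventually.of_forall fun s => ?_
  by_cases hs : eLpNorm (ψ s) 4 volume < ∞
  · obtain ⟨n, hn⟩ := ENNReal.exists_nat_gt hs.ne
    refine tendsto_const_nhds.congr' ?_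
    filter_upwards [eventually_ge_atTop n] with m hm
    rw [Set.indicator_of_mem]
    refine hn.le.trans ?_
    simpa using hm
  · simp only [Set.indicator_apply, nonlin_of_eq_top _ (not_lt_top_iff.mp hs), ite_self]
    exact tendsto_const_nhds

/-! ### Multiplication by a convolution and the free flow -/

theorem continuous_modulate_left (u : L2) : Continuous fun k => modulate k u := by
  refine continuous_iff_continuousAt.mpr fun k => ?_
  refine tendsto_toLp_of_dominated (fun s => memLp_planeWave_mul s (Lp.memLp u))
    (memLp_planeWave_mul k (Lp.memLp u)) (Lp.memLp u) (fun s => ?_) ?_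
  · exact Eventually.of_forall fun x => by rw [norm_mul, norm_planeWave, one_mul]
  · refine Eventually.of_forall fun x => Tendsto.mul_const _ ?_
    have : Continuous fun s => planeWave s x := by unfold planeWave; fun_prop
    exact this.tendsto k

/-- The convolution of two `L²` functions. -/
def conv (a b : L2) (x : Space) : ℂ := ∫ y, a y * b (x - y)

theorem integrable_conv (a b : L2) (x : Space) : Integrable fun y => a y * b (x - y) :=
  (Lp.memLp a).integrable_mul
    ((Lp.memLp b).comp_measurePreserving (Measure.measurePreserving_sub_left volume x))

theorem norm_conv_le (a b : L2) (x : Space) : ‖conv a b x‖ ≤ ‖a‖ * ‖b‖ := by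
  have h : ‖conv a b x‖ₑ ≤ ‖a‖ₑ * ‖b‖ₑ := by
    refine (enorm_integral_le_lintegral_enorm _).trans
      ((ENNReal.pow_le_pow_left_iff two_ne_zero).mp ?_)
    simp only [enorm_mul]
    refine (lintegral_mul_sub_sq_le (Lp.aestronglyMeasurable a).enorm
      (Lp.aestronglyMeasurable b).enorm x).trans (le_of_eq ?_)
    rw [mul_pow, Lp.enorm_def, Lp.enorm_def, eLpNorm_two_sq, eLpNorm_two_sq]
  simp only [enorm_eq_nnnorm] at h
  exact_mod_cast h

theorem conv_sub_left (a a' b : L2) (x : Space) :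
    conv (a - a') b x = conv a b x - conv a' b x := by
  rw [conv, conv, conv, ← integral_sub (integrable_conv a b x) (integrable_conv a' b x)]
  refine integral_congr_ae ?_
  filter_upwards [Lp.coeFn_sub a a'] with y hy
  rw [hy, Pi.sub_apply, sub_mul]

theorem conv_sub_right (a b b' : L2) (x : Space) :
    conv a (b - b') x = conv a b x - conv a b' x := by
  rw [conv, conv, conv, ← integral_sub (integrable_conv a b x) (integrable_conv a b' x)]
  refine integral_congr_ae ?_
  filter_upwards [(Measure.measurePreserving_sub_left volume x).quasiMeasurePreserving.ae
    (Lp.coeFn_sub b b')] with y hy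
  rw [hy, Pi.sub_apply, mul_sub]

theorem aestronglyMeasurable_conv (a b : L2) :
    AEStronglyMeasurable (conv a b) (volume : Measure Space) :=
  (AEStronglyMeasurable.convolution_integrand (ContinuousLinearMap.mul ℂ ℂ)
    (Lp.aestronglyMeasurable a) (Lp.aestronglyMeasurable b)).integral_prod_right'

theorem memLp_conv_mul (a b u : L2) : MemLp (fun x => conv a b x * u x) 2 volume :=
  (Lp.memLp u).of_le_mul ((aestronglyMeasurable_conv a b).mul (Lp.aestronglyMeasurable u))
    (Eventually.of_forall fun x => by
      rw [norm_mul]; exact mul_le_mul_of_nonneg_right (norm_conv_le a b x) (norm_nonneg _))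

/-- The product of `a ⋆ b` and `u`. -/
def convMul (a b u : L2) : L2 := (memLp_conv_mul a b u).toLp _

theorem convMul_coe (a b u : L2) :
    (convMul a b u : Space → ℂ) =ᵐ[volume] fun x => conv a b x * u x :=
  (memLp_conv_mul a b u).coeFn_toLp

theorem norm_convMul_le (a b u : L2) : ‖convMul a b u‖ ≤ ‖a‖ * ‖b‖ * ‖u‖ := by
  refine Lp.norm_le_mul_norm_of_ae_le_mul ?_
  filter_upwards [convMul_coe a b u] with x hx
  rw [hx, norm_mul]
  exact mul_le_mul_of_nonneg_right (norm_conv_le a b x) (norm_nonneg _)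

theorem convMul_sub_left (a a' b u : L2) :
    convMul a b u - convMul a' b u = convMul (a - a') b u := by
  apply Lp.ext
  filter_upwards [Lp.coeFn_sub (convMul a b u) (convMul a' b u), convMul_coe a b u,
    convMul_coe a' b u, convMul_coe (a - a') b u] with x h1 h2 h3 h4
  rw [h1, Pi.sub_apply, h2, h3, h4, conv_sub_left, sub_mul]

theorem convMul_sub_right (a b b' u : L2) :
    convMul a b u - convMul a b' u = convMul a (b - b') u := by
  apply Lp.ext
  filter_upwards [Lp.coeFn_sub (convMul a b u) (convMul a b' u), convMul_coe a b u,
    convMul_coe a b' u, convMul_coe a (b - b') u] with x h1 h2 h3 h4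
  rw [h1, Pi.sub_apply, h2, h3, h4, conv_sub_right, sub_mul]

theorem tendsto_convMul {a b : ℕ → L2} {a₀ b₀ : L2} (ha : Tendsto a atTop (𝓝 a₀))
    (hb : Tendsto b atTop (𝓝 b₀)) (u : L2) :
    Tendsto (fun n => convMul (a n) (b n) u) atTop (𝓝 (convMul a₀ b₀ u)) := by
  rw [tendsto_iff_norm_sub_tendsto_zero] at ha hb ⊢
  have hb' : Tendsto (fun n => ‖b n - b₀‖ + ‖b₀‖) atTop (𝓝 (0 + ‖b₀‖)) := hb.add_const _
  have h := ((ha.mul hb').mul_const ‖u‖).add ((hb.const_mul ‖a₀‖).mul_const ‖u‖)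
  simp only [zero_mul, mul_zero, add_zero] at h
  refine squeeze_zero (fun _ => norm_nonneg _) (fun n => ?_) h
  rw [← sub_add_sub_cancel _ (convMul a₀ (b n) u), convMul_sub_left, convMul_sub_right]
  refine (norm_add_le _ _).trans (add_le_add ((norm_convMul_le _ _ _).trans ?_)
    (norm_convMul_le _ _ _))
  gcongr
  simpa using norm_add_le (b n - b₀) b₀

theorem integrable_smul_modulate (h : SchwartzMap Space ℂ) (u : L2) :
    Integrable (fun k => h k • modulate k u) := by
  refine Integrable.mono' (h.integrable.norm.mul_const ‖u‖)
    (h.continuous.smul (continuous_modulate_left u)).aestronglyMeasurable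
    (Eventually.of_forall fun k => ?_)
  rw [norm_smul, Lp.norm_def (modulate k u), eLpNorm_modulate, ← Lp.norm_def]

/-- Fourier inversion writes the convolution as a superposition of plane waves. The identity between
vectors of `L²` is checked by pairing with `φ` and applying Fubini. -/
theorem convMul_schwartz (a b : SchwartzMap Space ℂ) (u : L2) :
    convMul (a.toLp 2) (b.toLp 2) u
      = ∫ k, (𝓕 (SchwartzMap.convolution (ContinuousLinearMap.mul ℂ ℂ) a b) k) • modulate k u := by
  set V := SchwartzMap.convolution (ContinuousLinearMap.mul ℂ ℂ) a b with hV
  have hVx : ∀ x, conv (a.toLp 2) (b.toLp 2) x = V x := fun x => by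
    rw [hV, SchwartzMap.convolution_apply, conv]
    refine integral_congr_ae ?_
    filter_upwards [a.coeFn_toLp 2 volume,
      (Measure.measurePreserving_sub_left volume x).quasiMeasurePreserving.ae
        (b.coeFn_toLp 2 volume)] with y h1 h2
    rw [h1, h2]
    rfl
  have hVi : ∀ x, V x = ∫ k, planeWave k x * 𝓕 V k := fun x => by
    have h1 : V x = 𝓕⁻ (𝓕 V) x := by rw [FourierTransform.fourierInv_fourier_eq]
    rw [h1, SchwartzMap.fourierInv_coe, Real.fourierInv_eq']
    rfl
  have hint := integrable_smul_modulate (𝓕 V) u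
  refine ext_inner_left ℂ fun φ => ?_
  rw [← integral_inner hint, L2.inner_def]
  have hF : Integrable (fun z : Space × Space =>
      𝓕 V z.1 * (planeWave z.1 z.2 * (u z.2 * (starRingEnd ℂ) (φ z.2))))
      (volume.prod volume) := by
    have h1 : Integrable fun x => u x * (starRingEnd ℂ) (φ x) :=
      (Lp.memLp u).integrable_mul (Lp.memLp φ).star
    have h2 := (𝓕 V).integrable.mul_prod h1 (μ := (volume : Measure Space))
    refine h2.mono ?_ (Eventually.of_forall fun z => ?_)
    · have := (h2.1.mul (continuous_planeWave.aestronglyMeasurable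
        (μ := (volume : Measure Space).prod volume)))
      refine this.congr (Eventually.of_forall fun z => ?_)
      simp only [Pi.mul_apply]
      ring
    · simp only [norm_mul, norm_planeWave, one_mul, le_refl]
  have e1 : ∀ k, inner ℂ φ (𝓕 V k • modulate k u)
      = ∫ x, 𝓕 V k * (planeWave k x * (u x * (starRingEnd ℂ) (φ x))) := fun k => by
    rw [inner_smul_right, L2.inner_def, ← integral_const_mul]
    refine integral_congr_ae ?_
    filter_upwards [modulate_coe k u] with x hx
    rw [hx, RCLike.inner_apply]
    ring
  simp only [e1]
  rw [integral_integral_swap hF]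
  refine integral_congr_ae ?_
  filter_upwards [convMul_coe (a.toLp 2) (b.toLp 2) u] with x hx
  rw [hx, hVx, hVi, RCLike.inner_apply, mul_assoc, ← integral_mul_const]
  exact integral_congr_ae (Eventually.of_forall fun k => by ring)

/-- The transform of a convolution is a product; Cauchy-Schwarz and Plancherel bound its `L¹` norm.
-/
theorem lintegral_enorm_fourier_convolution_le (a b : SchwartzMap Space ℂ) :
    ∫⁻ k, ‖𝓕 (SchwartzMap.convolution (ContinuousLinearMap.mul ℂ ℂ) a b) k‖ₑ
      ≤ ‖(a.toLp 2 : L2)‖ₑ * ‖(b.toLp 2 : L2)‖ₑ := by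
  have hP : ∀ a : SchwartzMap Space ℂ,
      ‖(a.toLp 2 : L2)‖ₑ = eLpNorm (𝓕 a : SchwartzMap Space ℂ) 2 volume := fun a => by
    rw [← ofReal_norm, ← SchwartzMap.norm_fourier_toL2_eq, ofReal_norm, Lp.enorm_def,
      eLpNorm_congr_ae ((𝓕 a : SchwartzMap Space ℂ).coeFn_toLp 2 volume)]
  refine (ENNReal.pow_le_pow_left_iff two_ne_zero).mp ?_
  rw [mul_pow, hP, hP, eLpNorm_two_sq, eLpNorm_two_sq]
  refine le_trans (le_of_eq ?_) (lintegral_mul_sq_le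
    (𝓕 a).continuous.enorm.aemeasurable (𝓕 b).continuous.enorm.aemeasurable)
  congr 1
  refine lintegral_congr fun k => ?_
  rw [SchwartzMap.fourier_convolution, ← enorm_mul]
  rfl

theorem integrable_freeFlow {α : Type*} [MeasurableSpace α] {μ : Measure α} {F : α → L2}
    (hF : Integrable F μ) (τ : ℝ) : Integrable (fun s => freeFlow τ (F s)) μ :=
  (freeFlowₗᵢ τ).toContinuousLinearMap.integrable_comp hF

theorem freeFlow_integral {α : Type*} [MeasurableSpace α] {μ : Measure α} {F : α → L2}
    (hF : Integrable F μ) (τ : ℝ) : freeFlow τ (∫ s, F s ∂μ) = ∫ s, freeFlow τ (F s) ∂μ :=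
  ((freeFlowₗᵢ τ).toContinuousLinearMap.integral_comp_comm hF).symm

theorem eLpNorm_freeFlow_smul_modulate_le (τ : ℝ) (c : ℂ) (k : Space) (u : L2) {B : ℝ≥0}
    (hB : eLpNorm (freeFlow τ u) ∞ volume ≤ B) :
    eLpNorm (freeFlow τ (c • modulate k u)) ∞ volume ≤ ‖c‖ₑ * B := by
  rw [freeFlow_smul, eLpNorm_smul_coe]
  gcongr
  have := eLpNorm_freeFlow_modulate_freeFlow_neg τ k (freeFlow τ u) ∞
  rw [freeFlow_neg_freeFlow] at this
  rw [this]
  exact hB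

theorem eLpNorm_freeFlow_convMul_schwartz_le (τ : ℝ) (a b : SchwartzMap Space ℂ) (u : L2) {B : ℝ≥0}
    (hB : eLpNorm (freeFlow τ u) ∞ volume ≤ B) :
    eLpNorm (freeFlow τ (convMul (a.toLp 2) (b.toLp 2) u)) ∞ volume
      ≤ ‖(a.toLp 2 : L2)‖ₑ * ‖(b.toLp 2 : L2)‖ₑ * B := by
  have hint := integrable_smul_modulate
    (𝓕 (SchwartzMap.convolution (ContinuousLinearMap.mul ℂ ℂ) a b)) u
  rw [convMul_schwartz, freeFlow_integral hint]
  have hle := mul_le_mul_left (lintegral_enorm_fourier_convolution_le a b) (B : ℝ≥0∞)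
  rw [← lintegral_mul_const' _ _ ENNReal.coe_ne_top] at hle
  have hC : ‖(a.toLp 2 : L2)‖ₑ * ‖(b.toLp 2 : L2)‖ₑ * B
      = ((‖(a.toLp 2 : L2)‖₊ * ‖(b.toLp 2 : L2)‖₊ * B : ℝ≥0) : ℝ≥0∞) := by
    rw [enorm_eq_nnnorm, enorm_eq_nnnorm, ENNReal.coe_mul, ENNReal.coe_mul]
  rw [hC] at hle ⊢
  exact eLpNorm_top_integral_le (integrable_freeFlow hint τ)
    (Eventually.of_forall fun k => eLpNorm_freeFlow_smul_modulate_le τ _ k u hB) hle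

theorem exists_seq_schwartz_tendsto (a : L2) : ∃ s : ℕ → SchwartzMap Space ℂ,
    Tendsto (fun n => ((s n).toLp 2 : L2)) atTop (𝓝 a) := by
  obtain ⟨s, hs, hlim⟩ := mem_closure_iff_seq_limit.mp (denseRange_schwartz a)
  choose r hr using hs
  exact ⟨r, by simpa only [← SchwartzMap.toLpCLM_apply (𝕜 := ℝ), hr] using hlim⟩

/-- Approximation of `a` and `b` by Schwartz functions: the products converge in `L²`, and the `L^∞`
norm is lower semicontinuous there. -/
theorem eLpNorm_freeFlow_convMul_le (τ : ℝ) (a b u : L2) {B : ℝ≥0}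
    (hB : eLpNorm (freeFlow τ u) ∞ volume ≤ B) :
    eLpNorm (freeFlow τ (convMul a b u)) ∞ volume ≤ ‖a‖ₑ * ‖b‖ₑ * B := by
  obtain ⟨s, hs⟩ := exists_seq_schwartz_tendsto a
  obtain ⟨r, hr⟩ := exists_seq_schwartz_tendsto b
  have hlim : Tendsto (fun n => freeFlow τ (convMul ((s n).toLp 2) ((r n).toLp 2) u)) atTop
      (𝓝 (freeFlow τ (convMul a b u))) :=
    ((freeFlowₗᵢ τ).continuous.tendsto _).comp (tendsto_convMul hs hr u)
  refine (eLpNorm_le_liminf ∞ hlim).trans ?_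
  have hlim' : Tendsto (fun n => ‖((s n).toLp 2 : L2)‖ₑ * ‖((r n).toLp 2 : L2)‖ₑ * B) atTop
      (𝓝 (‖a‖ₑ * ‖b‖ₑ * B)) := by
    have h := ENNReal.tendsto_coe.mpr ((hs.nnnorm.mul hr.nnnorm).mul_const B)
    simpa only [ENNReal.coe_mul, ← enorm_eq_nnnorm] using h
  rw [← hlim'.liminf_eq]
  exact liminf_le_liminf (Eventually.of_forall fun n =>
    eLpNorm_freeFlow_convMul_schwartz_le τ _ _ u hB)

/-- Take `a = g` and `b = |u|²`, whose `L²` norm is `‖u‖₄²`. The constant is independent of `τ`,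
whereas the dispersive bound blows up as `τ → 0`. -/
theorem eLpNorm_freeFlow_nonlin_le (τ : ℝ) (g : RealL2) {u : L2} (hu : eLpNorm u 4 volume < ∞)
    {B : ℝ≥0} (hB : eLpNorm (freeFlow τ u) ∞ volume ≤ B) :
    eLpNorm (freeFlow τ (nonlin g u)) ∞ volume ≤ ‖g‖ₑ * eLpNorm u 4 volume ^ 2 * B := by
  have hgm : MemLp (fun x => (g x : ℂ)) 2 volume := (Lp.memLp g).ofReal
  have hq : eLpNorm (fun x => ((‖u x‖ ^ 2 : ℝ) : ℂ)) 2 volume = eLpNorm u 4 volume ^ 2 := by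
    have h : eLpNorm (fun x => ((‖u x‖ ^ 2 : ℝ) : ℂ)) 2 volume ^ 2 = (eLpNorm u 4 volume ^ 2) ^ 2 := by
      rw [eLpNorm_two_sq, ← pow_mul, eLpNorm_four_pow]
      refine lintegral_congr fun x => ?_
      rw [← ofReal_norm, Complex.norm_real, ofReal_norm, enorm_pow, enorm_norm]
      ring
    exact le_antisymm ((ENNReal.pow_le_pow_left_iff two_ne_zero).mp h.le)
      ((ENNReal.pow_le_pow_left_iff two_ne_zero).mp h.ge)
  have hqm : MemLp (fun x => ((‖u x‖ ^ 2 : ℝ) : ℂ)) 2 volume :=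
    ⟨Complex.continuous_ofReal.comp_aestronglyMeasurable
      ((Lp.aestronglyMeasurable u).norm.pow 2), by rw [hq]; exact ENNReal.pow_lt_top hu⟩
  have hconv : ∀ x, conv (hgm.toLp _) (hqm.toLp _) x = (potential g u x : ℂ) := fun x => by
    rw [potential_eq, ← integral_complex_ofReal, conv]
    refine integral_congr_ae ?_
    filter_upwards [hgm.coeFn_toLp,
      (Measure.measurePreserving_sub_left volume x).quasiMeasurePreserving.ae hqm.coeFn_toLp] with y h1 h2
    rw [h1, h2]
    push_cast
    rfl
  have hnl : nonlin g u = convMul (hgm.toLp _) (hqm.toLp _) u := by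
    apply Lp.ext
    filter_upwards [nonlin_coe g hu, convMul_coe (hgm.toLp _) (hqm.toLp _) u] with x h1 h2
    rw [h1, h2, hconv, hartreeTerm_eq]
  have h := eLpNorm_freeFlow_convMul_le τ (hgm.toLp _) (hqm.toLp _) u hB
  rw [← hnl, Lp.enorm_toLp, Lp.enorm_toLp, hq] at h
  have hg : eLpNorm (fun x => (g x : ℂ)) 2 volume = ‖g‖ₑ := by
    rw [Lp.enorm_def]
    exact eLpNorm_congr_norm_ae (Eventually.of_forall fun x => Complex.norm_real _)
  rwa [hg] at h

/-! ### The interaction picture -/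

/-- The right hand side of the Hartree equation in the interaction picture
`φ(t) = exp (i t H₀) ψ(t)`. -/
def source (f : ℝ → RealL2) (φ : ℝ → L2) (s : ℝ) : L2 :=
  (-Complex.I) • freeFlow (-s) (nonlin (f s) (freeFlow s (φ s)))

/-- The `L⁴` norm of the function whose interaction picture is `φ`. -/
def norm4 (φ : ℝ → L2) (s : ℝ) : ℝ≥0∞ := eLpNorm (freeFlow s (φ s)) 4 volume

theorem continuous_freeFlow_self {φ : ℝ → L2} (hφ : Continuous φ) :
    Continuous fun s => freeFlow s (φ s) := continuous_freeFlow_comp continuous_id hφ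

theorem measurable_norm4 {φ : ℝ → L2} (hφ : Continuous φ) : Measurable (norm4 φ) :=
  measurable_eLpNorm_comp 4 (continuous_freeFlow_self hφ)

theorem aestronglyMeasurable_freeFlow_comp {a : ℝ → ℝ} (ha : Continuous a) {h : ℝ → L2}
    {μ : Measure ℝ} (hh : AEStronglyMeasurable h μ) :
    AEStronglyMeasurable (fun s => freeFlow (a s) (h s)) μ := by
  have h1 : AEStronglyMeasurable (fun s => (a s, h s)) μ := ha.aestronglyMeasurable.prodMk hh
  have := Continuous.comp_aestronglyMeasurable (g := fun p : ℝ × L2 => freeFlow p.1 p.2)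
    continuous_freeFlow h1
  simpa only [Function.comp_def] using this

theorem aestronglyMeasurable_source {f : ℝ → RealL2} (hf : Continuous f) {φ : ℝ → L2}
    (hφ : Continuous φ) : AEStronglyMeasurable (source f φ) volume :=
  (aestronglyMeasurable_freeFlow_comp continuous_neg
    (aestronglyMeasurable_nonlin hf (continuous_freeFlow_self hφ))).const_smul (-Complex.I)

theorem enorm_source_eq (f : ℝ → RealL2) (φ : ℝ → L2) (s : ℝ) :
    ‖source f φ s‖ₑ = ‖nonlin (f s) (freeFlow s (φ s))‖ₑ := by
  rw [source, enorm_smul, enorm_neg, enorm_freeFlow, ← ofReal_norm Complex.I, Complex.norm_I,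
    ENNReal.ofReal_one, one_mul]

theorem enorm_source_le (f : ℝ → RealL2) (φ : ℝ → L2) (s : ℝ) :
    ‖source f φ s‖ₑ ≤ ‖f s‖ₑ * norm4 φ s ^ 2 * ‖φ s‖ₑ := by
  rw [enorm_source_eq]
  refine (enorm_nonlin_le _ _).trans (le_of_eq ?_)
  rw [enorm_freeFlow, norm4]

theorem enorm_source_sub_le (f : ℝ → RealL2) {φ χ : ℝ → L2} {s : ℝ} (h1 : norm4 φ s < ∞)
    (h2 : norm4 χ s < ∞) :
    ‖source f φ s - source f χ s‖ₑ
      ≤ 2 * ‖f s‖ₑ * (norm4 φ s ^ 2 + norm4 χ s ^ 2) * ‖φ s - χ s‖ₑ := by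
  rw [source, source, ← smul_sub, ← freeFlow_sub, enorm_smul, enorm_neg, enorm_freeFlow,
    ← ofReal_norm Complex.I, Complex.norm_I, ENNReal.ofReal_one, one_mul]
  refine (enorm_nonlin_sub_le _ h1 h2).trans (le_of_eq ?_)
  rw [← freeFlow_sub, enorm_freeFlow, norm4, norm4]

/-- The flow by `t - s` takes `ψ(s) = e^{-isH₀}φ(s)` to `e^{-itH₀}φ(s)`. With `t` fixed, the same
`L^∞` norm thus stands on both sides, and the estimate closes linearly in it. -/
theorem eLpNorm_top_freeFlow_source_le (f : ℝ → RealL2) (φ : ℝ → L2) (t s : ℝ) {B : ℝ≥0}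
    (hB : eLpNorm (freeFlow t (φ s)) ∞ volume ≤ B) :
    eLpNorm (freeFlow t (source f φ s)) ∞ volume ≤ ‖f s‖ₑ * norm4 φ s ^ 2 * B := by
  rw [source, freeFlow_smul, freeFlow_freeFlow, eLpNorm_smul_coe, enorm_neg,
    ← ofReal_norm Complex.I, Complex.norm_I, ENNReal.ofReal_one, one_mul]
  by_cases h : eLpNorm (freeFlow s (φ s)) 4 volume < ∞
  · refine eLpNorm_freeFlow_nonlin_le (t + -s) (f s) h ?_
    rwa [freeFlow_freeFlow, neg_add_cancel_right]
  · rw [nonlin_of_eq_top _ (not_lt_top_iff.mp h), freeFlow_map_zero,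
      eLpNorm_congr_ae (Lp.coeFn_zero ℂ 2 volume), eLpNorm_zero]
    exact zero_le

/-- Hölder with exponents `4/3` and `4`, as `2 · 4/3 = 8/3`. The power `1/4` of the length is the
gain that makes short intervals perturbative. -/
theorem lintegral_sq_le_mixedNorm (J : Set ℝ) {ψ : ℝ → L2} (hψ : Continuous ψ) :
    ∫⁻ t in J, eLpNorm (ψ t) 4 volume ^ 2 ≤ mixedNorm J ψ ^ 2 * volume J ^ (1 / 4 : ℝ) := by
  have hpq : (4 / 3 : ℝ).HolderConjugate 4 := by constructor <;> norm_num
  have h := ENNReal.lintegral_mul_le_Lp_mul_Lq (volume.restrict J) hpq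
    ((measurable_eLpNorm_comp 4 hψ).pow_const 2).aemeasurable
    (aemeasurable_const (b := (1 : ℝ≥0∞)))
  simp only [Pi.mul_apply, mul_one, ENNReal.one_rpow, lintegral_const, Measure.restrict_apply_univ,
    one_mul] at h
  refine h.trans (le_of_eq ?_)
  congr 1
  rw [mixedNorm, ← ENNReal.rpow_natCast, ← ENNReal.rpow_mul]
  simp_rw [← ENNReal.rpow_natCast, ← ENNReal.rpow_mul]
  norm_num

/-- The Strichartz norm of the function whose interaction picture is `φ`. -/
def strichartzNorm (J : Set ℝ) (φ : ℝ → L2) : ℝ≥0∞ := mixedNorm J fun t => freeFlow t (φ t)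

theorem lintegral_norm4_sq_le (J : Set ℝ) {φ : ℝ → L2} (hφ : Continuous φ) :
    ∫⁻ t in J, norm4 φ t ^ 2 ≤ strichartzNorm J φ ^ 2 * volume J ^ (1 / 4 : ℝ) :=
  lintegral_sq_le_mixedNorm J (continuous_freeFlow_self hφ)

theorem ae_norm4_lt_top {J : Set ℝ} {φ : ℝ → L2} (hφ : Continuous φ)
    (h : strichartzNorm J φ < ∞) : ∀ᵐ s ∂(volume.restrict J), norm4 φ s < ∞ := by
  have h1 : ∫⁻ t in J, norm4 φ t ^ (8 / 3 : ℝ) ≠ ∞ := by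
    have h2 := mixedNorm_rpow J fun t => freeFlow t (φ t)
    refine ne_of_eq_of_ne h2.symm ?_
    exact (ENNReal.rpow_lt_top_of_nonneg (by norm_num) h.ne).ne
  filter_upwards [ae_lt_top' ((measurable_norm4 hφ).pow_const _).aemeasurable h1] with s hs
  by_contra hc
  rw [not_lt_top_iff.mp hc, ENNReal.top_rpow_of_pos (by norm_num)] at hs
  exact lt_irrefl _ hs

theorem lintegral_mul_norm4_sq_le {J : Set ℝ} (hJ : MeasurableSet J) {f : ℝ → RealL2}
    {φ : ℝ → L2} (hφ : Continuous φ) {A R K : ℝ≥0} (hA : ∀ s ∈ J, ‖f s‖ₑ ≤ A)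
    (hR : strichartzNorm J φ ≤ R) :
    ∫⁻ s in J, ‖f s‖ₑ * norm4 φ s ^ 2 * K
      ≤ A * K * ((R : ℝ≥0∞) ^ 2 * volume J ^ (1 / 4 : ℝ)) := by
  calc ∫⁻ s in J, ‖f s‖ₑ * norm4 φ s ^ 2 * K
      ≤ ∫⁻ s in J, ((A * K : ℝ≥0) : ℝ≥0∞) * norm4 φ s ^ 2 := by
        refine setLIntegral_mono' hJ fun s hs => ?_
        rw [mul_right_comm, ENNReal.coe_mul]
        gcongr
        exact hA s hs
    _ = ((A * K : ℝ≥0) : ℝ≥0∞) * ∫⁻ s in J, norm4 φ s ^ 2 :=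
        lintegral_const_mul' _ _ ENNReal.coe_ne_top
    _ ≤ _ := by
        rw [ENNReal.coe_mul]
        gcongr
        exact (lintegral_norm4_sq_le J hφ).trans (by gcongr)

theorem lintegral_enorm_source_le {J : Set ℝ} (hJ : MeasurableSet J) {f : ℝ → RealL2}
    {φ : ℝ → L2} (hφ : Continuous φ) {A R K : ℝ≥0} (hA : ∀ s ∈ J, ‖f s‖ₑ ≤ A)
    (hR : strichartzNorm J φ ≤ R) (hK : ∀ s ∈ J, ‖φ s‖ₑ ≤ K) :
    ∫⁻ s in J, ‖source f φ s‖ₑ ≤ A * K * ((R : ℝ≥0∞) ^ 2 * volume J ^ (1 / 4 : ℝ)) := by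
  refine le_trans (setLIntegral_mono' hJ fun s hs => ?_) (lintegral_mul_norm4_sq_le hJ hφ hA hR)
  exact (enorm_source_le f φ s).trans (by gcongr; exact hK s hs)

theorem lintegral_enorm_source_sub_le {J : Set ℝ} (hJ : MeasurableSet J) {f : ℝ → RealL2}
    {φ χ : ℝ → L2} (hφ : Continuous φ) (hχ : Continuous χ) {A R K : ℝ≥0}
    (hA : ∀ s ∈ J, ‖f s‖ₑ ≤ A) (hR : strichartzNorm J φ ≤ R) (hR' : strichartzNorm J χ ≤ R)
    (hK : ∀ s ∈ J, ‖φ s - χ s‖ₑ ≤ K) :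
    ∫⁻ s in J, ‖source f φ s - source f χ s‖ₑ
      ≤ 4 * (A * K * ((R : ℝ≥0∞) ^ 2 * volume J ^ (1 / 4 : ℝ))) := by
  have hm : ∀ {φ : ℝ → L2}, Continuous φ → ∀ c : ℝ≥0∞,
      AEMeasurable (fun s => c * norm4 φ s ^ 2) (volume.restrict J) := fun hφ c =>
    (((measurable_norm4 hφ).pow_const 2).const_mul c).aemeasurable
  calc ∫⁻ s in J, ‖source f φ s - source f χ s‖ₑ
      ≤ ∫⁻ s in J, (2 * (A * K : ℝ≥0) * norm4 φ s ^ 2 + 2 * (A * K : ℝ≥0) * norm4 χ s ^ 2) := by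
        refine lintegral_mono_ae ?_
        filter_upwards [ae_norm4_lt_top hφ (hR.trans_lt ENNReal.coe_lt_top),
          ae_norm4_lt_top hχ (hR'.trans_lt ENNReal.coe_lt_top), ae_restrict_mem hJ]
          with s h1 h2 hs
        refine (enorm_source_sub_le f h1 h2).trans ?_
        calc 2 * ‖f s‖ₑ * (norm4 φ s ^ 2 + norm4 χ s ^ 2) * ‖φ s - χ s‖ₑ
            ≤ 2 * A * (norm4 φ s ^ 2 + norm4 χ s ^ 2) * K := by
              gcongr
              · exact hA s hs
              · exact hK s hs
          _ = _ := by rw [ENNReal.coe_mul]; ring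
    _ = 2 * (A * K : ℝ≥0) * (∫⁻ s in J, norm4 φ s ^ 2)
          + 2 * (A * K : ℝ≥0) * ∫⁻ s in J, norm4 χ s ^ 2 := by
        have hc : (2 * (A * K : ℝ≥0) : ℝ≥0∞) ≠ ∞ :=
          ENNReal.mul_ne_top (by norm_num) ENNReal.coe_ne_top
        rw [lintegral_add_left' (hm hφ _), lintegral_const_mul' _ _ hc, lintegral_const_mul' _ _ hc]
    _ ≤ 2 * (A * K : ℝ≥0) * ((R : ℝ≥0∞) ^ 2 * volume J ^ (1 / 4 : ℝ))
          + 2 * (A * K : ℝ≥0) * ((R : ℝ≥0∞) ^ 2 * volume J ^ (1 / 4 : ℝ)) := by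
        gcongr
        · exact (lintegral_norm4_sq_le J hφ).trans (by gcongr)
        · exact (lintegral_norm4_sq_le J hχ).trans (by gcongr)
    _ = _ := by rw [ENNReal.coe_mul]; ring

theorem enorm_intervalIntegral_le_lintegral (h : ℝ → L2) (a b : ℝ) :
    ‖∫ s in a..b, h s‖ₑ ≤ ∫⁻ s, ‖h s‖ₑ := by
  rw [← ofReal_norm, intervalIntegral.norm_intervalIntegral_eq, ofReal_norm]
  exact (enorm_integral_le_lintegral_enorm _).trans (setLIntegral_le_lintegral _ _)

theorem freeFlow_intervalIntegral {h : ℝ → L2} {a b : ℝ} (hh : IntervalIntegrable h volume a b)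
    (t : ℝ) : freeFlow t (∫ s in a..b, h s) = ∫ s in a..b, freeFlow t (h s) :=
  ((freeFlowₗᵢ t).toContinuousLinearMap.intervalIntegral_comp_comm hh).symm

theorem eLpNorm_top_intervalIntegral_le {h : ℝ → L2} {a b : ℝ}
    (hh : IntervalIntegrable h volume a b) {k : ℝ → ℝ≥0∞}
    (hk : ∀ᵐ s ∂(volume.restrict (Set.uIoc a b)), eLpNorm (h s) ∞ volume ≤ k s) {C : ℝ≥0}
    (hC : ∫⁻ s in Set.uIoc a b, k s ≤ C) :
    eLpNorm (∫ s in a..b, h s : L2) ∞ volume ≤ C := by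
  have h1 := eLpNorm_top_integral_le (intervalIntegrable_iff.mp hh) hk hC
  rw [intervalIntegral.intervalIntegral_eq_integral_uIoc]
  refine le_trans (le_of_eq ?_) h1
  split_ifs
  · rw [one_smul]
  · rw [neg_one_smul, eLpNorm_congr_ae (Lp.coeFn_neg _), eLpNorm_neg]

theorem strichartzNorm_add_integral_le (u : L2) {g : ℝ → L2} (hg : Integrable g) (t₀ : ℝ)
    (J : Set ℝ) :
    strichartzNorm J (fun t => u + ∫ s in t₀..t, g s) ≤ 5 * ‖u‖ₑ + 5 * ∫⁻ s, ‖g s‖ₑ := by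
  have hc : Continuous fun t => ∫ s in t₀..t, g s :=
    intervalIntegral.continuous_primitive (fun a b => hg.intervalIntegrable) t₀
  simp only [strichartzNorm, freeFlow_add]
  exact (mixedNorm_add_le J (continuous_freeFlow_time u) (continuous_freeFlow_self hc)).trans
    (add_le_add (mixedNorm_freeFlow_le u J) (mixedNorm_freeFlow_integral_le hg t₀ J))

/-! ### Local solutions by contraction -/

/-- The iteration map of Duhamel's formula, frozen outside `J`. -/
def picardMap (f : ℝ → RealL2) (J : Set ℝ) (t₀ : ℝ) (u : L2) (φ : ℝ → L2) (t : ℝ) : L2 :=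
  u + ∫ s in t₀..t, J.indicator (source f φ) s

/-- The bounds propagated by the iteration. -/
structure InBall (J : Set ℝ) (M : ℝ≥0) (u : L2) (φ : ℝ → L2) : Prop where
  enorm_le : ∀ t, ‖φ t‖ₑ ≤ (2 * M : ℝ≥0)
  strichartz_le : strichartzNorm J φ ≤ (10 * M : ℝ≥0)
  top_le : ∀ (t : ℝ) (B : ℝ≥0), eLpNorm (freeFlow t u) ∞ volume ≤ B →
    ∀ s, eLpNorm (freeFlow t (φ s)) ∞ volume ≤ (2 * B : ℝ≥0)

/-- The time interval `J` is short with respect to a bound `A` of the interaction and a bound `M`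
of the data. -/
def IsShort (A M : ℝ≥0) (J : Set ℝ) : Prop :=
  800 * (A : ℝ≥0∞) * (M : ℝ≥0∞) ^ 2 * volume J ^ (1 / 4 : ℝ) ≤ 1

/-- The constant is `800 = 8 · 10²`: the Strichartz radius is `10 M`, and `8 = 2 · 4` turns the
factor `4` of the difference estimate into a contraction by `1/2`. -/
theorem IsShort.eight_mul_le {A M : ℝ≥0} {J : Set ℝ} (h : IsShort A M J) (K : ℝ≥0) :
    8 * ((A : ℝ≥0∞) * K * (((10 * M : ℝ≥0) : ℝ≥0∞) ^ 2 * volume J ^ (1 / 4 : ℝ))) ≤ (K : ℝ≥0∞) := by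
  calc 8 * ((A : ℝ≥0∞) * K * (((10 * M : ℝ≥0) : ℝ≥0∞) ^ 2 * volume J ^ (1 / 4 : ℝ)))
      = 800 * (A : ℝ≥0∞) * (M : ℝ≥0∞) ^ 2 * volume J ^ (1 / 4 : ℝ) * (K : ℝ≥0∞) := by
        push_cast; ring
    _ ≤ 1 * (K : ℝ≥0∞) := mul_le_mul_left h _
    _ = K := one_mul _

theorem IsShort.two_mul_le {A M : ℝ≥0} {J : Set ℝ} (h : IsShort A M J) (K : ℝ≥0) :
    2 * ((A : ℝ≥0∞) * K * (((10 * M : ℝ≥0) : ℝ≥0∞) ^ 2 * volume J ^ (1 / 4 : ℝ))) ≤ K :=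
  le_trans (by gcongr; norm_num) (h.eight_mul_le K)

theorem integrableOn_source {J : Set ℝ} {f : ℝ → RealL2} (hf : Continuous f)
    {φ : ℝ → L2} (hφ : Continuous φ) (h : ∫⁻ s in J, ‖source f φ s‖ₑ < ∞) :
    IntegrableOn (source f φ) J :=
  ⟨(aestronglyMeasurable_source hf hφ).restrict, h⟩

theorem lintegral_enorm_indicator {J : Set ℝ} (hJ : MeasurableSet J) (g : ℝ → L2) :
    ∫⁻ s, ‖J.indicator g s‖ₑ = ∫⁻ s in J, ‖g s‖ₑ := by
  simp only [enorm_indicator_eq_indicator_enorm]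
  exact lintegral_indicator hJ _

section

variable {f : ℝ → RealL2} {J : Set ℝ} {A M : ℝ≥0} {u : L2} {φ χ : ℝ → L2} {t₀ : ℝ}

theorem InBall.lintegral_enorm_source_le_mass (hJ : MeasurableSet J) (hA : ∀ s ∈ J, ‖f s‖ₑ ≤ A)
    (hs : IsShort A M J) (hφ : Continuous φ) (h : InBall J M u φ) :
    ∫⁻ s in J, ‖source f φ s‖ₑ ≤ M := by
  have h1 := lintegral_enorm_source_le hJ hφ hA h.strichartz_le fun s _ => h.enorm_le s
  have h2 := hs.two_mul_le (2 * M)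
  have h3 := (mul_le_mul_right h1 2).trans h2
  rw [ENNReal.coe_mul] at h3
  exact (ENNReal.mul_le_mul_iff_right (by norm_num) (by norm_num)).mp h3

theorem InBall.integrable_indicator (hf : Continuous f) (hJ : MeasurableSet J)
    (hA : ∀ s ∈ J, ‖f s‖ₑ ≤ A) (hs : IsShort A M J) (hφ : Continuous φ) (h : InBall J M u φ) :
    Integrable (J.indicator (source f φ)) :=
  (integrable_indicator_iff hJ).mpr (integrableOn_source hf hφ
    ((h.lintegral_enorm_source_le_mass hJ hA hs hφ).trans_lt ENNReal.coe_lt_top))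

/-- In each of the three bounds the data use up half, and shortness of `J` leaves the other half to
the integral: `M + M`, then `5M + 5M` with the Strichartz constant `5`, then `B + B`. -/
theorem InBall.picardMap (hf : Continuous f) (hJ : MeasurableSet J)
    (hA : ∀ s ∈ J, ‖f s‖ₑ ≤ A) (hs : IsShort A M J) (hu : ‖u‖ₑ ≤ M) (hφ : Continuous φ)
    (h : InBall J M u φ) : InBall J M u (picardMap f J t₀ u φ) := by
  have hint := h.integrable_indicator hf hJ hA hs hφ
  have hle := h.lintegral_enorm_source_le_mass hJ hA hs hφ
  rw [← lintegral_enorm_indicator hJ] at hle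
  refine ⟨fun t => ?_, ?_, fun t B hB s => ?_⟩
  · calc ‖Hartree.picardMap f J t₀ u φ t‖ₑ ≤ ‖u‖ₑ + ‖∫ s in t₀..t, J.indicator (source f φ) s‖ₑ :=
        enorm_add_le _ _
      _ ≤ M + M := add_le_add hu ((enorm_intervalIntegral_le_lintegral _ _ _).trans hle)
      _ = _ := by push_cast; ring
  · refine (strichartzNorm_add_integral_le u hint t₀ J).trans ?_
    calc 5 * ‖u‖ₑ + 5 * ∫⁻ s, ‖J.indicator (source f φ) s‖ₑ ≤ 5 * (M : ℝ≥0∞) + 5 * M := by gcongr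
      _ = _ := by push_cast; ring
  · rw [Hartree.picardMap, freeFlow_add, freeFlow_intervalIntegral hint.intervalIntegrable]
    refine (eLpNorm_add_coe_le ∞ (by simp) _ _).trans ?_
    have hk : ∀ r, eLpNorm (freeFlow t (J.indicator (source f φ) r)) ∞ volume
        ≤ J.indicator (fun r => ‖f r‖ₑ * norm4 φ r ^ 2 * (2 * B : ℝ≥0)) r := fun r => by
      by_cases hr : r ∈ J
      · rw [Set.indicator_of_mem hr, Set.indicator_of_mem hr]
        exact eLpNorm_top_freeFlow_source_le f φ t r (h.top_le t B hB r)
      · rw [Set.indicator_of_notMem hr, Set.indicator_of_notMem hr, freeFlow_map_zero,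
          eLpNorm_congr_ae (Lp.coeFn_zero ℂ 2 volume), eLpNorm_zero]
    have hC : ∫⁻ r in Set.uIoc t₀ s,
        J.indicator (fun r => ‖f r‖ₑ * norm4 φ r ^ 2 * (2 * B : ℝ≥0)) r ≤ B := by
      refine (setLIntegral_le_lintegral _ _).trans ?_
      rw [lintegral_indicator hJ]
      have h1 := lintegral_mul_norm4_sq_le hJ hφ hA h.strichartz_le (K := 2 * B)
      have h3 := (mul_le_mul_right h1 2).trans (hs.two_mul_le (2 * B))
      have e : ((2 * B : ℝ≥0) : ℝ≥0∞) = 2 * (B : ℝ≥0∞) := by push_cast; rfl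
      nth_rewrite 2 [e] at h3
      exact (ENNReal.mul_le_mul_iff_right (by norm_num) (by norm_num)).mp h3
    refine (add_le_add hB (eLpNorm_top_intervalIntegral_le
      (integrable_freeFlow hint t).intervalIntegrable (Eventually.of_forall hk) hC)).trans ?_
    push_cast
    rw [two_mul]

theorem two_mul_enorm_picardMap_sub_le (hf : Continuous f) (hJ : MeasurableSet J)
    (hA : ∀ s ∈ J, ‖f s‖ₑ ≤ A) (hs : IsShort A M J) (hφ : Continuous φ) (hχ : Continuous χ)
    (h : InBall J M u φ) (h' : InBall J M u χ) {D : ℝ≥0} (hD : ∀ s, ‖φ s - χ s‖ₑ ≤ D) (t : ℝ) :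
    2 * ‖picardMap f J t₀ u φ t - picardMap f J t₀ u χ t‖ₑ ≤ D := by
  have hi := h.integrable_indicator hf hJ hA hs hφ
  have hi' := h'.integrable_indicator hf hJ hA hs hχ
  have e : picardMap f J t₀ u φ t - picardMap f J t₀ u χ t
      = ∫ s in t₀..t, J.indicator (fun s => source f φ s - source f χ s) s := by
    rw [picardMap, picardMap, add_sub_add_left_eq_sub,
      ← intervalIntegral.integral_sub hi.intervalIntegrable hi'.intervalIntegrable]
    simp only [← Pi.sub_apply, ← Set.indicator_sub']
  have h1 : ∫⁻ s, ‖J.indicator (fun s => source f φ s - source f χ s) s‖ₑ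
      ≤ 4 * ((A : ℝ≥0∞) * D * (((10 * M : ℝ≥0) : ℝ≥0∞) ^ 2 * volume J ^ (1 / 4 : ℝ))) := by
    rw [lintegral_enorm_indicator hJ]
    exact lintegral_enorm_source_sub_le hJ hφ hχ hA h.strichartz_le h'.strichartz_le
      fun s _ => hD s
  rw [e]
  refine (mul_le_mul_right ((enorm_intervalIntegral_le_lintegral _ _ _).trans h1) 2).trans
    (le_trans (le_of_eq ?_) (hs.eight_mul_le D))
  rw [← mul_assoc]
  norm_num

end

/-- All three conditions pass to uniform `L²` limits by lower semicontinuity. Keeping the `L^∞`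
bound inside the ball hands it to the fixed point, with no finiteness of that norm to be known in
advance for the solution. -/
theorem isClosed_inBall (J : Set ℝ) (hJ : MeasurableSet J) (M : ℝ≥0) (u : L2) :
    IsClosed {φ : BoundedContinuousFunction ℝ L2 | InBall J M u φ} := by
  refine IsSeqClosed.isClosed fun v w hv hvw => ?_
  have hpt : ∀ t, Tendsto (fun n => v n t) atTop (𝓝 (w t)) := fun t =>
    ((BoundedContinuousFunction.lipschitz_eval_const t).continuous.tendsto w).comp hvw
  refine ⟨fun t => ?_, ?_, fun t B hB s => ?_⟩
  · exact le_of_tendsto (hpt t).enorm (Eventually.of_forall fun n => (hv n).enorm_le t)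
  · exact mixedNorm_le_of_tendsto hJ (fun n => continuous_freeFlow_self (v n).continuous)
      (fun t _ => ((freeFlowₗᵢ t).continuous.tendsto _).comp (hpt t))
      (fun n => (hv n).strichartz_le) tendsto_const_nhds
  · exact (isClosed_setOf_eLpNorm_le ∞ _).mem_of_tendsto
      (((freeFlowₗᵢ t).continuous.tendsto _).comp (hpt s))
      (Eventually.of_forall fun n => (hv n).top_le t B hB s)

/-- The contraction is measured in the sup norm of bounded continuous `L²`-valued functions, in
which the ball is complete; the Strichartz norm need only stay bounded. -/
theorem exists_picardMap_eq {f : ℝ → RealL2} (hf : Continuous f) {J : Set ℝ}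
    (hJ : MeasurableSet J) {A M : ℝ≥0} (hA : ∀ s ∈ J, ‖f s‖ₑ ≤ A) (hs : IsShort A M J) {u : L2}
    (hu : ‖u‖ₑ ≤ M) (t₀ : ℝ) :
    ∃ φ : ℝ → L2, Continuous φ ∧ InBall J M u φ ∧ ∀ t, φ t = picardMap f J t₀ u φ t := by
  set S : Set (BoundedContinuousFunction ℝ L2) := {φ | InBall J M u φ} with hS
  have hstep : ∀ φ : S, ∃ χ : S, ∀ t, χ.1 t = picardMap f J t₀ u φ.1 t := fun φ => by
    have hc : Continuous (picardMap f J t₀ u φ.1) := continuous_const.add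
      (intervalIntegral.continuous_primitive (fun a b =>
        (InBall.integrable_indicator hf hJ hA hs φ.1.continuous φ.2).intervalIntegrable) t₀)
    have hb : InBall J M u (picardMap f J t₀ u φ.1) :=
      InBall.picardMap hf hJ hA hs hu φ.1.continuous φ.2
    refine ⟨⟨BoundedContinuousFunction.ofNormedAddCommGroup _ hc (2 * M) fun t => ?_, hb⟩,
      fun t => rfl⟩
    have := hb.enorm_le t
    rw [enorm_eq_nnnorm] at this
    exact_mod_cast this
  choose Φ hΦ using hstep
  have hcontr : ContractingWith (1 / 2) Φ := by
    refine ⟨by norm_num [← NNReal.coe_lt_coe], LipschitzWith.of_dist_le_mul fun φ χ => ?_⟩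
    rw [Subtype.dist_eq, Subtype.dist_eq, BoundedContinuousFunction.dist_le (by positivity)]
    intro t
    rw [hΦ, hΦ, dist_eq_norm]
    have h := two_mul_enorm_picardMap_sub_le (t₀ := t₀) hf hJ hA hs φ.1.continuous χ.1.continuous
      φ.2 χ.2 (D := nndist φ.1 χ.1) (fun s => by
        rw [enorm_eq_nnnorm, ← nndist_eq_nnnorm]
        exact_mod_cast BoundedContinuousFunction.dist_coe_le_dist s) t
    rw [enorm_eq_nnnorm] at h
    have h2 : 2 * ‖picardMap f J t₀ u φ.1 t - picardMap f J t₀ u χ.1 t‖ ≤ dist φ.1 χ.1 := by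
      exact_mod_cast h
    push_cast
    linarith
  have hne : Nonempty S := ⟨⟨0, by
    have h0 : ∀ (t : ℝ) (p : ℝ≥0∞), eLpNorm (freeFlow t 0 : L2) p volume = 0 := fun t p => by
      rw [freeFlow_map_zero, eLpNorm_congr_ae (Lp.coeFn_zero ℂ 2 volume), eLpNorm_zero]
    refine ⟨fun t => ?_, ?_, fun t B hB s => ?_⟩
    · simp
    · refine le_trans (le_of_eq ?_) zero_le
      have : (fun t => freeFlow t ((0 : BoundedContinuousFunction ℝ L2) t)) = fun _ => 0 := by
        funext t
        exact freeFlow_map_zero t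
      rw [strichartzNorm, this, mixedNorm_zero]
    · exact (h0 t ∞).le.trans zero_le⟩⟩
  have := (isClosed_inBall J hJ M u).completeSpace_coe
  obtain ⟨φ, hφ⟩ : ∃ φ : S, Φ φ = φ := ⟨_, hcontr.fixedPoint_isFixedPt⟩
  refine ⟨φ.1, φ.1.continuous, φ.2, fun t => ?_⟩
  rw [← hΦ, hφ]

/-- A solution of the Hartree equation on `[a, b]` in the interaction picture. -/
structure IsMild (f : ℝ → RealL2) (a b : ℝ) (φ : ℝ → L2) : Prop where
  continuous : Continuous φ
  finite : strichartzNorm (Set.Icc a b) φ < ∞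
  eq : ∀ s ∈ Set.Icc a b, ∀ t ∈ Set.Icc a b, φ t - φ s = ∫ r in s..t, source f φ r

theorem exists_enorm_le_on_Icc {E : Type*} [NormedAddCommGroup E] {f : ℝ → E} (hf : Continuous f)
    (a b : ℝ) : ∃ A : ℝ≥0, ∀ s ∈ Set.Icc a b, ‖f s‖ₑ ≤ A := by
  obtain ⟨C, hC⟩ := isCompact_Icc.exists_bound_of_continuousOn (hf.continuousOn (s := Set.Icc a b))
  refine ⟨C.toNNReal, fun s hs => ?_⟩
  rw [← ofReal_norm]
  exact ENNReal.ofReal_le_ofReal (hC s hs)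

theorem integrableOn_source_Icc {f : ℝ → RealL2} (hf : Continuous f) {a b : ℝ} {φ : ℝ → L2}
    (hφ : Continuous φ) (h : strichartzNorm (Set.Icc a b) φ < ∞) :
    IntegrableOn (source f φ) (Set.Icc a b) := by
  obtain ⟨A, hA⟩ := exists_enorm_le_on_Icc hf a b
  obtain ⟨K, hK⟩ := exists_enorm_le_on_Icc hφ a b
  refine integrableOn_source hf hφ ((lintegral_enorm_source_le measurableSet_Icc hφ hA
    (R := (strichartzNorm (Set.Icc a b) φ).toNNReal) (ENNReal.coe_toNNReal h.ne).ge hK).trans_lt ?_)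
  refine ENNReal.mul_lt_top (by finiteness) (ENNReal.mul_lt_top (by finiteness) ?_)
  exact ENNReal.rpow_lt_top_of_nonneg (by norm_num) measure_Icc_lt_top.ne

theorem intervalIntegrable_of_Icc {g : ℝ → L2} {a b s t : ℝ} (h : IntegrableOn g (Set.Icc a b))
    (hs : s ∈ Set.Icc a b) (ht : t ∈ Set.Icc a b) : IntervalIntegrable g volume s t :=
  (h.mono_set (Set.uIcc_subset_Icc hs ht)).intervalIntegrable

theorem IsMild.of_base {f : ℝ → RealL2} (hf : Continuous f) {a b : ℝ} {φ : ℝ → L2}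
    (hφ : Continuous φ) (h : strichartzNorm (Set.Icc a b) φ < ∞) {t₀ : ℝ} (ht₀ : t₀ ∈ Set.Icc a b)
    (heq : ∀ t ∈ Set.Icc a b, φ t - φ t₀ = ∫ r in t₀..t, source f φ r) : IsMild f a b φ := by
  refine ⟨hφ, h, fun s hs t ht => ?_⟩
  have hi := integrableOn_source_Icc hf hφ h
  rw [← sub_sub_sub_cancel_right _ _ (φ t₀), heq t ht, heq s hs,
    intervalIntegral.integral_interval_sub_left (intervalIntegrable_of_Icc hi ht₀ ht)
      (intervalIntegrable_of_Icc hi ht₀ hs)]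

theorem exists_isMild {f : ℝ → RealL2} (hf : Continuous f) {a b t₀ : ℝ} (ht₀ : t₀ ∈ Set.Icc a b)
    {A M : ℝ≥0} (hA : ∀ s ∈ Set.Icc a b, ‖f s‖ₑ ≤ A) (hs : IsShort A M (Set.Icc a b)) {u : L2}
    (hu : ‖u‖ₑ ≤ M) :
    ∃ φ : ℝ → L2, IsMild f a b φ ∧ φ t₀ = u ∧ InBall (Set.Icc a b) M u φ := by
  obtain ⟨φ, hc, hb, heq⟩ := exists_picardMap_eq hf measurableSet_Icc hA hs hu t₀
  have h0 : φ t₀ = u := by rw [heq, picardMap, intervalIntegral.integral_same, add_zero]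
  refine ⟨φ, IsMild.of_base hf hc (hb.strichartz_le.trans_lt ENNReal.coe_lt_top) ht₀
    fun t ht => ?_, h0, hb⟩
  rw [h0, heq t, picardMap, add_sub_cancel_left]
  refine intervalIntegral.integral_congr fun r hr => ?_
  exact Set.indicator_of_mem (Set.uIcc_subset_Icc ht₀ ht hr) _

theorem IsMild.mono {f : ℝ → RealL2} {a b a' b' : ℝ} {φ : ℝ → L2} (h : IsMild f a b φ)
    (hss : Set.Icc a' b' ⊆ Set.Icc a b) : IsMild f a' b' φ :=
  ⟨h.continuous, (mixedNorm_mono hss _).trans_lt h.finite,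
    fun s hs t ht => h.eq s (hss hs) t (hss ht)⟩

/-! ### Uniqueness, stability and conservation of mass -/

/-- Gronwall's lemma with a merely integrable weight. Absolute continuity of the integral gives a
step on which `k` has mass below `1/2`; on the next step the maximum of `d` is then at most half of
itself, and induction over the steps reaches all of `[a, b]`. -/
theorem eq_zero_of_le_lintegral {k : ℝ → ℝ≥0∞} {a b t₀ : ℝ}
    (hk : ∫⁻ s in Set.Icc a b, k s ≠ ∞) {d : ℝ → ℝ≥0} (hd : Continuous d)
    (ht₀ : t₀ ∈ Set.Icc a b)
    (h : ∀ t ∈ Set.Icc a b, (d t : ℝ≥0∞) ≤ ∫⁻ s in Set.uIoc t₀ t, k s * d s) :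
    ∀ t ∈ Set.Icc a b, d t = 0 := by
  obtain ⟨δ, hδ, hsmall⟩ := exists_pos_setLIntegral_lt_of_measure_lt hk
    (ε := 1 / 2) (by norm_num)
  obtain ⟨η, hη, hηδ⟩ := ENNReal.lt_iff_exists_nnreal_btwn.mp hδ
  have hη0 : (0 : ℝ) < η := by exact_mod_cast hη
  have hstep : ∀ n : ℕ, ∀ t ∈ Set.Icc a b, |t - t₀| ≤ n * (η / 2) → d t = 0 := by
    intro n
    induction n with
    | zero =>
      intro t ht hn
      have : t = t₀ := by
        rw [Nat.cast_zero, zero_mul] at hn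
        exact sub_eq_zero.mp (abs_nonpos_iff.mp hn)
      have h0 := h t ht
      rw [this, Set.uIoc_of_le le_rfl, Set.Ioc_self] at h0
      simp only [Measure.restrict_empty, lintegral_zero_measure, nonpos_iff_eq_zero] at h0
      rw [this]
      exact_mod_cast h0
    | succ n ih =>
      -- The new times lie in two windows of length `η / 2`, one on each side of `t₀`, of total
      -- length `η`. Elsewhere the induction hypothesis makes the integrand vanish.
      set W : Set ℝ := Set.Icc a b ∩ {t | |t - t₀| ≤ (n + 1 : ℕ) * (η / 2)} with hW
      have hWc : IsCompact W := isCompact_Icc.inter_right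
        (isClosed_le (by fun_prop) continuous_const)
      have hWn : W.Nonempty := ⟨t₀, ht₀, by
        rw [Set.mem_ofPred_eq, sub_self, abs_zero]; positivity⟩
      obtain ⟨r, hrW, hr⟩ := hWc.exists_isMaxOn hWn hd.continuousOn
      suffices hr0 : d r = 0 by
        intro t ht hn
        have := hr (show t ∈ W from ⟨ht, hn⟩)
        rw [Set.mem_ofPred_eq, hr0] at this
        exact le_antisymm this zero_le
      set E : Set ℝ := {s | n * ((η : ℝ) / 2) < |s - t₀|} with hE
      have hEm : MeasurableSet E := measurableSet_lt measurable_const (by fun_prop)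
      have hsub : ∀ s ∈ Set.uIoc t₀ r, s ∈ Set.Icc a b ∧ |s - t₀| ≤ |r - t₀| := fun s hs =>
        ⟨Set.uIcc_subset_Icc ht₀ hrW.1 (Set.uIoc_subset_uIcc hs),
          Set.abs_sub_left_of_mem_uIcc (Set.uIoc_subset_uIcc hs)⟩
      have hEs : E ∩ Set.uIoc t₀ r ⊆ Set.Icc a b := fun s hs => (hsub s hs.2).1
      have hvol : (volume.restrict (Set.Icc a b)) (E ∩ Set.uIoc t₀ r) < δ := by
        refine lt_of_le_of_lt (Measure.restrict_apply_le _ _) (lt_of_le_of_lt ?_ hηδ)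
        have hcov : E ∩ Set.uIoc t₀ r ⊆
            Set.Icc (t₀ + n * ((η : ℝ) / 2)) (t₀ + (n + 1 : ℕ) * ((η : ℝ) / 2)) ∪
            Set.Icc (t₀ - (n + 1 : ℕ) * ((η : ℝ) / 2)) (t₀ - n * ((η : ℝ) / 2)) := by
          intro s hs
          have h1 : n * ((η : ℝ) / 2) < |s - t₀| := hs.1
          have h2 : |s - t₀| ≤ (n + 1 : ℕ) * ((η : ℝ) / 2) := (hsub s hs.2).2.trans hrW.2
          rcases le_total 0 (s - t₀) with h3 | h3
          · rw [abs_of_nonneg h3] at h1 h2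
            exact Or.inl ⟨by linarith, by linarith⟩
          · rw [abs_of_nonpos h3] at h1 h2
            exact Or.inr ⟨by linarith, by linarith⟩
        refine (measure_mono hcov).trans ((measure_union_le _ _).trans ?_)
        rw [Real.volume_Icc, Real.volume_Icc, ← ENNReal.ofReal_add (by push_cast; linarith)
          (by push_cast; linarith), ← ENNReal.ofReal_coe_nnreal]
        refine ENNReal.ofReal_le_ofReal (le_of_eq ?_)
        push_cast
        ring
      have hint := hsmall _ hvol
      rw [Measure.restrict_restrict (hEm.inter measurableSet_uIoc),
        Set.inter_eq_left.mpr hEs] at hint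
      have hle : (d r : ℝ≥0∞) ≤ 1 / 2 * d r := by
        calc (d r : ℝ≥0∞) ≤ ∫⁻ s in Set.uIoc t₀ r, k s * d s := h r hrW.1
          _ ≤ ∫⁻ s in Set.uIoc t₀ r, E.indicator (fun s => k s * d r) s := by
              refine setLIntegral_mono' measurableSet_uIoc fun s hs => ?_
              by_cases hsE : s ∈ E
              · rw [Set.indicator_of_mem hsE]
                gcongr
                exact hr ⟨(hsub s hs).1, (hsub s hs).2.trans hrW.2⟩
              · rw [ih s (hsub s hs).1 (not_lt.mp hsE)]
                simp
          _ = (∫⁻ s in E ∩ Set.uIoc t₀ r, k s) * d r := by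
              rw [lintegral_indicator hEm, Measure.restrict_restrict hEm,
                lintegral_mul_const' _ _ ENNReal.coe_ne_top]
          _ ≤ 1 / 2 * d r := by gcongr
      have hle' : d r ≤ 1 / 2 * d r := by
        have e : (1 / 2 : ℝ≥0∞) = ((1 / 2 : ℝ≥0) : ℝ≥0∞) := by
          rw [ENNReal.coe_div (by norm_num)]; norm_num
        rw [e] at hle
        exact_mod_cast hle
      have hle2 : (d r : ℝ) ≤ 1 / 2 * d r := by exact_mod_cast hle'
      have h0 : (d r : ℝ) = 0 := le_antisymm (by linarith) (d r).coe_nonneg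
      exact_mod_cast h0
  intro t ht
  obtain ⟨n, hn⟩ := exists_nat_gt (|t - t₀| / (η / 2))
  exact hstep n t ht ((div_lt_iff₀ (by positivity)).mp hn).le

section

variable {f : ℝ → RealL2} {a b : ℝ} {φ χ : ℝ → L2}

theorem IsMild.integrableOn (hf : Continuous f) (h : IsMild f a b φ) :
    IntegrableOn (source f φ) (Set.Icc a b) := integrableOn_source_Icc hf h.continuous h.finite

theorem IsMild.sub_eq (hf : Continuous f) (h : IsMild f a b φ) (h' : IsMild f a b χ) {s t : ℝ}
    (hs : s ∈ Set.Icc a b) (ht : t ∈ Set.Icc a b) :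
    φ t - χ t = (φ s - χ s) + ∫ r in s..t, (source f φ r - source f χ r) := by
  rw [intervalIntegral.integral_sub (intervalIntegrable_of_Icc (h.integrableOn hf) hs ht)
    (intervalIntegrable_of_Icc (h'.integrableOn hf) hs ht), ← h.eq s hs t ht, ← h'.eq s hs t ht]
  abel

theorem enorm_intervalIntegral_le_uIoc (g : ℝ → L2) (s t : ℝ) :
    ‖∫ r in s..t, g r‖ₑ ≤ ∫⁻ r in Set.uIoc s t, ‖g r‖ₑ := by
  rw [← ofReal_norm, intervalIntegral.norm_intervalIntegral_eq, ofReal_norm]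
  exact enorm_integral_le_lintegral_enorm _

theorem lintegral_mul_norm4_sq_lt_top (hf : Continuous f) (hφ : Continuous φ)
    (h : strichartzNorm (Set.Icc a b) φ < ∞) :
    ∫⁻ s in Set.Icc a b, ‖f s‖ₑ * norm4 φ s ^ 2 < ∞ := by
  obtain ⟨A, hA⟩ := exists_enorm_le_on_Icc hf a b
  have h1 := lintegral_mul_norm4_sq_le measurableSet_Icc hφ hA
    (R := (strichartzNorm (Set.Icc a b) φ).toNNReal) (ENNReal.coe_toNNReal h.ne).ge (K := 1)
  simp only [ENNReal.coe_one, mul_one] at h1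
  refine h1.trans_lt (ENNReal.mul_lt_top (by finiteness) (ENNReal.mul_lt_top (by finiteness) ?_))
  exact ENNReal.rpow_lt_top_of_nonneg (by norm_num) measure_Icc_lt_top.ne

/-- Finiteness of the Strichartz norms makes the Lipschitz weight of `source` integrable in time, so
Gronwall applies with no smallness of the interval or of the solutions. -/
theorem IsMild.unique (hf : Continuous f) (h : IsMild f a b φ) (h' : IsMild f a b χ) {t₀ : ℝ}
    (ht₀ : t₀ ∈ Set.Icc a b) (h0 : φ t₀ = χ t₀) : ∀ t ∈ Set.Icc a b, φ t = χ t := by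
  have hk : ∫⁻ s in Set.Icc a b, 2 * ‖f s‖ₑ * (norm4 φ s ^ 2 + norm4 χ s ^ 2) ≠ ∞ := by
    have hm : AEMeasurable (fun s => ‖f s‖ₑ * norm4 φ s ^ 2) (volume.restrict (Set.Icc a b)) :=
      (hf.enorm.measurable.mul ((measurable_norm4 h.continuous).pow_const 2)).aemeasurable
    have e : ∫⁻ s in Set.Icc a b, 2 * ‖f s‖ₑ * (norm4 φ s ^ 2 + norm4 χ s ^ 2)
        = 2 * ∫⁻ s in Set.Icc a b, (‖f s‖ₑ * norm4 φ s ^ 2 + ‖f s‖ₑ * norm4 χ s ^ 2) := by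
      rw [← lintegral_const_mul' _ _ (by norm_num)]
      exact lintegral_congr fun s => by ring
    rw [e, lintegral_add_left' hm]
    exact ENNReal.mul_ne_top (by norm_num) (ENNReal.add_ne_top.mpr
      ⟨(lintegral_mul_norm4_sq_lt_top hf h.continuous h.finite).ne,
        (lintegral_mul_norm4_sq_lt_top hf h'.continuous h'.finite).ne⟩)
  have hz := eq_zero_of_le_lintegral hk (d := fun t => ‖φ t - χ t‖₊)
    (h.continuous.sub h'.continuous).nnnorm ht₀ fun t ht => ?_
  · exact fun t ht => sub_eq_zero.mp (nnnorm_eq_zero.mp (hz t ht))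
  · rw [← enorm_eq_nnnorm, h.sub_eq hf h' ht₀ ht, h0, sub_self, zero_add]
    refine (enorm_intervalIntegral_le_uIoc _ _ _).trans (lintegral_mono_ae ?_)
    have hss : Set.uIoc t₀ t ⊆ Set.Icc a b :=
      Set.uIoc_subset_uIcc.trans (Set.uIcc_subset_Icc ht₀ ht)
    filter_upwards [ae_restrict_of_ae_restrict_of_subset hss (ae_norm4_lt_top h.continuous h.finite),
      ae_restrict_of_ae_restrict_of_subset hss (ae_norm4_lt_top h'.continuous h'.finite)]
      with s h1 h2
    rw [← enorm_eq_nnnorm]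
    exact enorm_source_sub_le f h1 h2

theorem IsMild.congr (h : IsMild f a b φ) (hχ : Continuous χ)
    (he : ∀ t ∈ Set.Icc a b, χ t = φ t) : IsMild f a b χ := by
  have e : strichartzNorm (Set.Icc a b) χ = strichartzNorm (Set.Icc a b) φ :=
    mixedNorm_congr measurableSet_Icc fun t ht => by rw [he t ht]
  refine ⟨hχ, e ▸ h.finite, fun s hs t ht => ?_⟩
  rw [he s hs, he t ht, h.eq s hs t ht]
  refine intervalIntegral.integral_congr fun r hr => ?_
  rw [source, source, he r (Set.uIcc_subset_Icc hs ht hr)]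

/-- By uniqueness any solution on a short interval is the fixed point, and so inherits its
quantitative bounds, in particular the one in `L^∞`. -/
theorem IsMild.exists_inBall (hf : Continuous f) (h : IsMild f a b φ) {t₀ : ℝ}
    (ht₀ : t₀ ∈ Set.Icc a b) {A M : ℝ≥0} (hA : ∀ s ∈ Set.Icc a b, ‖f s‖ₑ ≤ A)
    (hs : IsShort A M (Set.Icc a b)) (hM : ‖φ t₀‖ₑ ≤ M) :
    ∃ χ, (∀ t ∈ Set.Icc a b, φ t = χ t) ∧ InBall (Set.Icc a b) M (φ t₀) χ := by
  obtain ⟨χ, hχ, h0, hb⟩ := exists_isMild hf ht₀ hA hs hM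
  exact ⟨χ, h.unique hf hχ ht₀ h0.symm, hb⟩

theorem IsMild.strichartzNorm_le (hf : Continuous f) (h : IsMild f a b φ) {t₀ : ℝ}
    (ht₀ : t₀ ∈ Set.Icc a b) {A M : ℝ≥0} (hA : ∀ s ∈ Set.Icc a b, ‖f s‖ₑ ≤ A)
    (hs : IsShort A M (Set.Icc a b)) (hM : ‖φ t₀‖ₑ ≤ M) :
    strichartzNorm (Set.Icc a b) φ ≤ (10 * M : ℝ≥0) := by
  obtain ⟨χ, he, hb⟩ := h.exists_inBall hf ht₀ hA hs hM
  refine le_trans (le_of_eq ?_) hb.strichartz_le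
  exact mixedNorm_congr measurableSet_Icc fun t ht => by rw [he t ht]

theorem IsMild.eLpNorm_top_le (hf : Continuous f) (h : IsMild f a b φ) {t₀ : ℝ}
    (ht₀ : t₀ ∈ Set.Icc a b) {A M : ℝ≥0} (hA : ∀ s ∈ Set.Icc a b, ‖f s‖ₑ ≤ A)
    (hs : IsShort A M (Set.Icc a b)) (hM : ‖φ t₀‖ₑ ≤ M) {t : ℝ} {B : ℝ≥0}
    (hB : eLpNorm (freeFlow t (φ t₀)) ∞ volume ≤ B) {s : ℝ} (hsJ : s ∈ Set.Icc a b) :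
    eLpNorm (freeFlow t (φ s)) ∞ volume ≤ (2 * B : ℝ≥0) := by
  obtain ⟨χ, he, hb⟩ := h.exists_inBall hf ht₀ hA hs hM
  rw [he s hsJ]
  exact hb.top_le t B hB s

/-- Let `D` be the maximal distance, `D₀` the distance at `t₀` and `X` the integral of the
difference of sources. Then `D ≤ D₀ + X` and `2X ≤ D`, so `X ≤ D₀` and `D ≤ 2 D₀`; Strichartz gives
`5 D₀ + 5 X ≤ 10 D₀`. -/
theorem IsMild.stability (hf : Continuous f) (h : IsMild f a b φ) (h' : IsMild f a b χ) {t₀ : ℝ}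
    (ht₀ : t₀ ∈ Set.Icc a b) {A M : ℝ≥0} (hA : ∀ s ∈ Set.Icc a b, ‖f s‖ₑ ≤ A)
    (hs : IsShort A M (Set.Icc a b)) (hM : ‖φ t₀‖ₑ ≤ M) (hM' : ‖χ t₀‖ₑ ≤ M) :
    (∀ t ∈ Set.Icc a b, ‖φ t - χ t‖ ≤ 2 * ‖φ t₀ - χ t₀‖) ∧
      strichartzNorm (Set.Icc a b) (fun t => φ t - χ t) ≤ 10 * ‖φ t₀ - χ t₀‖ₑ := by
  obtain ⟨r, hr, hmax⟩ := (isCompact_Icc (a := a) (b := b)).exists_isMaxOn ⟨t₀, ht₀⟩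
    (h.continuous.sub h'.continuous).nnnorm.continuousOn
  set D := ‖φ r - χ r‖₊ with hD
  have hd : ∀ t ∈ Set.Icc a b, ‖φ t - χ t‖ₑ ≤ D := fun t ht => by
    rw [enorm_eq_nnnorm]
    exact_mod_cast hmax ht
  set g : ℝ → L2 := fun s => source f φ s - source f χ s with hg
  set X := ∫⁻ s in Set.Icc a b, ‖g s‖ₑ with hX
  have hX2 : 2 * X ≤ D := by
    refine (mul_le_mul_right (lintegral_enorm_source_sub_le measurableSet_Icc h.continuous
      h'.continuous hA (h.strichartzNorm_le hf ht₀ hA hs hM)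
      (h'.strichartzNorm_le hf ht₀ hA hs hM') hd) 2).trans
      (le_trans (le_of_eq ?_) (hs.eight_mul_le D))
    rw [← mul_assoc]
    norm_num
  have hgi : IntegrableOn g (Set.Icc a b) := (h.integrableOn hf).sub (h'.integrableOn hf)
  have hXtop : X ≠ ∞ := hgi.2.ne
  have hDX : (D : ℝ≥0∞) ≤ ‖φ t₀ - χ t₀‖₊ + X := by
    rw [hD, ← enorm_eq_nnnorm, ← enorm_eq_nnnorm, h.sub_eq hf h' ht₀ hr]
    refine (enorm_add_le _ _).trans (add_le_add le_rfl ?_)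
    exact (enorm_intervalIntegral_le_uIoc _ _ _).trans (lintegral_mono_set
      (Set.uIoc_subset_uIcc.trans (Set.uIcc_subset_Icc ht₀ hr)))
  lift X to ℝ≥0 using hXtop with Y hY
  have e1 : 2 * (Y : ℝ) ≤ D := by exact_mod_cast hX2
  have e2 : (D : ℝ) ≤ ‖φ t₀ - χ t₀‖ + Y := by exact_mod_cast hDX
  refine ⟨fun t ht => ?_, ?_⟩
  · have : ‖φ t - χ t‖ ≤ D := by
      have := hd t ht
      rw [enorm_eq_nnnorm] at this
      exact_mod_cast this
    linarith
  · have hind : Integrable ((Set.Icc a b).indicator g) :=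
      (integrable_indicator_iff measurableSet_Icc).mpr hgi
    have e3 : strichartzNorm (Set.Icc a b) (fun t => φ t - χ t)
        = strichartzNorm (Set.Icc a b)
          (fun t => (φ t₀ - χ t₀) + ∫ s in t₀..t, (Set.Icc a b).indicator g s) := by
      refine mixedNorm_congr measurableSet_Icc fun t ht => ?_
      simp only
      rw [h.sub_eq hf h' ht₀ ht]
      congr 2
      refine intervalIntegral.integral_congr fun s hs' => ?_
      exact (Set.indicator_of_mem (Set.uIcc_subset_Icc ht₀ ht hs') g).symm
    rw [e3]
    refine (strichartzNorm_add_integral_le _ hind t₀ _).trans ?_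
    rw [lintegral_enorm_indicator measurableSet_Icc, ← hX, enorm_eq_nnnorm]
    have e4 : (5 * ‖φ t₀ - χ t₀‖₊ + 5 * Y : ℝ) ≤ 10 * ‖φ t₀ - χ t₀‖₊ := by
      rw [coe_nnnorm]; linarith
    exact_mod_cast e4

theorem re_inner_source (f : ℝ → RealL2) (φ : ℝ → L2) (s : ℝ) :
    (inner ℂ (φ s) (source f φ s)).re = 0 := by
  have h := inner_freeFlow_left s (φ s) (nonlin (f s) (freeFlow s (φ s)))
  rw [source, inner_smul_right, ← h]
  simp [inner_nonlin_im]

/-- A substitute for differentiating the mass: the increment is `Re ⟨φ t + φ s, φ t - φ s⟩`, and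
since `source` at `r` is orthogonal to `φ r` in the real sense, `2 φ r` may be subtracted on the
left. Only the oscillation of `φ` remains. -/
theorem IsMild.abs_norm_sq_sub_le (hf : Continuous f) (h : IsMild f a b φ) {s t ε : ℝ}
    (hs : s ∈ Set.Icc a b) (ht : t ∈ Set.Icc a b) (hst : s ≤ t)
    (hε : ∀ r ∈ Set.Icc s t, ‖φ t - φ r‖ ≤ ε ∧ ‖φ s - φ r‖ ≤ ε) :
    |‖φ t‖ ^ 2 - ‖φ s‖ ^ 2| ≤ 2 * ε * ∫ r in s..t, ‖source f φ r‖ := by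
  have hi := intervalIntegrable_of_Icc (h.integrableOn hf) hs ht
  have e1 : ‖φ t‖ ^ 2 - ‖φ s‖ ^ 2 = (inner ℂ (φ t + φ s) (φ t - φ s)).re := by
    rw [inner_sub_right, inner_add_left, inner_add_left, ← inner_conj_symm (φ t) (φ s)]
    have h1 := inner_self_eq_norm_sq (𝕜 := ℂ) (φ t)
    have h2 := inner_self_eq_norm_sq (𝕜 := ℂ) (φ s)
    simp only [RCLike.re_to_complex] at h1 h2
    simp only [Complex.sub_re, Complex.add_re, Complex.conj_re, h1, h2]
    ring
  have e2 : inner ℂ (φ t + φ s) (φ t - φ s)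
      = ∫ r in s..t, inner ℂ (φ t + φ s) (source f φ r) := by
    rw [h.eq s hs t ht]
    exact ((innerSL ℂ (φ t + φ s)).intervalIntegral_comp_comm hi).symm
  have hi2 : IntervalIntegrable (fun r => inner ℂ (φ t + φ s) (source f φ r)) volume s t :=
    ⟨(innerSL ℂ (φ t + φ s)).integrable_comp hi.1, (innerSL ℂ (φ t + φ s)).integrable_comp hi.2⟩
  have e3 : (∫ r in s..t, inner ℂ (φ t + φ s) (source f φ r)).re
      = ∫ r in s..t, (inner ℂ (φ t + φ s) (source f φ r)).re :=
    (Complex.reCLM.intervalIntegral_comp_comm hi2).symm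
  rw [e1, e2, e3, ← Real.norm_eq_abs, ← intervalIntegral.integral_const_mul]
  refine intervalIntegral.norm_integral_le_of_norm_le hst (Eventually.of_forall fun r hr => ?_)
    (hi.norm.const_mul _)
  have hr' := hε r (Set.Ioc_subset_Icc_self hr)
  have e4 : (inner ℂ (φ t + φ s) (source f φ r)).re
      = (inner ℂ ((φ t - φ r) + (φ s - φ r)) (source f φ r)).re := by
    have e5 : (φ t - φ r) + (φ s - φ r) = (φ t + φ s) - φ r - φ r := by abel
    rw [e5, inner_sub_left _ (φ r), inner_sub_left, Complex.sub_re, Complex.sub_re,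
      re_inner_source, sub_zero, sub_zero]
  rw [e4, Real.norm_eq_abs]
  refine (Complex.abs_re_le_norm _).trans ((norm_inner_le_norm _ _).trans ?_)
  gcongr
  refine (norm_add_le _ _).trans ?_
  linarith [hr'.1, hr'.2]

theorem IsMild.norm_eq_of_le (hf : Continuous f) (h : IsMild f a b φ) {s t : ℝ}
    (hs : s ∈ Set.Icc a b) (ht : t ∈ Set.Icc a b) (hst : s ≤ t) : ‖φ t‖ = ‖φ s‖ := by
  set I := ∫ r in s..t, ‖source f φ r‖ with hI
  have hgi := h.integrableOn hf
  -- Summed over a partition fine enough for uniform continuity, the oscillation factor is at most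
  -- `ε`, while the integrals add up to the fixed number `I`.
  have key : ∀ ε > 0, |‖φ t‖ ^ 2 - ‖φ s‖ ^ 2| ≤ 2 * ε * I := by
    intro ε hε
    obtain ⟨δ, hδ, huc⟩ := Metric.uniformContinuousOn_iff.mp
      ((isCompact_Icc (a := a) (b := b)).uniformContinuousOn_of_continuous
        h.continuous.continuousOn) ε hε
    obtain ⟨n, hn⟩ := exists_nat_gt ((t - s) / δ)
    have hn0 : (0 : ℝ) < n := lt_of_le_of_lt (div_nonneg (sub_nonneg.mpr hst) hδ.le) hn
    have hnδ : (t - s) / n < δ := by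
      rw [div_lt_iff₀ hδ] at hn
      rw [div_lt_iff₀ hn0]
      linarith
    set w := (t - s) / n with hw
    have hw0 : 0 ≤ w := div_nonneg (sub_nonneg.mpr hst) hn0.le
    set x : ℕ → ℝ := fun k => s + k * w with hx
    have hx0 : x 0 = s := by simp [hx]
    have hxn : x n = t := by
      simp only [hx, hw]
      field_simp
      ring
    have hxm : Monotone x := fun i j hij => by
      simp only [hx]
      gcongr
    have hxJ : ∀ k ≤ n, x k ∈ Set.Icc a b := fun k hk =>
      ⟨hs.1.trans (hx0 ▸ hxm (Nat.zero_le k)), (hxn ▸ hxm hk : x k ≤ t).trans ht.2⟩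
    have hpiece : ∀ k < n, |‖φ (x (k + 1))‖ ^ 2 - ‖φ (x k)‖ ^ 2|
        ≤ 2 * ε * ∫ r in x k..x (k + 1), ‖source f φ r‖ := fun k hk => by
      have h1 := hxJ k hk.le
      have h2 := hxJ (k + 1) hk
      have hd : x (k + 1) - x k = w := by simp only [hx]; push_cast; ring
      refine h.abs_norm_sq_sub_le hf h1 h2 (hxm (Nat.le_succ k)) fun r hr => ?_
      have hrJ : r ∈ Set.Icc a b := ⟨h1.1.trans hr.1, hr.2.trans h2.2⟩
      rw [← dist_eq_norm, ← dist_eq_norm]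
      refine ⟨(huc _ h2 _ hrJ ?_).le, (huc _ h1 _ hrJ ?_).le⟩
      · rw [Real.dist_eq, abs_of_nonneg (sub_nonneg.mpr hr.2)]
        linarith [hr.1]
      · rw [Real.dist_eq, abs_of_nonpos (sub_nonpos.mpr hr.1)]
        linarith [hr.2]
    calc |‖φ t‖ ^ 2 - ‖φ s‖ ^ 2|
        = |∑ k ∈ Finset.range n, (‖φ (x (k + 1))‖ ^ 2 - ‖φ (x k)‖ ^ 2)| := by
          rw [Finset.sum_range_sub fun k => ‖φ (x k)‖ ^ 2, hx0, hxn]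
      _ ≤ ∑ k ∈ Finset.range n, |‖φ (x (k + 1))‖ ^ 2 - ‖φ (x k)‖ ^ 2| :=
          Finset.abs_sum_le_sum_abs _ _
      _ ≤ ∑ k ∈ Finset.range n, 2 * ε * ∫ r in x k..x (k + 1), ‖source f φ r‖ :=
          Finset.sum_le_sum fun k hk => hpiece k (Finset.mem_range.mp hk)
      _ = 2 * ε * I := by
          rw [← Finset.mul_sum, intervalIntegral.sum_integral_adjacent_intervals, hx0, hxn]
          exact fun k hk => (intervalIntegrable_of_Icc hgi (hxJ k hk.le) (hxJ (k + 1) hk)).norm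
  have hI0 : 0 ≤ I := intervalIntegral.integral_nonneg hst fun r _ => norm_nonneg _
  have hzero : |‖φ t‖ ^ 2 - ‖φ s‖ ^ 2| ≤ 0 := by
    refine le_of_forall_pos_le_add fun ε hε => ?_
    have := key (ε / (2 * (I + 1))) (by positivity)
    refine this.trans ?_
    rw [zero_add, ← mul_div_assoc, div_mul_eq_mul_div, div_le_iff₀ (by positivity)]
    nlinarith
  have := abs_nonpos_iff.mp hzero
  exact (pow_left_inj₀ (norm_nonneg _) (norm_nonneg _) two_ne_zero).mp (sub_eq_zero.mp this)

theorem IsMild.norm_eq (hf : Continuous f) (h : IsMild f a b φ) {s t : ℝ}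
    (hs : s ∈ Set.Icc a b) (ht : t ∈ Set.Icc a b) : ‖φ t‖ = ‖φ s‖ := by
  rcases le_total s t with hst | hst
  · exact h.norm_eq_of_le hf hs ht hst
  · exact (h.norm_eq_of_le hf ht hs hst).symm

end

/-! ### Global solutions -/

theorem lintegral_lt_top_of_mixedNorm {J : Set ℝ} {ψ : ℝ → L2} (h : mixedNorm J ψ < ∞) :
    ∫⁻ t in J, eLpNorm (ψ t) 4 volume ^ (8 / 3 : ℝ) < ∞ := by
  rw [← mixedNorm_rpow]
  exact ENNReal.rpow_lt_top_of_nonneg (by norm_num) h.ne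

theorem mixedNorm_union_lt_top {J K : Set ℝ} {ψ : ℝ → L2} (hJ : mixedNorm J ψ < ∞)
    (hK : mixedNorm K ψ < ∞) : mixedNorm (J ∪ K) ψ < ∞ :=
  ENNReal.rpow_lt_top_of_nonneg (by norm_num) ((lintegral_union_le _ _ _).trans_lt
    (ENNReal.add_lt_top.mpr ⟨lintegral_lt_top_of_mixedNorm hJ, lintegral_lt_top_of_mixedNorm hK⟩)).ne

theorem IsMild.glue {f : ℝ → RealL2} (hf : Continuous f) {a b c : ℝ} (hab : a ≤ b) (hbc : b ≤ c)
    {φ χ : ℝ → L2} (h : IsMild f a b φ) (h' : IsMild f b c χ) (hb : φ b = χ b) :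
    ∃ ω, IsMild f a c ω ∧ (∀ t ∈ Set.Icc a b, ω t = φ t) ∧ ∀ t ∈ Set.Icc b c, ω t = χ t := by
  set ω : ℝ → L2 := fun t => if t ≤ b then φ t else χ t with hω
  have hc : Continuous ω := h.continuous.if_le h'.continuous continuous_id continuous_const
    fun t ht => by rw [show t = b from ht]; exact hb
  have h1 : ∀ t ∈ Set.Icc a b, ω t = φ t := fun t ht => if_pos ht.2
  have h2 : ∀ t ∈ Set.Icc b c, ω t = χ t := fun t ht => by
    rcases ht.1.eq_or_lt with he | hlt
    · rw [← he, h1 b ⟨hab, le_rfl⟩, hb]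
    · exact if_neg hlt.not_ge
  have hfin : strichartzNorm (Set.Icc a c) ω < ∞ := by
    rw [← Set.Icc_union_Icc_eq_Icc hab hbc]
    refine mixedNorm_union_lt_top ?_ ?_
    · exact (h.congr hc h1).finite
    · exact (h'.congr hc h2).finite
  refine ⟨ω, IsMild.of_base hf hc hfin (t₀ := b) ⟨hab, hbc⟩ fun t ht => ?_, h1, h2⟩
  rcases le_total t b with htb | htb
  · exact (h.congr hc h1).eq b ⟨hab, le_rfl⟩ t ⟨ht.1, htb⟩
  · exact (h'.congr hc h2).eq b ⟨le_rfl, hbc⟩ t ⟨htb, ht.2⟩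

theorem exists_isShort (A M : ℝ≥0) :
    ∃ τ : ℝ, 0 < τ ∧ ∀ a b : ℝ, b - a ≤ τ → IsShort A M (Set.Icc a b) := by
  -- The fourth power in the step length undoes the exponent `1/4` of the volume; the `+ 1` keeps
  -- `q` positive when `A` or `M` vanishes.
  set q : ℝ := 800 * A * M ^ 2 + 1 with hq
  have hq1 : 0 < q := by positivity
  refine ⟨(q⁻¹) ^ 4, by positivity, fun a b hab => ?_⟩
  have hvol : volume (Set.Icc a b) ^ (1 / 4 : ℝ) ≤ ENNReal.ofReal q⁻¹ := by
    rw [Real.volume_Icc]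
    calc ENNReal.ofReal (b - a) ^ (1 / 4 : ℝ) ≤ ENNReal.ofReal (q⁻¹ ^ 4) ^ (1 / 4 : ℝ) := by
          gcongr
      _ = ENNReal.ofReal q⁻¹ := by
          rw [ENNReal.ofReal_rpow_of_nonneg (by positivity) (by norm_num), ← Real.rpow_natCast,
            ← Real.rpow_mul (by positivity)]
          norm_num
  have hc : 800 * (A : ℝ≥0∞) * (M : ℝ≥0∞) ^ 2 ≤ ENNReal.ofReal q := by
    have e : 800 * (A : ℝ≥0∞) * (M : ℝ≥0∞) ^ 2 = ENNReal.ofReal (800 * A * M ^ 2) := by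
      rw [ENNReal.ofReal_mul (by positivity), ENNReal.ofReal_mul (by norm_num),
        ENNReal.ofReal_pow (by positivity), ENNReal.ofReal_coe_nnreal, ENNReal.ofReal_coe_nnreal]
      norm_num
    rw [e]
    exact ENNReal.ofReal_le_ofReal (by linarith)
  calc 800 * (A : ℝ≥0∞) * (M : ℝ≥0∞) ^ 2 * volume (Set.Icc a b) ^ (1 / 4 : ℝ)
      ≤ ENNReal.ofReal q * ENNReal.ofReal q⁻¹ := mul_le_mul' hc hvol
    _ = 1 := by
        rw [← ENNReal.ofReal_mul hq1.le, mul_inv_cancel₀ hq1.ne', ENNReal.ofReal_one]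

/-- A step size dividing `[0, T]` into finitely many short intervals. -/
theorem exists_nat_step (A M : ℝ≥0) {T : ℝ} (hT : 0 ≤ T) : ∃ (N : ℕ) (τ : ℝ), 0 ≤ τ ∧ N * τ = T ∧
    ∀ a b : ℝ, b - a ≤ τ → IsShort A M (Set.Icc a b) := by
  obtain ⟨τ, hτ, h⟩ := exists_isShort A M
  obtain ⟨N, hN⟩ := exists_nat_gt (T / τ)
  have hN0 : (0 : ℝ) < N := lt_of_le_of_lt (div_nonneg hT hτ.le) hN
  refine ⟨N, T / N, div_nonneg hT hN0.le, by field_simp, fun a b hab => h a b (hab.trans ?_)⟩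
  rw [div_le_iff₀ hN0]
  rw [div_lt_iff₀ hτ] at hN
  linarith

theorem isMild_zero {f : ℝ → RealL2} (hf : Continuous f) (u : L2) :
    IsMild f 0 0 fun _ => u := by
  refine IsMild.of_base hf continuous_const ?_ (t₀ := 0) ⟨le_rfl, le_rfl⟩ fun t ht => ?_
  · rw [strichartzNorm, mixedNorm, Set.Icc_self, Measure.restrict_singleton]
    simp
  · rw [show t = 0 from le_antisymm ht.2 ht.1, intervalIntegral.integral_same, sub_self]

/-- Mass conservation restores the bound `‖u‖` at both endpoints after each extension, so one step
length serves throughout and finitely many steps cover `[-T, T]`. -/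
theorem exists_isMild_symm {f : ℝ → RealL2} (hf : Continuous f) (u : L2) {T : ℝ} (hT : 0 ≤ T) :
    ∃ φ, IsMild f (-T) T φ ∧ φ 0 = u := by
  obtain ⟨A, hA⟩ := exists_enorm_le_on_Icc hf (-T) T
  obtain ⟨N, τ, hτ, hNT, hshort⟩ := exists_nat_step A ‖u‖₊ hT
  have hind : ∀ k : ℕ, k ≤ N → ∃ φ, IsMild f (-(k * τ)) (k * τ) φ ∧ φ 0 = u := by
    intro k
    induction k with
    | zero =>
      intro _
      refine ⟨fun _ => u, ?_, rfl⟩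
      simpa using isMild_zero hf u
    | succ k ih =>
      intro hk
      obtain ⟨φ, hφ, hφ0⟩ := ih (Nat.le_of_succ_le hk)
      set r : ℝ := k * τ with hr
      have hr0 : 0 ≤ r := by positivity
      have e : ((k + 1 : ℕ) : ℝ) * τ = r + τ := by push_cast; ring
      have hrT : r + τ ≤ T := by
        rw [← hNT, ← e]
        gcongr
      have hmass : ∀ t ∈ Set.Icc (-r) r, ‖φ t‖ₑ ≤ ‖u‖₊ := fun t ht => by
        rw [← enorm_eq_nnnorm, ← ofReal_norm, ← ofReal_norm,
          hφ.norm_eq hf (s := 0) ⟨by linarith, hr0⟩ ht, hφ0]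
      obtain ⟨χ, hχ, hχ0, -⟩ := exists_isMild hf (a := r) (b := r + τ) (t₀ := r)
        ⟨le_rfl, by linarith⟩ (fun s hs => hA s ⟨by linarith [hs.1], by linarith [hs.2]⟩)
        (hshort _ _ (by linarith)) (hmass r ⟨by linarith, le_rfl⟩)
      obtain ⟨ω, hω, hω0, -⟩ := hφ.glue hf (by linarith) (by linarith) hχ hχ0.symm
      obtain ⟨χ', hχ', hχ0', -⟩ := exists_isMild hf (a := -r - τ) (b := -r) (t₀ := -r)
        ⟨by linarith, le_rfl⟩ (fun s hs => hA s ⟨by linarith [hs.1], by linarith [hs.2]⟩)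
        (hshort _ _ (by linarith)) (hmass (-r) ⟨le_rfl, by linarith⟩)
      obtain ⟨ω', hω', -, hω0'⟩ := hχ'.glue hf (by linarith) (by linarith) hω
        (by rw [hχ0', hω0 (-r) ⟨le_rfl, by linarith⟩])
      refine ⟨ω', ?_, ?_⟩
      · rw [e, neg_add']
        exact hω'
      · rw [hω0' 0 ⟨by linarith, by linarith⟩, hω0 0 ⟨by linarith, hr0⟩, hφ0]
  rw [← hNT]
  exact hind N le_rfl

theorem exists_isMild_global {f : ℝ → RealL2} (hf : Continuous f) (u : L2) :
    ∃ φ : ℝ → L2, φ 0 = u ∧ ∀ T, IsMild f (-T) T φ := by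
  choose φ hφ hφ0 using fun n : ℕ => exists_isMild_symm hf u (Nat.cast_nonneg (α := ℝ) n)
  have hmem : ∀ (n : ℕ) (t : ℝ), |t| ≤ n → t ∈ Set.Icc (-(n : ℝ)) n := fun n t h => abs_le.mp h
  have hcompat : ∀ m n : ℕ, m ≤ n → ∀ t : ℝ, |t| ≤ m → φ m t = φ n t := by
    intro m n hmn t ht
    have hmn' : (m : ℝ) ≤ n := by exact_mod_cast hmn
    exact (hφ m).unique hf ((hφ n).mono (Set.Icc_subset_Icc (by linarith) hmn')) (t₀ := 0)
      (hmem m 0 (by simp)) (by rw [hφ0, hφ0]) t (hmem m t ht)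
  -- By uniqueness the solutions on `[-n, n]` agree wherever they overlap, so any `n ≥ |t|` gives
  -- the same value.
  set Φ : ℝ → L2 := fun t => φ ⌈|t|⌉₊ t with hΦ
  have heq : ∀ (n : ℕ) (t : ℝ), |t| ≤ n → Φ t = φ n t := fun n t ht =>
    hcompat _ n (Nat.ceil_le.mpr ht) t (Nat.le_ceil _)
  have hc : Continuous Φ := by
    refine continuous_iff_continuousAt.mpr fun t => ?_
    obtain ⟨n, hn⟩ := exists_nat_gt |t|
    refine (hφ n).continuous.continuousAt.congr ?_
    filter_upwards [(continuous_abs.isOpen_preimage _ isOpen_Iio).mem_nhds hn] with s hs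
    exact (heq n s (le_of_lt hs)).symm
  refine ⟨Φ, by rw [heq 0 0 (by simp), hφ0], fun T => ?_⟩
  obtain ⟨n, hn⟩ := exists_nat_gt T
  exact ((hφ n).congr hc fun t ht => heq n t (abs_le.mpr ht)).mono
    (Set.Icc_subset_Icc (by linarith) hn.le)

/-! ### Continuous dependence -/

/-- Each step at most doubles the distance and adds one short interval on either side, hence the
factors `2 ^ k` and `2 * k`. -/
theorem IsMild.dependence_step {f : ℝ → RealL2} (hf : Continuous f) {φ χ : ℝ → L2} {T : ℝ}
    (h : IsMild f (-T) T φ) (h' : IsMild f (-T) T χ) {A M : ℝ≥0}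
    (hA : ∀ s ∈ Set.Icc (-T) T, ‖f s‖ₑ ≤ A) (hM : ‖φ 0‖ₑ ≤ M) (hM' : ‖χ 0‖ₑ ≤ M) {τ : ℝ}
    (hτ : 0 ≤ τ) (hshort : ∀ a b : ℝ, b - a ≤ τ → IsShort A M (Set.Icc a b)) (k : ℕ)
    (hk : k * τ ≤ T) :
    (∀ t ∈ Set.Icc (-(k * τ)) (k * τ), ‖φ t - χ t‖ ≤ 2 ^ k * ‖φ 0 - χ 0‖) ∧
      ∫⁻ t in Set.Icc (-(k * τ)) (k * τ), norm4 (fun t => φ t - χ t) t ^ (8 / 3 : ℝ)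
        ≤ 2 * k * (10 * 2 ^ k * ‖φ 0 - χ 0‖ₑ) ^ (8 / 3 : ℝ) := by
  induction k with
  | zero =>
    simp only [Nat.cast_zero, zero_mul, neg_zero, Set.Icc_self, Measure.restrict_singleton]
    simp
  | succ k ih =>
    set r : ℝ := k * τ with hr
    have hr0 : 0 ≤ r := by positivity
    have e : ((k + 1 : ℕ) : ℝ) * τ = r + τ := by push_cast; ring
    rw [e] at hk ⊢
    obtain ⟨ih1, ih2⟩ := ih (by linarith)
    have h0 : (0 : ℝ) ∈ Set.Icc (-T) T := ⟨by linarith, by linarith⟩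
    have hmass : ∀ {φ : ℝ → L2}, IsMild f (-T) T φ → ‖φ 0‖ₑ ≤ M → ∀ t ∈ Set.Icc (-T) T,
        ‖φ t‖ₑ ≤ M := fun h hM t ht => by
      rwa [← ofReal_norm, h.norm_eq hf h0 ht, ofReal_norm]
    have hpiece : ∀ a b t₀ : ℝ, b - a ≤ τ → Set.Icc a b ⊆ Set.Icc (-T) T → t₀ ∈ Set.Icc a b →
        t₀ ∈ Set.Icc (-r) r →
        (∀ t ∈ Set.Icc a b, ‖φ t - χ t‖ ≤ 2 ^ (k + 1) * ‖φ 0 - χ 0‖) ∧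
        ∫⁻ t in Set.Icc a b, norm4 (fun t => φ t - χ t) t ^ (8 / 3 : ℝ)
          ≤ (10 * 2 ^ (k + 1) * ‖φ 0 - χ 0‖ₑ) ^ (8 / 3 : ℝ) := by
      intro a b t₀ hab hss ht₀ ht₀'
      obtain ⟨s1, s2⟩ := (h.mono hss).stability hf (h'.mono hss) ht₀ (fun s hs => hA s (hss hs))
        (hshort a b hab) (hmass h hM t₀ (hss ht₀)) (hmass h' hM' t₀ (hss ht₀))
      have h3 := ih1 t₀ ht₀'
      refine ⟨fun t ht => ?_, ?_⟩
      · calc ‖φ t - χ t‖ ≤ 2 * ‖φ t₀ - χ t₀‖ := s1 t ht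
          _ ≤ 2 * (2 ^ k * ‖φ 0 - χ 0‖) := by gcongr
          _ = _ := by ring
      · have h4 : ‖φ t₀ - χ t₀‖ₑ ≤ 2 ^ k * ‖φ 0 - χ 0‖ₑ := by
          rw [enorm_eq_nnnorm, enorm_eq_nnnorm]
          exact_mod_cast h3
        have h5 : strichartzNorm (Set.Icc a b) (fun t => φ t - χ t)
            ≤ 10 * 2 ^ (k + 1) * ‖φ 0 - χ 0‖ₑ := by
          refine s2.trans ?_
          calc 10 * ‖φ t₀ - χ t₀‖ₑ ≤ 10 * (2 ^ k * ‖φ 0 - χ 0‖ₑ) := by gcongr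
            _ ≤ 10 * (2 ^ (k + 1) * ‖φ 0 - χ 0‖ₑ) := by
                gcongr
                · norm_num
                · exact Nat.le_succ k
            _ = _ := by ring
        have h6 := ENNReal.rpow_le_rpow h5 (show (0 : ℝ) ≤ 8 / 3 by norm_num)
        rwa [strichartzNorm, mixedNorm_rpow] at h6
    obtain ⟨p1, p2⟩ := hpiece r (r + τ) r (by linarith)
      (Set.Icc_subset_Icc (by linarith) hk) ⟨le_rfl, by linarith⟩ ⟨by linarith, le_rfl⟩
    obtain ⟨m1, m2⟩ := hpiece (-(r + τ)) (-r) (-r) (by linarith)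
      (Set.Icc_subset_Icc (by linarith) (by linarith)) ⟨by linarith, le_rfl⟩ ⟨le_rfl, by linarith⟩
    have hcover : Set.Icc (-(r + τ)) (r + τ)
        = (Set.Icc (-(r + τ)) (-r) ∪ Set.Icc (-r) r) ∪ Set.Icc r (r + τ) := by
      rw [Set.Icc_union_Icc_eq_Icc (by linarith) (by linarith),
        Set.Icc_union_Icc_eq_Icc (by linarith) (by linarith)]
    have hgrow : (2 : ℝ) ^ k * ‖φ 0 - χ 0‖ ≤ 2 ^ (k + 1) * ‖φ 0 - χ 0‖ := by
      gcongr
      · norm_num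
      · exact Nat.le_succ k
    rw [hcover]
    refine ⟨fun t ht => ?_, ?_⟩
    · rcases ht with (ht | ht) | ht
      · exact m1 t ht
      · exact (ih1 t ht).trans hgrow
      · exact p1 t ht
    · have ih3 : ∫⁻ t in Set.Icc (-r) r, norm4 (fun t => φ t - χ t) t ^ (8 / 3 : ℝ)
          ≤ 2 * k * (10 * 2 ^ (k + 1) * ‖φ 0 - χ 0‖ₑ) ^ (8 / 3 : ℝ) := by
        refine ih2.trans ?_
        gcongr
        · norm_num
        · exact Nat.le_succ k
      refine (lintegral_union_le _ _ _).trans ((add_le_add ((lintegral_union_le _ _ _).trans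
        (add_le_add m2 ih3)) p2).trans (le_of_eq ?_))
      push_cast
      ring

theorem exists_dependence {f : ℝ → RealL2} (hf : Continuous f) (M : ℝ≥0) {T : ℝ} (hT : 0 ≤ T) :
    ∃ C : ℝ≥0, ∀ φ χ : ℝ → L2, IsMild f (-T) T φ → IsMild f (-T) T χ → ‖φ 0‖ₑ ≤ M → ‖χ 0‖ₑ ≤ M →
      (∀ t ∈ Set.Icc (-T) T, ‖φ t - χ t‖ ≤ C * ‖φ 0 - χ 0‖) ∧
      ∫⁻ t in Set.Icc (-T) T, norm4 (fun t => φ t - χ t) t ^ (8 / 3 : ℝ)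
        ≤ C * (C * ‖φ 0 - χ 0‖ₑ) ^ (8 / 3 : ℝ) := by
  obtain ⟨A, hA⟩ := exists_enorm_le_on_Icc hf (-T) T
  obtain ⟨N, τ, hτ, hNT, hshort⟩ := exists_nat_step A M hT
  refine ⟨max (2 * N) (10 * 2 ^ N), fun φ χ h h' hM hM' => ?_⟩
  obtain ⟨h1, h2⟩ := h.dependence_step hf h' hA hM hM' hτ hshort N hNT.le
  rw [hNT] at h1 h2
  refine ⟨fun t ht => (h1 t ht).trans ?_, h2.trans ?_⟩
  · gcongr
    refine le_trans ?_ (NNReal.coe_le_coe.mpr (le_max_right _ _))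
    push_cast
    linarith [pow_pos (show (0 : ℝ) < 2 by norm_num) N]
  · gcongr
    · exact_mod_cast le_max_left (2 * N : ℝ≥0) (10 * 2 ^ N)
    · exact_mod_cast le_max_right (2 * N : ℝ≥0) (10 * 2 ^ N)

/-! ### Solutions and the interaction picture -/

theorem freeFlow_sub_nonlin (f : ℝ → RealL2) (φ : ℝ → L2) (t s : ℝ) :
    freeFlow (t - s) (nonlin (f s) (freeFlow s (φ s))) = Complex.I • freeFlow t (source f φ s) := by
  rw [source, freeFlow_smul, freeFlow_freeFlow, smul_smul, ← sub_eq_add_neg]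
  simp

theorem ae_norm4_lt_top_of_forall {φ : ℝ → L2} (hφ : Continuous φ)
    (h : ∀ T : ℝ, strichartzNorm (Set.Icc (-T) T) φ < ∞) : ∀ᵐ s : ℝ, norm4 φ s < ∞ := by
  have h1 : ∀ n : ℕ, ∀ᵐ s : ℝ, s ∈ Set.Icc (-(n : ℝ)) n → norm4 φ s < ∞ := fun n =>
    (ae_restrict_iff' measurableSet_Icc).mp (ae_norm4_lt_top hφ (h n))
  filter_upwards [ae_all_iff.mpr h1] with s hs
  obtain ⟨n, hn⟩ := exists_nat_gt |s|
  exact hs n (abs_le.mp hn.le)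

theorem mem_Icc_abs {T t : ℝ} (h : |t| ≤ T) : Set.uIcc 0 t ⊆ Set.Icc (-T) T :=
  Set.uIcc_subset_Icc ⟨by linarith [abs_nonneg t], by linarith [abs_nonneg t]⟩ (abs_le.mp h)

theorem IsSolution.isMild {f : ℝ → RealL2} (hf : Continuous f) {ψ₀ : L2} {ψ : ℝ → L2}
    (h : IsSolution f ψ₀ ψ) (T : ℝ) : IsMild f (-T) T fun t => freeFlow (-t) (ψ t) := by
  set φ : ℝ → L2 := fun t => freeFlow (-t) (ψ t) with hφ
  have hψφ : ∀ t, freeFlow t (φ t) = ψ t := fun t => freeFlow_freeFlow_neg t (ψ t)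
  have hc : Continuous φ := continuous_freeFlow_comp continuous_neg h.continuous
  have hfin : ∀ T : ℝ, strichartzNorm (Set.Icc (-T) T) φ < ∞ := fun T => by
    simp only [strichartzNorm, hψφ]
    exact ENNReal.rpow_lt_top_of_nonneg (by norm_num) (h.strichartz T).ne
  wlog hT : 0 ≤ T generalizing T
  · exact (this 0 le_rfl).mono (by rw [Set.Icc_eq_empty (by linarith)]; exact Set.empty_subset _)
  obtain ⟨N, hN, -, hduh⟩ := h.duhamel
  -- Finite Strichartz norms make `ψ s` lie in `L⁴` for almost every `s`, so the `N` in the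
  -- definition of a solution agrees almost everywhere with `nonlin`.
  have hNn : ∀ᵐ s : ℝ, N s = nonlin (f s) (freeFlow s (φ s)) := by
    filter_upwards [hN, ae_norm4_lt_top_of_forall hc hfin] with s h1 h2
    refine Lp.ext (h1.trans ?_)
    rw [← hψφ s]
    exact (nonlin_coe (f s) h2).symm
  have h0 : φ 0 = ψ₀ := by rw [hφ]; simp only [neg_zero, freeFlow_zero, h.initial]
  refine IsMild.of_base hf hc (hfin T) (t₀ := 0) ⟨by linarith, hT⟩ fun t ht => ?_
  have hi : IntervalIntegrable (source f φ) volume 0 t :=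
    intervalIntegrable_of_Icc (integrableOn_source_Icc hf hc (hfin T)) ⟨by linarith, hT⟩ ht
  have e1 : ∫ s in (0 : ℝ)..t, freeFlow (t - s) (N s)
      = Complex.I • freeFlow t (∫ s in (0 : ℝ)..t, source f φ s) := by
    rw [freeFlow_intervalIntegral hi, ← intervalIntegral.integral_smul]
    refine intervalIntegral.integral_congr_ae ?_
    filter_upwards [hNn] with s hs _
    rw [hs, freeFlow_sub_nonlin]
  have e2 := (hduh t).2
  rw [e1, smul_smul, Complex.I_mul_I, neg_one_smul, sub_neg_eq_add, ← freeFlow_add] at e2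
  rw [h0]
  change freeFlow (-t) (ψ t) - ψ₀ = _
  rw [e2, freeFlow_neg_freeFlow, add_sub_cancel_left]

theorem isSolution_of_isMild {f : ℝ → RealL2} (hf : Continuous f) {φ : ℝ → L2}
    (h : ∀ T, IsMild f (-T) T φ) : IsSolution f (φ 0) fun t => freeFlow t (φ t) := by
  have hc : Continuous φ := (h 0).continuous
  have hi : ∀ T, IntegrableOn (source f φ) (Set.Icc (-T) T) := fun T => (h T).integrableOn hf
  refine ⟨continuous_freeFlow_self hc, fun T => lintegral_lt_top_of_mixedNorm (h T).finite,
    fun s => nonlin (f s) (freeFlow s (φ s)), ?_, ?_, fun t => ?_⟩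
  · filter_upwards [ae_norm4_lt_top_of_forall hc fun T => (h T).finite] with s hs
    exact nonlin_coe (f s) hs
  · refine locallyIntegrable_iff.mpr fun K hK => ?_
    obtain ⟨T, hT⟩ := hK.isBounded.subset_closedBall 0
    rw [Real.closedBall_eq_Icc, zero_sub, zero_add] at hT
    refine IntegrableOn.mono_set ?_ hT
    refine ⟨(aestronglyMeasurable_nonlin hf (continuous_freeFlow_self hc)).restrict, ?_⟩
    have := (hi T).2
    simpa only [HasFiniteIntegral, enorm_source_eq] using this
  · have hit : IntervalIntegrable (source f φ) volume 0 t :=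
      ((hi |t|).mono_set (mem_Icc_abs le_rfl)).intervalIntegrable
    simp only [freeFlow_sub_nonlin]
    have hit' : IntervalIntegrable (fun s => freeFlow t (source f φ s)) volume 0 t :=
      ⟨integrable_freeFlow hit.1 t, integrable_freeFlow hit.2 t⟩
    refine ⟨hit'.smul Complex.I, ?_⟩
    rw [intervalIntegral.integral_smul, ← freeFlow_intervalIntegral hit, smul_smul,
      Complex.I_mul_I, neg_one_smul, sub_neg_eq_add, ← freeFlow_add,
      ← (h |t|).eq 0 (mem_Icc_abs le_rfl Set.left_mem_uIcc) t (mem_Icc_abs le_rfl Set.right_mem_uIcc),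
      add_sub_cancel]

theorem existsUnique_isSolution {f : ℝ → RealL2} (hf : Continuous f) (ψ₀ : L2) :
    ∃! ψ : ℝ → L2, IsSolution f ψ₀ ψ := by
  obtain ⟨φ, h0, hφ⟩ := exists_isMild_global hf ψ₀
  refine existsUnique_of_exists_of_unique ⟨_, h0 ▸ isSolution_of_isMild hf hφ⟩ fun ψ χ h h' => ?_
  funext t
  have h1 := (h.isMild hf |t|).unique hf (h'.isMild hf |t|) (t₀ := 0)
    (mem_Icc_abs le_rfl Set.left_mem_uIcc) (by simp only [h.initial, h'.initial]) t
    (mem_Icc_abs le_rfl Set.right_mem_uIcc)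
  simpa only [freeFlow_freeFlow_neg] using congrArg (freeFlow t) h1

theorem IsSolution.continuousDependence {f : ℝ → RealL2} (hf : Continuous f) {ψ₀ : L2}
    {ψ : ℝ → L2} (h : IsSolution f ψ₀ ψ) (T : ℝ) {ε : ℝ≥0} (hε : 0 < ε) :
    ∃ δ : ℝ, 0 < δ ∧ ∀ (φ₀ : L2) (φ : ℝ → L2), IsSolution f φ₀ φ → ‖φ₀ - ψ₀‖ < δ →
      (∀ t ∈ Set.Icc (-T) T, ‖φ t - ψ t‖ < ε) ∧
      strichartzIntegral T (fun t => φ t - ψ t) < ε := by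
  -- The definition allows negative `T`, for which the interval is empty.
  set S := max T 0 with hS
  have hTS : Set.Icc (-T) T ⊆ Set.Icc (-S) S :=
    Set.Icc_subset_Icc (neg_le_neg (le_max_left _ _)) (le_max_left _ _)
  obtain ⟨C, hC⟩ := exists_dependence hf (‖ψ₀‖₊ + 1) (le_max_right T 0)
  have hε' : (0 : ℝ) < ε := by exact_mod_cast hε
  have h1 : ∀ᶠ x : ℝ in 𝓝 0, C * x < ε :=
    ((continuous_const.mul continuous_id).tendsto' (0 : ℝ) 0 (by simp)).eventually_lt_const hε'
  have h2 : ∀ᶠ x : ℝ in 𝓝 0, C * (C * x) ^ (8 / 3 : ℝ) < ε := by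
    have hc : Continuous fun x : ℝ => C * (C * x) ^ (8 / 3 : ℝ) :=
      continuous_const.mul ((continuous_const.mul continuous_id).rpow_const
        fun _ => Or.inr (by norm_num))
    refine (hc.tendsto' 0 0 ?_).eventually_lt_const hε'
    rw [mul_zero, Real.zero_rpow (by norm_num), mul_zero]
  obtain ⟨δ, hδ, hsmall⟩ := Metric.eventually_nhds_iff.mp (h1.and h2)
  -- Distance below `1` keeps both masses under `‖ψ₀‖ + 1`, the bound for which `C` was chosen
  -- before `δ`.
  refine ⟨min δ 1, lt_min hδ one_pos, fun φ₀ φ hφ hd => ?_⟩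
  obtain ⟨s1, s2⟩ := hsmall (y := ‖φ₀ - ψ₀‖) (by
    rw [Real.dist_eq, sub_zero, abs_norm]
    exact hd.trans_le (min_le_left _ _))
  have i1 : freeFlow (-0) (φ 0) = φ₀ := by rw [neg_zero, freeFlow_zero, hφ.initial]
  have i2 : freeFlow (-0) (ψ 0) = ψ₀ := by rw [neg_zero, freeFlow_zero, h.initial]
  have m1 : ‖φ₀‖ₑ ≤ ((‖ψ₀‖₊ + 1 : ℝ≥0) : ℝ≥0∞) := by
    rw [enorm_eq_nnnorm, ENNReal.coe_le_coe, ← NNReal.coe_le_coe]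
    push_cast
    have e := norm_add_le ψ₀ (φ₀ - ψ₀)
    rw [add_sub_cancel] at e
    linarith [hd.trans_le (min_le_right δ 1)]
  have m2 : ‖ψ₀‖ₑ ≤ ((‖ψ₀‖₊ + 1 : ℝ≥0) : ℝ≥0∞) := by
    rw [enorm_eq_nnnorm, ENNReal.coe_le_coe]
    exact le_self_add
  obtain ⟨d1, d2⟩ := hC _ _ (hφ.isMild hf S) (h.isMild hf S) (by rwa [i1]) (by rwa [i2])
  simp only [i1, i2] at d1 d2
  refine ⟨fun t ht => ?_, ?_⟩
  · have e := d1 t (hTS ht)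
    rw [← freeFlow_sub, norm_freeFlow] at e
    exact e.trans_lt s1
  · have e : ∀ t, norm4 (fun t => freeFlow (-t) (φ t) - freeFlow (-t) (ψ t)) t
        = eLpNorm (φ t - ψ t : L2) 4 volume := fun t => by
      rw [norm4, freeFlow_sub, freeFlow_freeFlow_neg, freeFlow_freeFlow_neg]
    simp only [e] at d2
    refine (lintegral_mono_set hTS).trans_lt (d2.trans_lt ?_)
    have e2 : (C : ℝ≥0∞) * (C * ‖φ₀ - ψ₀‖ₑ) ^ (8 / 3 : ℝ)
        = ENNReal.ofReal (C * (C * ‖φ₀ - ψ₀‖) ^ (8 / 3 : ℝ)) := by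
      rw [ENNReal.ofReal_mul (by positivity), ← ENNReal.ofReal_rpow_of_nonneg (by positivity)
        (by norm_num), ENNReal.ofReal_mul (by positivity), ENNReal.ofReal_coe_nnreal, ofReal_norm]
    rw [e2, ← ENNReal.ofReal_coe_nnreal (p := ε)]
    exact (ENNReal.ofReal_lt_ofReal_iff hε').mpr s2

/-! ### Boundedness for integrable data -/

theorem lintegral_decay_lt_top {δ : ℝ} (hδ : 0 < δ) :
    ∫⁻ r in {r : ℝ | δ ≤ |r|}, ENNReal.ofReal ((4 * Real.pi * |r|) ^ (-(3 / 2) : ℝ)) < ∞ := by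
  -- For `|r| ≥ δ` one has `1 + |r| ≤ |r| (1/δ + 1)`, which compares the kernel with the integrable
  -- function `(1 + |r|)^{-3/2}`.
  set q : ℝ := 4 * Real.pi / (1 / δ + 1) with hq
  have hq0 : 0 < q := by positivity
  have hm : MeasurableSet {r : ℝ | δ ≤ |r|} := measurableSet_le measurable_const measurable_norm
  have hle : ∀ r ∈ {r : ℝ | δ ≤ |r|}, ENNReal.ofReal ((4 * Real.pi * |r|) ^ (-(3 / 2) : ℝ))
      ≤ ENNReal.ofReal (q ^ (-(3 / 2) : ℝ)) * ENNReal.ofReal ((1 + ‖r‖) ^ (-(3 / 2) : ℝ)) := by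
    intro r hr
    rw [Set.mem_ofPred_eq] at hr
    rw [← ENNReal.ofReal_mul (by positivity), ← Real.mul_rpow hq0.le (by positivity)]
    refine ENNReal.ofReal_le_ofReal (Real.rpow_le_rpow_of_nonpos (by positivity) ?_ (by norm_num))
    have h1 : 1 + ‖r‖ ≤ |r| * (1 / δ + 1) := by
      rw [Real.norm_eq_abs, mul_add, mul_one, mul_one_div]
      gcongr
      exact (one_le_div hδ).mpr hr
    rw [hq, div_mul_eq_mul_div, div_le_iff₀ (by positivity), mul_assoc (4 * Real.pi)]
    exact mul_le_mul_of_nonneg_left h1 (by positivity)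
  refine (setLIntegral_mono' hm hle).trans_lt ((setLIntegral_le_lintegral _ _).trans_lt ?_)
  rw [lintegral_const_mul' _ _ ENNReal.ofReal_ne_top]
  refine ENNReal.mul_lt_top ENNReal.ofReal_lt_top ?_
  exact finite_integral_one_add_norm (by rw [Module.finrank_self]; norm_num)

theorem eLpNorm_top_freeFlow_source_le_decay (f : ℝ → RealL2) (φ : ℝ → L2) {t s : ℝ} (hts : t ≠ s)
    {A M : ℝ≥0} (hA : ‖f s‖ₑ ≤ A) (hM : ‖φ s‖ₑ ≤ M) :
    eLpNorm (freeFlow t (source f φ s)) ∞ volume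
      ≤ ENNReal.ofReal ((4 * Real.pi * |t - s|) ^ (-(3 / 2) : ℝ)) * (A * M ^ 3 : ℝ≥0) := by
  have h1 : eLpNorm (nonlin (f s) (freeFlow s (φ s))) 1 volume ≤ (A * M ^ 3 : ℝ≥0) := by
    refine (eLpNorm_one_nonlin_le _ _).trans ?_
    rw [enorm_freeFlow, ENNReal.coe_mul, ENNReal.coe_pow]
    gcongr
  rw [source, freeFlow_smul, freeFlow_freeFlow, eLpNorm_smul_coe, enorm_neg,
    ← ofReal_norm Complex.I, Complex.norm_I, ENNReal.ofReal_one, one_mul, ← sub_eq_add_neg]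
  exact (eLpNorm_top_freeFlow_le (sub_ne_zero.mpr hts)
    ⟨Lp.aestronglyMeasurable _, h1.trans_lt ENNReal.coe_lt_top⟩).trans (by gcongr)

/-- Duhamel up to time `t₀`, followed by free evolution to `t`. All contributions originate at
distance at least `δ` from `t`, where the dispersive factor is integrable, and mass conservation
bounds the `L¹` norm of the nonlinearity. -/
theorem IsMild.eLpNorm_top_freeFlow_le {f : ℝ → RealL2} (hf : Continuous f) {T : ℝ} {φ : ℝ → L2}
    (h : IsMild f (-T) T φ) {A M : ℝ≥0} (hA : ∀ s, ‖f s‖ₑ ≤ A) (hM : ‖φ 0‖ₑ ≤ M)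
    (hM1 : eLpNorm (φ 0) 1 volume ≤ M) {δ : ℝ} (hδ : 0 < δ) {t t₀ : ℝ} (ht₀ : |t₀| ≤ T)
    (ht : δ ≤ |t|) (hs : ∀ s ∈ Set.uIoc 0 t₀, δ ≤ |t - s|) :
    eLpNorm (freeFlow t (φ t₀)) ∞ volume
      ≤ ENNReal.ofReal ((4 * Real.pi * δ) ^ (-(3 / 2) : ℝ)) * M
        + (∫⁻ r in {r : ℝ | δ ≤ |r|}, ENNReal.ofReal ((4 * Real.pi * |r|) ^ (-(3 / 2) : ℝ)))
          * (A * M ^ 3 : ℝ≥0) := by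
  set k : ℝ → ℝ≥0∞ := fun r => ENNReal.ofReal ((4 * Real.pi * |r|) ^ (-(3 / 2) : ℝ)) with hk
  set K := ∫⁻ r in {r : ℝ | δ ≤ |r|}, k r with hK
  have hKtop : K ≠ ∞ := (lintegral_decay_lt_top hδ).ne
  have hm : MeasurableSet {r : ℝ | δ ≤ |r|} := measurableSet_le measurable_const measurable_norm
  have hmem := mem_Icc_abs ht₀
  have h0 : (0 : ℝ) ∈ Set.Icc (-T) T := hmem Set.left_mem_uIcc
  have hi : IntervalIntegrable (source f φ) volume 0 t₀ :=
    intervalIntegrable_of_Icc (h.integrableOn hf) h0 (hmem Set.right_mem_uIcc)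
  have e : φ t₀ = φ 0 + ∫ s in (0 : ℝ)..t₀, source f φ s := by
    rw [← h.eq 0 h0 t₀ (hmem Set.right_mem_uIcc), add_sub_cancel]
  rw [e, freeFlow_add, freeFlow_intervalIntegral hi]
  refine (eLpNorm_add_coe_le ∞ (by simp) _ _).trans (add_le_add ?_ ?_)
  · have ht0 : t ≠ 0 := by
      rintro rfl
      rw [abs_zero] at ht
      linarith
    refine (Hartree.eLpNorm_top_freeFlow_le ht0
      ⟨Lp.aestronglyMeasurable _, hM1.trans_lt ENNReal.coe_lt_top⟩).trans ?_
    gcongr ?_ * ?_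
    refine ENNReal.ofReal_le_ofReal (Real.rpow_le_rpow_of_nonpos (by positivity) ?_ (by norm_num))
    gcongr
  · have hC : K * (A * M ^ 3 : ℝ≥0) = ((K.toNNReal * (A * M ^ 3) : ℝ≥0) : ℝ≥0∞) := by
      rw [ENNReal.coe_mul K.toNNReal, ENNReal.coe_toNNReal hKtop]
    rw [hC]
    refine eLpNorm_top_intervalIntegral_le
      (k := fun s => k (t - s) * (A * M ^ 3 : ℝ≥0))
      ⟨integrable_freeFlow hi.1 t, integrable_freeFlow hi.2 t⟩ ?_ ?_
    · filter_upwards [ae_restrict_mem measurableSet_uIoc] with s hsm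
      have hts : t ≠ s := by
        rintro rfl
        have := hs t hsm
        rw [sub_self, abs_zero] at this
        linarith
      refine eLpNorm_top_freeFlow_source_le_decay f φ hts (hA s) ?_
      rwa [← ofReal_norm, h.norm_eq hf h0 (hmem (Set.uIoc_subset_uIcc hsm)), ofReal_norm]
    · rw [← hC, lintegral_mul_const' _ _ ENNReal.coe_ne_top]
      gcongr
      calc ∫⁻ s in Set.uIoc 0 t₀, k (t - s)
          ≤ ∫⁻ s in Set.uIoc 0 t₀, {r : ℝ | δ ≤ |r|}.indicator k (t - s) := by
            refine setLIntegral_mono' measurableSet_uIoc fun s hsm => ?_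
            rw [Set.indicator_of_mem]
            exact hs s hsm
        _ ≤ ∫⁻ s, {r : ℝ | δ ≤ |r|}.indicator k (t - s) := setLIntegral_le_lintegral _ _
        _ = ∫⁻ s, {r : ℝ | δ ≤ |r|}.indicator k s := lintegral_sub_left_eq_self _ t
        _ = K := lintegral_indicator hm _

/-- The time `t₀` is `t` moved by `δ` towards `0`. Up to `t₀` dispersion bounds `e^{-itH₀}φ(t₀)` by
`B`; over the short interval from `t₀` to `t` the Galilean bound at most doubles it. Taking `δ ≤ c`
keeps `t₀` between `0` and `t`, and `δ ≤ τ` makes the last interval short. Neither `δ` nor `B`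
depends on `t`. -/
theorem exists_eLpNorm_top_le {f : ℝ → RealL2} (hf : Continuous f) {A : ℝ≥0}
    (hA : ∀ s, ‖f s‖ₑ ≤ A) {c : ℝ} (hc : 0 < c) (M : ℝ≥0) :
    ∃ C : ℝ≥0, ∀ φ : ℝ → L2, (∀ T, IsMild f (-T) T φ) → ‖φ 0‖ₑ ≤ M →
      eLpNorm (φ 0) 1 volume ≤ M → ∀ t : ℝ, c ≤ |t| →
        eLpNorm (freeFlow t (φ t)) ∞ volume ≤ C := by
  obtain ⟨τ, hτ, hshort⟩ := exists_isShort A M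
  set δ := min c τ with hδ
  have hδ0 : 0 < δ := lt_min hc hτ
  set B : ℝ≥0∞ := ENNReal.ofReal ((4 * Real.pi * δ) ^ (-(3 / 2) : ℝ)) * M
    + (∫⁻ r in {r : ℝ | δ ≤ |r|}, ENNReal.ofReal ((4 * Real.pi * |r|) ^ (-(3 / 2) : ℝ)))
      * (A * M ^ 3 : ℝ≥0) with hB
  have hBtop : B ≠ ∞ := ENNReal.add_ne_top.mpr
    ⟨ENNReal.mul_ne_top ENNReal.ofReal_ne_top ENNReal.coe_ne_top,
      ENNReal.mul_ne_top (lintegral_decay_lt_top hδ0).ne ENNReal.coe_ne_top⟩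
  refine ⟨2 * B.toNNReal, fun φ h hM hM1 t ht => ?_⟩
  have hδt : δ ≤ |t| := (min_le_left _ _).trans ht
  have key : ∀ a b t₀ : ℝ, Set.Icc a b ⊆ Set.Icc (-(|t|)) |t| → b - a ≤ τ → t₀ ∈ Set.Icc a b →
      t ∈ Set.Icc a b → (∀ s ∈ Set.uIoc 0 t₀, δ ≤ |t - s|) →
      eLpNorm (freeFlow t (φ t)) ∞ volume ≤ (2 * B.toNNReal : ℝ≥0) := by
    intro a b t₀ hss hab ht₀ htJ hs
    have hM' : ‖φ t₀‖ₑ ≤ M := by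
      rwa [← ofReal_norm, (h |t|).norm_eq hf (s := 0)
        ⟨by linarith [abs_nonneg t], abs_nonneg t⟩ (hss ht₀), ofReal_norm]
    refine ((h |t|).mono hss).eLpNorm_top_le hf ht₀ (fun s _ => hA s) (hshort a b hab) hM' ?_ htJ
    rw [ENNReal.coe_toNNReal hBtop]
    exact (h |t|).eLpNorm_top_freeFlow_le hf hA hM hM1 hδ0 (abs_le.mpr (hss ht₀)) hδt hs
  have hδτ : δ ≤ τ := min_le_right _ _
  rcases le_total 0 t with h0 | h0
  · rw [abs_of_nonneg h0] at hδt key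
    refine key (t - δ) t (t - δ) (Set.Icc_subset_Icc (by linarith) le_rfl) (by linarith)
      ⟨le_rfl, by linarith⟩ ⟨by linarith, le_rfl⟩ fun s hs => ?_
    rw [Set.uIoc_of_le (by linarith)] at hs
    exact le_trans (by linarith [hs.2]) (le_abs_self _)
  · rw [abs_of_nonpos h0] at hδt key
    refine key t (t + δ) (t + δ) (Set.Icc_subset_Icc (by linarith) (by linarith)) (by linarith)
      ⟨by linarith, le_rfl⟩ ⟨le_rfl, by linarith⟩ fun s hs => ?_
    rw [Set.uIoc_of_ge (by linarith)] at hs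
    exact le_trans (by linarith [hs.1]) (neg_le_abs _)

end Hartree

end

theorem mainTheorem7 (f : ℝ → Hartree.RealL2) (hf : Continuous f) :
    Hartree.GloballyWellPosed f ∧
    ((∃ A : ℝ, ∀ t : ℝ, ‖f t‖ ≤ A) →
      ∀ c : ℝ, 0 < c → ∀ M : ℝ≥0, ∃ C : ℝ≥0,
        ∀ (ψ₀ : Hartree.L2) (ψ : ℝ → Hartree.L2), Hartree.IsSolution f ψ₀ ψ →
          MemLp (ψ₀ : Hartree.Space → ℂ) 1 volume →
          eLpNorm (ψ₀ : Hartree.Space → ℂ) 1 volume ≤ M →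
          eLpNorm (ψ₀ : Hartree.Space → ℂ) 2 volume ≤ M →
          ∀ t : ℝ, c ≤ |t| → eLpNorm (ψ t : Hartree.Space → ℂ) ∞ volume ≤ C) := by
  refine ⟨⟨Hartree.existsUnique_isSolution hf,
    fun ψ₀ ψ h T ε hε => h.continuousDependence hf T hε⟩, ?_⟩
  rintro ⟨A, hA⟩ c hc M
  have hA' : ∀ s, ‖f s‖ₑ ≤ A.toNNReal := fun s => by
    rw [← ofReal_norm]
    exact ENNReal.ofReal_le_ofReal (hA s)
  obtain ⟨C, hC⟩ := Hartree.exists_eLpNorm_top_le hf hA' hc M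
  refine ⟨C, fun ψ₀ ψ h _ h1 h2 t ht => ?_⟩
  have h0 : Hartree.freeFlow (-0) (ψ 0) = ψ₀ := by
    rw [neg_zero, Hartree.freeFlow_zero, h.initial]
  have key := hC _ (h.isMild hf) (by rwa [h0, Lp.enorm_def]) (by rwa [h0]) t ht
  rwa [Hartree.freeFlow_freeFlow_neg] at key
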